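/- Let $q$ range over prime powers. For $n\ge 1$ equip $V=\mathbf F_{q^2}^n$ with the nondegenerate Hermitian form $\langle u,v\rangle=c\sum_{1\le i\le n}(-1)^{i+1}u_iv_{n+1-i}^q$, where $c\in\mathbf F_{q^2}$ satisfies $c^{q-1}=(-1)^{n+1}$. Let $GU_n(q)$ be the group of all linear automorphisms of $V$ preserving this form, acting on the poset $L_n^-(\mathbf F_q)^*=\{0\subsetneq U\subsetneq V\mid U\subseteq U^\perp\}$ of nontrivial totally isotropic subspaces. Let $GL_n(q)$ be the group of all linear automorphisms of $\mathbf F_q^n$, acting on the poset $L_n^+(\mathbf F_q)^*$ of nontrivial proper subspaces of $\mathbf F_q^n$. For a finite poset $P$ let $\widetilde\chi(P)=\sum_{d\ge -1}(-1)^dc_d(P)$, where $c_d(P)$ is the number of chains in $P$ with $d+1$ elements (so $c_{-1}(P)=1$ and $\widetilde\chi(\emptyset)=-1$). For a finite group $G$ acting on a finite poset $P$ and $r\ge 0$, the $r$th equivariant reduced Euler characteristic is $$\widetilde\chi_r(P,G)=\frac1{|G|}\sum_{X\in\mathrm{Hom}(\mathbf Z^r,G)}\widetilde\chi\big(\{x\in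 P\mid gx=x\text{ for all }g\in X(\mathbf Z^r)\}\big).$$ Write $\widetilde\chi_r(GU_n(q))=\widetilde\chi_r(L_n^-(\mathbf F_q)^*,GU_n(q))$, $\widetilde\chi_r(GL_n(q))=\widetilde\chi_r(L_n^+(\mathbf F_q)^*,GL_n(q))$, and $\mathrm{FGL}^-_r(x)=1-\sum_{n\ge1}\widetilde\chi_r(GU_n(q))x^n\in\mathbf Q[[x]]$. Then for every $r\ge 0$: (1) for every prime power $q$, $$\mathrm{FGL}^-_{r+1}(x)=\prod_{0\le j\le r}\big(1+(-1)^jq^{r-j}x\big)^{(-1)^j\binom rj};$$ (2) for every $n\ge1$ there is a polynomial $P\in\mathbf Z[t]$ such that, for every prime power $q$, $\widetilde\chi_{r+1}(GL_n(q))=P(q)$ and $$\widetilde\chi_{r+1}(GU_n(q))=-(-1)^{n(r+1)}P(-q).$$ In other words, $\widetilde\chi_{r+1}(GU_n(q))=-(-1)^{n(r+1)}\widetilde\chi_{r+1}(GL_n(-q))$, where $\widetilde\chi_{r+1}(GL_n(-q))$ denotes the polynomial $\widetilde\chi_{r+1}(GL_n(q))$ in $q$ evaluated at $-q$. -/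

import Mathlib

noncomputable section

namespace UnitaryBuilding

/-- The reduced Euler characteristic `∑_{d ≥ -1} (-1)^d c_d` of a finite poset `P`, where `c_d` is
the number of `d`-simplices, i.e. of chains with `d + 1` elements. The empty chain is the unique
simplex of dimension `-1`. -/
def reducedEulerChar (P : Type*) [PartialOrder P] [Finite P] : ℤ :=
  ∑ᶠ s : {s : Finset P // IsChain (· ≤ ·) (s : Set P)}, (-1 : ℤ) ^ (s.1.card + 1)

/-- A finite group receives only finitely many homomorphisms from the free abelian group `ℤ^r`, so
the sum in `equivariantEulerChar` is a finite one. -/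
instance finite_hom (r : ℕ) (G : Type*) [Group G] [Finite G] :
    Finite (Multiplicative (Fin r → ℤ) →* G) := by
  classical
  refine Finite.of_injective
    (fun (X : Multiplicative (Fin r → ℤ) →* G) (i : Fin r) =>
      X (Multiplicative.ofAdd (Pi.single i 1))) ?_
  intro X Y h
  let S : AddSubgroup (Fin r → ℤ) := Subgroup.toAddSubgroup' (X.eqLocus Y)
  have hS : ∀ z : Fin r → ℤ, z ∈ S := by
    intro z
    rw [← Finset.univ_sum_single z]
    refine sum_mem fun i _ => ?_
    have hi : Pi.single i (z i) = z i • (Pi.single i 1 : Fin r → ℤ) := by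
      rw [← Pi.single_smul, smul_eq_mul, mul_one]
    rw [hi]
    exact S.zsmul_mem (congrFun h i) _
  exact MonoidHom.ext fun z => hS z.toAdd

/-- The `r`th equivariant reduced Euler characteristic of the finite `G`-poset `P`: the sum, over
all homomorphisms `X : ℤ^r → G`, of the reduced Euler characteristics of the induced subposets of
`X(ℤ^r)`-fixed elements of `P`, divided by the order of `G`. -/
def equivariantEulerChar (r : ℕ) (P : Type*) (G : Type*) [PartialOrder P] [Finite P] [Group G]
    [Finite G] [MulAction G P] : ℚ :=
  (∑ᶠ X : Multiplicative (Fin r → ℤ) →* G,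
    (reducedEulerChar {x : P // ∀ z, X z • x = x} : ℚ)) / (Nat.card G : ℚ)

section Unitary

variable {F : Type*} [Field F]

/-- The form `⟨u, v⟩ = c ∑_{1 ≤ i ≤ n} (-1)^{i+1} u_i v_{n+1-i}^q` on `F^n`. The coordinates are
indexed by `0, …, n - 1` here, so the sign of the term with index `i` is `(-1)^i`. -/
def hermForm (q n : ℕ) (c : F) (u v : Fin n → F) : F :=
  c * ∑ i : Fin n, (-1) ^ (i : ℕ) * u i * v i.rev ^ q

/-- The general unitary group: all linear automorphisms of `F^n` that preserve the form. -/
def GU (q n : ℕ) (c : F) : Subgroup ((Fin n → F) ≃ₗ[F] (Fin n → F)) where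
  carrier := {g | ∀ u v, hermForm q n c (g u) (g v) = hermForm q n c u v}
  mul_mem' {g h} hg hh u v := by
    rw [LinearEquiv.mul_apply, LinearEquiv.mul_apply, hg, hh]
  one_mem' _ _ := rfl
  inv_mem' {g} hg u v := by
    have h := hg (g⁻¹ u) (g⁻¹ v)
    rw [← LinearEquiv.mul_apply, ← LinearEquiv.mul_apply, mul_inv_cancel] at h
    exact h.symm

/-- The poset of nontrivial totally isotropic subspaces: `0 ⊊ U ⊊ F^n` with `U ⊆ U^⊥`, ordered by
inclusion. -/
def IsotropicPoset (q n : ℕ) (c : F) : Type _ :=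
  {U : Submodule F (Fin n → F) // ⊥ < U ∧ U < ⊤ ∧ ∀ u ∈ U, ∀ v ∈ U, hermForm q n c u v = 0}

instance isotropic_partialOrder (q n : ℕ) (c : F) : PartialOrder (IsotropicPoset q n c) :=
  inferInstanceAs (PartialOrder (Subtype fun _ : Submodule F (Fin n → F) => _))

instance isotropic_finite [Finite F] (q n : ℕ) (c : F) : Finite (IsotropicPoset q n c) :=
  inferInstanceAs (Finite (Subtype fun _ : Submodule F (Fin n → F) => _))

instance finite_autGroup [Finite F] (n : ℕ) : Finite ((Fin n → F) ≃ₗ[F] (Fin n → F)) :=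
  Finite.of_injective (fun g => (g : (Fin n → F) → (Fin n → F))) DFunLike.coe_injective

theorem map_ne_bot_lt_top {n : ℕ} (g : (Fin n → F) ≃ₗ[F] (Fin n → F))
    {U : Submodule F (Fin n → F)} (h₁ : ⊥ < U) (h₂ : U < ⊤) :
    ⊥ < U.map (g : (Fin n → F) →ₗ[F] (Fin n → F)) ∧
      U.map (g : (Fin n → F) →ₗ[F] (Fin n → F)) < ⊤ := by
  constructor
  · have h := (Submodule.orderIsoMapComap g).strictMono h₁
    simpa using h
  · have h := (Submodule.orderIsoMapComap g).strictMono h₂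
    simpa using h

/-- The general unitary group acts on totally isotropic subspaces by taking images. -/
instance isotropic_mulAction (q n : ℕ) (c : F) : MulAction (GU q n c) (IsotropicPoset q n c) where
  smul g U := ⟨U.1.map (g.1 : (Fin n → F) →ₗ[F] (Fin n → F)),
    (map_ne_bot_lt_top g.1 U.2.1 U.2.2.1).1, (map_ne_bot_lt_top g.1 U.2.1 U.2.2.1).2, by
      rintro _ ⟨u, hu, rfl⟩ _ ⟨v, hv, rfl⟩
      exact (g.2 u v).trans (U.2.2.2 u hu v hv)⟩
  one_smul U := Subtype.ext (Submodule.map_id U.1)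
  mul_smul _ _ U := Subtype.ext (Submodule.map_comp _ _ U.1)

/-- The `r`th equivariant reduced Euler characteristic of the `GU_n(q)`-poset of nontrivial totally
isotropic subspaces. -/
def chiGU [Finite F] (r q n : ℕ) (c : F) : ℚ :=
  equivariantEulerChar r (IsotropicPoset q n c) (GU q n c)

/-- The generating function `1 - ∑_{n ≥ 1} χ̃_r(GU_n(q)) x^n`; `c n` is the constant in the
Hermitian form on `F^n`. -/
def FGLminus [Finite F] (r q : ℕ) (c : ℕ → F) : PowerSeries ℚ :=
  1 - PowerSeries.mk fun n => if n = 0 then 0 else chiGU r q n (c n)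

end Unitary

section Linear

variable (K : Type*) [Field K]

/-- The poset of nontrivial proper subspaces of `K^n`, ordered by inclusion. -/
def SubspacePoset (n : ℕ) : Type _ :=
  {U : Submodule K (Fin n → K) // ⊥ < U ∧ U < ⊤}

instance subspace_partialOrder (n : ℕ) : PartialOrder (SubspacePoset K n) :=
  inferInstanceAs (PartialOrder (Subtype fun _ : Submodule K (Fin n → K) => _))

instance subspace_finite [Finite K] (n : ℕ) : Finite (SubspacePoset K n) :=
  inferInstanceAs (Finite (Subtype fun _ : Submodule K (Fin n → K) => _))

/-- The general linear group acts on subspaces by taking images. -/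
instance subspace_mulAction (n : ℕ) : MulAction ((Fin n → K) ≃ₗ[K] (Fin n → K)) (SubspacePoset K n) where
  smul g U := ⟨U.1.map (g : (Fin n → K) →ₗ[K] (Fin n → K)), map_ne_bot_lt_top g U.2.1 U.2.2⟩
  one_smul U := Subtype.ext (Submodule.map_id U.1)
  mul_smul _ _ U := Subtype.ext (Submodule.map_comp _ _ U.1)

/-- The `r`th equivariant reduced Euler characteristic of the `GL_n(K)`-poset of nontrivial proper
subspaces. -/
def chiGL [Finite K] (r n : ℕ) : ℚ :=
  equivariantEulerChar r (SubspacePoset K n) ((Fin n → K) ≃ₗ[K] (Fin n → K))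

end Linear

end UnitaryBuilding

end

namespace UnitaryBuilding

/-! A homomorphism from ℤ^(r+1) to G is a homomorphism X from ℤ^r together with an element g of the
centralizer of its image. Summing over g, Burnside's lemma turns the equivariant Euler
characteristic into a signed count of G-orbits of pairs (X, chain of X-stable subspaces). Here X may
be restricted to a conjugation-stable class outside which the fixed posets have Euler characteristic
zero (`equivariantEulerChar_succ_eq_sum`). View X as a module structure over the group algebra R of
ℤ^r. If the module is not semisimple, its socle S contracts the fixed poset: U ≥ U ∩ S ≤ S in the
linear case and, with N = S ∩ S^⊥ ≠ 0, U ≥ U ∩ N^⊥ ≤ (U ∩ N^⊥) + N ≥ N in the unitary case. So only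
semisimple modules matter.

A semisimple module with a chain of submodules is determined up to isomorphism by the multiplicities
of the simple modules R/m, that is, by finitely supported functions on the maximal ideals, weighted
by residue degree. Hence the linear Euler characteristic is the sum, over all M of weight n, of the
Euler characteristics of the open intervals 0 < N < M (`chiGL_succ_eq_sum`). In the unitary case R
has an involution τ inverting group elements and raising scalars to the q-th power. Now M has to be
τ-invariant, and isotropic submodules correspond to N with N + τN ≤ M. Uniqueness is Witt's theorem
for semisimple Hermitian modules (`IsHerm.exists_isometry_comp_eq`), which uses surjectivity of
norms of finite fields; existence is `IsSesqPair.exists_hermModel`. Together they give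
`chiGU_succ_eq_sum`.

The rest is counting. Let A be the generating function of all M by weight and B that of the
τ-invariant M. The recursion χ̃(P) = -1 - Σ_x χ̃(P_{>x}) shows that the linear series is 1/A(x) and
the unitary one is B(x)/A(x²). The logarithmic derivatives count torsion points of a torus over the
algebraic closure. For A the k-th coefficient is (|F|^k - 1)^r. For B over the field with q²
elements it is (q^k - 1)^r for even k and (q^k + 1)^r for odd k, because self-dual maximal ideals
have odd degree. Thus the unitary series has coefficients -(q^k - 1)^r for even k and (q^k + 1)^r
for odd k, and the binomial theorem recognizes the alternating product. Replacing q by -q in the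
linear product amounts to rescaling x by (-1)^(r+1) in the unitary one, which is the second claim.
-/

open scoped Classical in
/-- The finset of all chains of a finite poset. -/
noncomputable def chains (P : Type*) [PartialOrder P] [Fintype P] : Finset (Finset P) :=
  Finset.univ.filter fun s => IsChain (· ≤ ·) (s : Set P)

/-! ### Euler characteristics of finite posets. -/

section Poset

variable {P Q : Type*} [PartialOrder P] [PartialOrder Q]

theorem mem_chains [Fintype P] {s : Finset P} :
    s ∈ chains P ↔ IsChain (· ≤ ·) (s : Set P) := by
  simp [chains]

theorem reducedEulerChar_eq_sum [Fintype P] :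
    reducedEulerChar P = ∑ s ∈ chains P, (-1 : ℤ) ^ (s.card + 1) := by
  classical
  rw [reducedEulerChar, finsum_eq_sum_of_fintype, chains]
  exact (Finset.sum_subtype (Finset.univ.filter fun s : Finset P => IsChain (· ≤ ·) (s : Set P))
    (by simp) (fun s => (-1 : ℤ) ^ (s.card + 1))).symm

theorem isChain_map_iff (e : P ↪o Q) (s : Finset P) :
    IsChain (· ≤ ·) ((s.map e.toEmbedding : Finset Q) : Set Q) ↔
      IsChain (· ≤ ·) (s : Set P) := by
  rw [Finset.coe_map]
  constructor
  · intro h x hx y hy hxy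
    have := h (Set.mem_image_of_mem _ hx) (Set.mem_image_of_mem _ hy)
      (fun h' => hxy (e.injective h'))
    simpa using this
  · rintro h _ ⟨x, hx, rfl⟩ _ ⟨y, hy, rfl⟩ hxy
    have := h hx hy (fun h' => hxy (by rw [h']))
    simpa using this

theorem reducedEulerChar_congr [Finite P] [Finite Q] (e : P ≃o Q) :
    reducedEulerChar P = reducedEulerChar Q := by
  classical
  have := Fintype.ofFinite P
  have := Fintype.ofFinite Q
  rw [reducedEulerChar_eq_sum, reducedEulerChar_eq_sum]
  refine Finset.sum_bij' (fun s _ => s.map e.toOrderEmbedding.toEmbedding)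
    (fun s _ => s.map e.symm.toOrderEmbedding.toEmbedding) ?_ ?_ ?_ ?_ ?_
  · intro s hs
    rw [mem_chains] at hs ⊢
    rwa [isChain_map_iff]
  · intro s hs
    rw [mem_chains] at hs ⊢
    rwa [isChain_map_iff]
  · intro s _
    ext x
    simp
  · intro s _
    ext x
    simp
  · intro s _
    simp

theorem reducedEulerChar_orderDual [Finite P] :
    reducedEulerChar Pᵒᵈ = reducedEulerChar P := by
  classical
  have := Fintype.ofFinite P
  rw [reducedEulerChar_eq_sum, reducedEulerChar_eq_sum]
  refine Finset.sum_bij' (fun s _ => s.map OrderDual.ofDual.toEmbedding)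
    (fun s _ => s.map OrderDual.toDual.toEmbedding) ?_ ?_ ?_ ?_ ?_
  · intro s hs
    rw [mem_chains] at hs ⊢
    rw [Finset.coe_map]
    rintro _ ⟨x, hx, rfl⟩ _ ⟨y, hy, rfl⟩ hxy
    exact (hs hx hy (fun h' => hxy (by rw [h']))).symm
  · intro s hs
    rw [mem_chains] at hs ⊢
    rw [Finset.coe_map]
    rintro _ ⟨x, hx, rfl⟩ _ ⟨y, hy, rfl⟩ hxy
    exact (hs hx hy (fun h' => hxy (by rw [h']))).symm
  · intro s _
    ext x
    simp
  · intro s _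
    ext x
    simp
  · intro s _
    simp

open scoped Classical in
theorem reducedEulerChar_subtype [Fintype P] (p : P → Prop) :
    reducedEulerChar {x // p x} =
      ∑ s ∈ chains P with ∀ x ∈ s, p x, (-1 : ℤ) ^ (s.card + 1) := by
  rw [reducedEulerChar_eq_sum]
  refine Finset.sum_bij' (fun s _ => s.map (Function.Embedding.subtype p))
    (fun s _ => s.subtype p) ?_ ?_ ?_ ?_ ?_
  · intro s hs
    rw [Finset.mem_filter, mem_chains]
    refine ⟨(isChain_map_iff (OrderEmbedding.subtype p) s).2 (mem_chains.1 hs), ?_⟩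
    intro x hx
    exact Finset.property_of_mem_map_subtype s hx
  · intro s hs
    rw [Finset.mem_filter, mem_chains] at hs
    rw [mem_chains]
    intro x hx y hy hxy
    exact hs.1 (Finset.mem_subtype.1 hx) (Finset.mem_subtype.1 hy)
      (fun h => hxy (Subtype.ext h))
  · intro s _
    ext x
    simpa using fun _ => x.2
  · intro s hs
    rw [Finset.mem_filter] at hs
    exact Finset.subtype_map_of_mem hs.2
  · intro s _
    simp

theorem exists_least_of_isChain {s : Finset P} (hs : IsChain (· ≤ ·) (s : Set P))
    (hne : s.Nonempty) : ∃ x ∈ s, ∀ y ∈ s, x ≤ y := by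
  obtain ⟨x, hx⟩ := s.exists_minimal hne
  refine ⟨x, hx.1, fun y hy => ?_⟩
  rcases eq_or_ne x y with rfl | hxy
  · exact le_rfl
  · rcases hs hx.1 hy hxy with h | h
    · exact h
    · exact hx.2 hy h

/-- Decomposing the nonempty chains by their least element. -/
theorem reducedEulerChar_eq_sum_gt [Fintype P] :
    reducedEulerChar P = -1 - ∑ x : P, reducedEulerChar {y // x < y} := by
  classical
  have h1 : ∑ x : P, reducedEulerChar {y // x < y} =
      - ∑ s ∈ chains P with s.Nonempty, (-1 : ℤ) ^ (s.card + 1) := by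
    simp_rw [reducedEulerChar_subtype]
    rw [Finset.sum_sigma', ← Finset.sum_neg_distrib]
    -- A nonempty chain is its least element together with a chain strictly above it; the extra
    -- element flips the sign.
    refine Finset.sum_bij (fun a _ => insert a.1 a.2) ?_ ?_ ?_ ?_
    · rintro ⟨x, t⟩ h
      simp only [Finset.mem_sigma, Finset.mem_univ, true_and, Finset.mem_filter, mem_chains] at h ⊢
      refine ⟨?_, Finset.insert_nonempty _ _⟩
      rw [Finset.coe_insert]
      exact h.1.insert fun y hy _ => Or.inl (h.2 y hy).le
    · rintro ⟨x, t⟩ h ⟨x', t'⟩ h' heq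
      simp only [Finset.mem_sigma, Finset.mem_univ, true_and, Finset.mem_filter, mem_chains]
        at h h' heq
      have hx : x = x' := by
        have h3 : x ∈ insert x' t' := heq ▸ Finset.mem_insert_self x t
        have h4 : x' ∈ insert x t := heq ▸ Finset.mem_insert_self x' t'
        rcases Finset.mem_insert.1 h3 with h3 | h3
        · exact h3
        · rcases Finset.mem_insert.1 h4 with h4 | h4
          · exact h4.symm
          · exact absurd (h.2 _ h4) (h'.2 _ h3).asymm
      subst hx
      have hx1 : x ∉ t := fun hx => lt_irrefl _ (h.2 x hx)
      have hx2 : x ∉ t' := fun hx => lt_irrefl _ (h'.2 x hx)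
      have : t = t' := by
        rw [← Finset.erase_insert hx1, heq, Finset.erase_insert hx2]
      rw [this]
    · intro s hs
      rw [Finset.mem_filter, mem_chains] at hs
      obtain ⟨x, hx, hmin⟩ := exists_least_of_isChain hs.1 hs.2
      refine ⟨⟨x, s.erase x⟩, ?_, Finset.insert_erase hx⟩
      simp only [Finset.mem_sigma, Finset.mem_univ, true_and, Finset.mem_filter, mem_chains]
      refine ⟨hs.1.mono (by simp), fun y hy => ?_⟩
      rw [Finset.mem_erase] at hy
      exact lt_of_le_of_ne (hmin y hy.2) hy.1.symm
    · rintro ⟨x, t⟩ h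
      simp only [Finset.mem_sigma, Finset.mem_univ, true_and, Finset.mem_filter, mem_chains] at h
      have hx1 : x ∉ t := fun hx => lt_irrefl _ (h.2 x hx)
      simp only [Finset.card_insert_of_notMem hx1]
      ring
  have h2 : (chains P).filter (fun s => ¬ s.Nonempty) = {∅} := by
    ext s
    simp only [Finset.mem_filter, mem_chains, Finset.not_nonempty_iff_eq_empty,
      Finset.mem_singleton, and_iff_right_iff_imp]
    rintro rfl
    simp
  rw [reducedEulerChar_eq_sum, ← Finset.sum_filter_add_sum_filter_not _ (fun s => s.Nonempty),
    h2, h1]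
  simp [add_comm]

/-- A decreasing monotone idempotent self-map retracts the poset onto its fixed points without
changing the Euler characteristic. -/
theorem reducedEulerChar_retract_of_le [Finite P] (f : P → P) (hmono : Monotone f)
    (hle : ∀ x, f x ≤ x) (hidem : ∀ x, f (f x) = f x) :
    reducedEulerChar P = reducedEulerChar {x // f x = x} := by
  classical
  have := Fintype.ofFinite P
  -- Let `m` be the least element of the chain moved by `f`. Toggling `f m` does not change the set
  -- of moved elements, since `f m` is fixed. So `T` is an involution; it changes the parity of the
  -- size and cancels every chain that contains a moved element.
  let B : Finset P → Finset P := fun s => s.filter fun x => f x ≠ x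
  let T : Finset P → Finset P := fun s =>
    if h : ∃ m ∈ B s, ∀ y ∈ B s, m ≤ y then symmDiff s {f h.choose} else s
  have hB : ∀ (s : Finset P) (m : P), B (symmDiff s {f m}) = B s := by
    intro s m
    ext x
    simp only [B, Finset.mem_filter, Finset.mem_symmDiff, Finset.mem_singleton]
    constructor
    · rintro ⟨h | h, hx⟩
      · exact ⟨h.1, hx⟩
      · exact absurd (by rw [h.1, hidem]) hx
    · rintro ⟨h, hx⟩
      exact ⟨Or.inl ⟨h, fun h' => hx (by rw [h', hidem])⟩, hx⟩
  have hT : ∀ s ∈ chains P, (¬ ∀ x ∈ s, f x = x) → ∃ m ∈ B s, (∀ y ∈ B s, m ≤ y) ∧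
      T s = symmDiff s {f m} ∧ T (T s) = s := by
    intro s hs hne
    rw [mem_chains] at hs
    have hex : ∃ m ∈ B s, ∀ y ∈ B s, m ≤ y := by
      refine exists_least_of_isChain (hs.mono (Finset.coe_subset.2 (Finset.filter_subset _ s))) ?_
      push Not at hne
      obtain ⟨x, hx, hfx⟩ := hne
      exact ⟨x, Finset.mem_filter.2 ⟨hx, hfx⟩⟩
    have hTs : T s = symmDiff s {f hex.choose} := by
      simp only [T, dif_pos hex]
    have hTT : T (T s) = s := by
      rw [hTs]
      simp only [T, hB, dif_pos hex]
      rw [symmDiff_assoc, symmDiff_self, symmDiff_bot]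
    exact ⟨hex.choose, hex.choose_spec.1, hex.choose_spec.2, hTs, hTT⟩
  have hsign : ∀ (s : Finset P) (a : P),
      (-1 : ℤ) ^ (s.card + 1) + (-1) ^ ((symmDiff s {a}).card + 1) = 0 := by
    intro s a
    by_cases ha : a ∈ s
    · have h1 : symmDiff s {a} = s.erase a := by
        ext x
        simp only [Finset.mem_symmDiff, Finset.mem_singleton, Finset.mem_erase]
        constructor
        · rintro (h | ⟨rfl, h⟩)
          · exact ⟨h.2, h.1⟩
          · exact absurd ha h
        · rintro ⟨h1, h2⟩
          exact Or.inl ⟨h2, h1⟩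
      rw [h1, ← Finset.card_erase_add_one ha]
      ring
    · have h1 : symmDiff s {a} = insert a s := by
        ext x
        simp only [Finset.mem_symmDiff, Finset.mem_singleton, Finset.mem_insert]
        constructor
        · rintro (h | ⟨rfl, h⟩)
          · exact Or.inr h.1
          · exact Or.inl rfl
        · rintro (rfl | h)
          · exact Or.inr ⟨rfl, ha⟩
          · exact Or.inl ⟨h, fun h' => ha (h' ▸ h)⟩
      rw [h1, Finset.card_insert_of_notMem ha]
      ring
  have key : ∑ s ∈ chains P with ¬ ∀ x ∈ s, f x = x, (-1 : ℤ) ^ (s.card + 1) = 0 := by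
    refine Finset.sum_involution (fun s _ => T s) ?_ ?_ ?_ ?_
    · intro s hs
      rw [Finset.mem_filter] at hs
      obtain ⟨m, -, -, h, -⟩ := hT s hs.1 hs.2
      rw [h]
      exact hsign s _
    · intro s hs _ heq
      rw [Finset.mem_filter] at hs
      obtain ⟨m, -, -, h, -⟩ := hT s hs.1 hs.2
      have h2 := hsign s (f m)
      rw [← h, heq, ← two_mul] at h2
      simp at h2
    · intro s hs
      rw [Finset.mem_filter] at hs
      obtain ⟨m, hm, hmin, h, -⟩ := hT s hs.1 hs.2
      rw [Finset.mem_filter, h, mem_chains]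
      have hms := Finset.mem_filter.1 hm
      constructor
      -- `f m` is comparable with each `y` of the chain: if `y` is moved, then `f m ≤ m ≤ y`; if `y`
      -- is fixed, then `f m ≤ m ≤ y` or `y = f y ≤ f m`.
      · refine ((mem_chains.1 hs.1).insert (a := f m) ?_).mono ?_
        · intro y hy _
          by_cases hfy : f y = y
          · rcases eq_or_ne m y with rfl | hmy
            · exact Or.inl (hle _)
            · rcases mem_chains.1 hs.1 hms.1 hy hmy with h' | h'
              · exact Or.inl ((hle m).trans h')
              · exact Or.inr (hfy ▸ hmono h')
          · exact Or.inl ((hle m).trans (hmin y (Finset.mem_filter.2 ⟨hy, hfy⟩)))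
        · intro x hx
          rw [Finset.mem_coe, Finset.mem_symmDiff, Finset.mem_singleton] at hx
          rcases hx with hx | hx
          · exact Or.inr hx.1
          · exact Or.inl hx.1
      · intro hall
        have h3 := hB s m ▸ hm
        rw [Finset.mem_filter] at h3
        exact h3.2 (hall m h3.1)
    · intro s hs
      rw [Finset.mem_filter] at hs
      obtain ⟨m, -, -, -, h⟩ := hT s hs.1 hs.2
      exact h
  rw [reducedEulerChar_eq_sum, ← Finset.sum_filter_add_sum_filter_not _ (fun s => ∀ x ∈ s, f x = x),
    key, add_zero, reducedEulerChar_subtype]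

/-- An increasing monotone idempotent self-map retracts the poset onto its fixed points without
changing the Euler characteristic. -/
theorem reducedEulerChar_retract_of_ge [Finite P] (f : P → P) (hmono : Monotone f)
    (hle : ∀ x, x ≤ f x) (hidem : ∀ x, f (f x) = f x) :
    reducedEulerChar P = reducedEulerChar {x // f x = x} := by
  have h := reducedEulerChar_retract_of_le (P := Pᵒᵈ)
    (fun x => OrderDual.toDual (f (OrderDual.ofDual x))) (fun x y h => hmono h) (fun x => hle _)
    (fun x => hidem _)
  rw [← reducedEulerChar_orderDual, h, ← reducedEulerChar_orderDual (P := {x // f x = x})]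
  exact reducedEulerChar_congr
    { toFun := fun y => OrderDual.toDual ⟨OrderDual.ofDual y.1, y.2⟩
      invFun := fun y => ⟨OrderDual.toDual (OrderDual.ofDual y).1, (OrderDual.ofDual y).2⟩
      left_inv := fun _ => rfl
      right_inv := fun _ => rfl
      map_rel_iff' := Iff.rfl }

theorem reducedEulerChar_of_unique [Finite P] [Unique P] : reducedEulerChar P = 0 := by
  classical
  have := Fintype.ofFinite P
  rw [reducedEulerChar_eq_sum_gt]
  have : ∀ x : P, reducedEulerChar {y // x < y} = -1 := by
    intro x
    have : IsEmpty {y // x < y} := ⟨fun y => y.2.ne (Subsingleton.elim _ _)⟩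
    rw [reducedEulerChar_eq_sum_gt]
    simp
  simp [this]

theorem reducedEulerChar_eq_zero_of_isLeast [Finite P] (a : P) (h : ∀ x, a ≤ x) :
    reducedEulerChar P = 0 := by
  rw [reducedEulerChar_retract_of_le (fun _ => a) (fun _ _ _ => le_rfl) h (fun _ => rfl)]
  have : Unique {x // a = x} := ⟨⟨⟨a, rfl⟩⟩, fun x => Subtype.ext x.2.symm⟩
  exact reducedEulerChar_of_unique

theorem reducedEulerChar_eq_zero_of_isGreatest [Finite P] (a : P) (h : ∀ x, x ≤ a) :
    reducedEulerChar P = 0 := by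
  rw [← reducedEulerChar_orderDual]
  exact reducedEulerChar_eq_zero_of_isLeast (OrderDual.toDual a) h

end Poset

/-! ### Homomorphisms from free abelian groups. -/

section Homs

variable {G : Type*} [Group G]

/-- The inclusion of `ℤ^r` into `ℤ^(r+1)` as the vectors with vanishing first coordinate. -/
def consZeroHom (r : ℕ) : Multiplicative (Fin r → ℤ) →* Multiplicative (Fin (r + 1) → ℤ) where
  toFun y := Multiplicative.ofAdd (Fin.cons 0 y.toAdd)
  map_one' := by
    apply Multiplicative.toAdd.injective
    funext i
    refine Fin.cases ?_ (fun j => ?_) i <;> rfl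
  map_mul' y z := by
    apply Multiplicative.toAdd.injective
    funext i
    refine Fin.cases ?_ (fun j => ?_) i <;> rfl

/-- A homomorphism from `ℤ^(r+1)` is a homomorphism from `ℤ^r` together with an element commuting
with its image. -/
def homSuccEquiv (r : ℕ) : (Multiplicative (Fin (r + 1) → ℤ) →* G) ≃
    {p : (Multiplicative (Fin r → ℤ) →* G) × G // ∀ z, Commute (p.1 z) p.2} where
  toFun X := ⟨(X.comp (consZeroHom r), X (Multiplicative.ofAdd (Pi.single 0 1))),
    fun z => (Commute.all _ _).map X⟩
  invFun p :=
    { toFun := fun z => p.1.2 ^ (z.toAdd 0) * p.1.1 (Multiplicative.ofAdd (Fin.tail z.toAdd))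
      map_one' := by
        have : (Multiplicative.ofAdd (Fin.tail (Multiplicative.toAdd
          (1 : Multiplicative (Fin (r + 1) → ℤ))))) = 1 := rfl
        rw [this]
        simp
      map_mul' := fun y z => by
        have h : (Multiplicative.ofAdd (Fin.tail (y * z).toAdd)) =
          Multiplicative.ofAdd (Fin.tail y.toAdd) * Multiplicative.ofAdd (Fin.tail z.toAdd) := rfl
        rw [h, MonoidHom.map_mul, toAdd_mul, Pi.add_apply, zpow_add, mul_assoc, mul_assoc]
        congr 1
        rw [← mul_assoc, ← mul_assoc]
        congr 1
        exact ((p.2 _).zpow_right _).eq.symm }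
  left_inv X := by
    refine MonoidHom.ext fun z => ?_
    change X (Multiplicative.ofAdd (Pi.single 0 1)) ^ (z.toAdd 0) *
      X (consZeroHom r (Multiplicative.ofAdd (Fin.tail z.toAdd))) = X z
    rw [← map_zpow, ← map_mul]
    congr 1
    apply Multiplicative.toAdd.injective
    funext i
    refine Fin.cases ?_ (fun j => ?_) i
    · simp [consZeroHom]
    · simp [consZeroHom, Fin.tail]
  right_inv p := by
    refine Subtype.ext (Prod.ext ?_ ?_)
    · ext z
      simp [consZeroHom]
    · have : (Multiplicative.ofAdd (Fin.tail (Pi.single 0 1 : Fin (r + 1) → ℤ))) = 1 := by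
        apply Multiplicative.toAdd.injective
        funext j
        simp [Fin.tail]
      simp [this]

theorem homSuccEquiv_fixed_iff {P : Type*} [MulAction G P] {r : ℕ}
    (X : Multiplicative (Fin (r + 1) → ℤ) →* G) (x : P) :
    (∀ z, X z • x = x) ↔
      (∀ z, (homSuccEquiv r X).1.1 z • x = x) ∧ (homSuccEquiv r X).1.2 • x = x := by
  constructor
  · intro h
    exact ⟨fun z => h _, h _⟩
  · rintro ⟨h1, h2⟩ z
    obtain ⟨p, rfl⟩ := (homSuccEquiv r).symm.surjective X
    rw [Equiv.apply_symm_apply] at h1 h2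
    change (p.1.2 ^ (z.toAdd 0) * p.1.1 (Multiplicative.ofAdd (Fin.tail z.toAdd))) • x = x
    rw [mul_smul, h1]
    exact (Subgroup.zpow_mem (MulAction.stabilizer G x) h2 _ : _ ∈ MulAction.stabilizer G x)

end Homs

/-! ### Orbit counting for pairs of a homomorphism and a chain. -/

section Burnside

variable {G P : Type*} [Group G] [PartialOrder P] [MulAction G P]

/-- If `g • x` is above `x`, all further powers of `g` keep `x` above, and finite order brings it
back; likewise below. So the stabilizer of a chain fixes it pointwise, which is what matches
stabilizers with fixed-point posets. -/
theorem smul_eq_of_image_eq [Finite G] (hmono : ∀ (g : G) (x y : P), x ≤ y → g • x ≤ g • y)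
    [DecidableEq P] {s : Finset P} (hs : IsChain (· ≤ ·) (s : Set P)) {g : G}
    (hg : s.image (g • ·) = s) {x : P} (hx : x ∈ s) : g • x = x := by
  have hgx : g • x ∈ s := by
    rw [← hg]
    exact Finset.mem_image_of_mem (g • ·) hx
  have hpow : ∀ n : ℕ, (x ≤ g • x → g • x ≤ g ^ (n + 1) • x) ∧
      (g • x ≤ x → g ^ (n + 1) • x ≤ g • x) := by
    intro n
    induction n with
    | zero => simp
    | succ n ih =>
      constructor
      · intro h
        have := hmono g _ _ (h.trans (ih.1 h))
        rwa [← mul_smul, ← pow_succ'] at this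
      · intro h
        have := hmono g _ _ ((ih.2 h).trans h)
        rwa [← mul_smul, ← pow_succ'] at this
  have hord : g ^ (orderOf g - 1 + 1) • x = x := by
    rw [Nat.sub_add_cancel (orderOf_pos g), pow_orderOf_eq_one, one_smul]
  by_contra hne
  rcases hs hx hgx (Ne.symm hne) with h | h
  · exact hne (le_antisymm (((hpow (orderOf g - 1)).1 h).trans hord.le) h)
  · exact hne (le_antisymm h (hord.ge.trans ((hpow (orderOf g - 1)).2 h)))

/-- A homomorphism `ℤ^r → G` from a given class together with a chain of fixed elements. -/
def IsFixedChain {r : ℕ} (S : (Multiplicative (Fin r → ℤ) →* G) → Prop)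
    (X : Multiplicative (Fin r → ℤ) →* G) (c : Finset P) : Prop :=
  S X ∧ IsChain (· ≤ ·) (c : Set P) ∧ ∀ x ∈ c, ∀ z, X z • x = x

/-- Summing stabilizer orders over a finite `G`-set, when the orbits are the fibres of a map. -/
theorem sum_card_stabilizer_eq {Y ζ : Type*} [Finite G] [MulAction G Y] [Fintype Y] [DecidableEq ζ]
    (Z : Finset ζ) (inv : Y → ζ) (hmem : ∀ y, inv y ∈ Z) (hsurj : ∀ z ∈ Z, ∃ y, inv y = z)
    (heq : ∀ y y', inv y = inv y' ↔ ∃ g : G, g • y = y') (sgn : ζ → ℤ) :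
    ∑ y : Y, sgn (inv y) * (Nat.card (MulAction.stabilizer G y) : ℤ) =
      (Nat.card G : ℤ) * ∑ z ∈ Z, sgn z := by
  classical
  have := Fintype.ofFinite G
  rw [← Finset.sum_fiberwise_of_maps_to (t := Z) (g := inv) (fun y _ => hmem y), Finset.mul_sum]
  refine Finset.sum_congr rfl fun z hz => ?_
  have h1 : ∀ y ∈ Finset.univ.filter (fun y => inv y = z),
      sgn (inv y) * (Nat.card (MulAction.stabilizer G y) : ℤ) =
        sgn z * (Nat.card (MulAction.stabilizer G y) : ℤ) := by
    intro y hy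
    rw [(Finset.mem_filter.1 hy).2]
  rw [Finset.sum_congr rfl h1, ← Finset.mul_sum, mul_comm]
  congr 1
  set T := Finset.univ.filter (fun y => inv y = z) with hT
  have h2 : ∀ y ∈ T, (T.card : ℤ) * (Nat.card (MulAction.stabilizer G y) : ℤ) = Nat.card G := by
    intro y hy
    have h3 : T = (MulAction.orbit G y).toFinset := by
      ext y'
      rw [hT, Finset.mem_filter, Set.mem_toFinset, MulAction.mem_orbit_iff, ← heq]
      rw [hT, Finset.mem_filter] at hy
      simp only [Finset.mem_univ, true_and] at hy ⊢
      rw [hy, eq_comm]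
    have h4 := MulAction.card_orbit_mul_card_stabilizer_eq_card_group G y
    rw [h3, Set.toFinset_card, Nat.card_eq_fintype_card, Nat.card_eq_fintype_card]
    exact_mod_cast h4
  have h5 : (T.card : ℤ) ≠ 0 := by
    obtain ⟨y, hy⟩ := hsurj z hz
    have : y ∈ T := by simp [hT, hy]
    exact_mod_cast (Finset.card_pos.2 ⟨y, this⟩).ne'
  apply mul_left_cancel₀ h5
  rw [Finset.mul_sum, Finset.sum_congr rfl h2, Finset.sum_const, nsmul_eq_mul]

variable [Finite G] [Finite P]

/-- The action of `G` on pairs of a homomorphism and a chain. -/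
@[reducible]
def fixedChainAction [DecidableEq P] (hmono : ∀ (g : G) (x y : P), x ≤ y → g • x ≤ g • y) {r : ℕ}
    (S : (Multiplicative (Fin r → ℤ) →* G) → Prop)
    (hS : ∀ X, S X → ∀ g : G, S ((MulAut.conj g).toMonoidHom.comp X)) :
    MulAction G {p : (Multiplicative (Fin r → ℤ) →* G) × Finset P // IsFixedChain S p.1 p.2} where
  smul g p := ⟨((MulAut.conj g).toMonoidHom.comp p.1.1, p.1.2.image (g • ·)), by
    obtain ⟨⟨X, c⟩, h1, h2, h3⟩ := p
    refine ⟨hS X h1 g, ?_, ?_⟩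
    · rw [Finset.coe_image]
      rintro _ ⟨x, hx, rfl⟩ _ ⟨y, hy, rfl⟩ hxy
      rcases h2 hx hy (fun h => hxy (by rw [h])) with h | h
      · exact Or.inl (hmono g _ _ h)
      · exact Or.inr (hmono g _ _ h)
    · intro x hx z
      obtain ⟨y, hy, rfl⟩ := Finset.mem_image.1 hx
      simp only [MonoidHom.comp_apply, MulEquiv.coe_toMonoidHom, MulAut.conj_apply]
      rw [← mul_smul, inv_mul_cancel_right, mul_smul, h3 y hy]⟩
  one_smul p := by
    refine Subtype.ext (Prod.ext ?_ ?_)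
    · change (MulAut.conj (1 : G)).toMonoidHom.comp p.1.1 = p.1.1
      ext z
      simp
    · change p.1.2.image ((1 : G) • ·) = p.1.2
      simp
  mul_smul g h p := by
    refine Subtype.ext (Prod.ext ?_ ?_)
    · change (MulAut.conj (g * h)).toMonoidHom.comp p.1.1 =
        (MulAut.conj g).toMonoidHom.comp ((MulAut.conj h).toMonoidHom.comp p.1.1)
      ext z
      simp
    · change p.1.2.image ((g * h) • ·) = (p.1.2.image (h • ·)).image (g • ·)
      rw [Finset.image_image]
      congr 1
      funext x
      exact mul_smul g h x

theorem equivariantEulerChar_succ_eq_sum_pairs [Fintype P] [Fintype G] {r : ℕ}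
    [Fintype (Multiplicative (Fin r → ℤ) →* G)] [DecidableEq P]
    [DecidablePred fun p : (Multiplicative (Fin r → ℤ) →* G) × G => ∀ z, Commute (p.1 z) p.2] :
    equivariantEulerChar (r + 1) P G =
      ((∑ p : (Multiplicative (Fin r → ℤ) →* G) × G with ∀ z, Commute (p.1 z) p.2,
        reducedEulerChar {x : P // (∀ z, p.1 z • x = x) ∧ p.2 • x = x} : ℤ) : ℚ) /
      (Nat.card G : ℚ) := by
  classical
  have := Fintype.ofFinite (Multiplicative (Fin (r + 1) → ℤ) →* G)
  rw [equivariantEulerChar, finsum_eq_sum_of_fintype]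
  congr 1
  rw [← Int.cast_sum]
  congr 1
  rw [Fintype.sum_equiv (homSuccEquiv r) _
    (fun p => reducedEulerChar {x : P // (∀ z, p.1.1 z • x = x) ∧ p.1.2 • x = x})]
  · exact (Finset.sum_subtype (Finset.univ.filter fun p :
      (Multiplicative (Fin r → ℤ) →* G) × G => ∀ z, Commute (p.1 z) p.2) (by simp)
      (fun p => reducedEulerChar {x : P // (∀ z, p.1 z • x = x) ∧ p.2 • x = x})).symm
  · intro X
    exact reducedEulerChar_congr
      { toFun := fun x => ⟨x.1, (homSuccEquiv_fixed_iff X x.1).1 x.2⟩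
        invFun := fun x => ⟨x.1, (homSuccEquiv_fixed_iff X x.1).2 x.2⟩
        left_inv := fun _ => rfl
        right_inv := fun _ => rfl
        map_rel_iff' := Iff.rfl }

/-- If the fixed posets of the homomorphisms outside the class `S` have vanishing Euler
characteristic, and `inv` classifies the pairs of a homomorphism in `S` and a chain of fixed
elements up to the action of `G`, then the equivariant Euler characteristic is the signed number of
values of `inv`. -/
theorem equivariantEulerChar_succ_eq_sum [DecidableEq P] {ζ : Type*}
    (hmono : ∀ (g : G) (x y : P), x ≤ y → g • x ≤ g • y) {r : ℕ}
    (S : (Multiplicative (Fin r → ℤ) →* G) → Prop)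
    (hS : ∀ X, S X → ∀ g : G, S ((MulAut.conj g).toMonoidHom.comp X))
    (hzero : ∀ X, ¬ S X → ∀ g : G, (∀ z, Commute (X z) g) →
      reducedEulerChar {x : P // (∀ z, X z • x = x) ∧ g • x = x} = 0)
    (Z : Finset ζ) (inv : (Multiplicative (Fin r → ℤ) →* G) → Finset P → ζ)
    (hmem : ∀ X c, IsFixedChain S X c → inv X c ∈ Z)
    (hsurj : ∀ z ∈ Z, ∃ X c, IsFixedChain S X c ∧ inv X c = z)
    (hinv : ∀ X c, IsFixedChain S X c → ∀ g : G,
      inv ((MulAut.conj g).toMonoidHom.comp X) (c.image (g • ·)) = inv X c)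
    (hconj : ∀ X c X' c', IsFixedChain S X c → IsFixedChain S X' c' → inv X c = inv X' c' →
      ∃ g : G, (MulAut.conj g).toMonoidHom.comp X = X' ∧ c.image (g • ·) = c')
    (sgn : ζ → ℤ) (hsgn : ∀ X c, IsFixedChain S X c → sgn (inv X c) = (-1) ^ (c.card + 1)) :
    equivariantEulerChar (r + 1) P G = ((∑ z ∈ Z, sgn z : ℤ) : ℚ) := by
  classical
  have := Fintype.ofFinite G
  have := Fintype.ofFinite P
  have := Fintype.ofFinite (Multiplicative (Fin r → ℤ) →* G)
  have hG : (Nat.card G : ℚ) ≠ 0 := by exact_mod_cast Nat.card_pos.ne'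
  rw [equivariantEulerChar_succ_eq_sum_pairs, div_eq_iff hG, mul_comm]
  norm_cast
  -- The orbit count times the order of `G` is the sum over pairs of sign times stabilizer order. By
  -- `h1` below, the stabilizer consists of the `g` that commute with `X` and fix the chain
  -- pointwise; exchanging the sums over `g` and over chains recovers the Euler characteristics.
  let _ := fixedChainAction hmono S hS
  rw [← sum_card_stabilizer_eq (G := G) (Y := {p : (Multiplicative (Fin r → ℤ) →* G) × Finset P //
    IsFixedChain S p.1 p.2}) Z (fun y => inv y.1.1 y.1.2) (fun y => hmem _ _ y.2) ?_ ?_ sgn]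
  · have h1 : ∀ y : {p : (Multiplicative (Fin r → ℤ) →* G) × Finset P // IsFixedChain S p.1 p.2},
        sgn (inv y.1.1 y.1.2) * (Nat.card (MulAction.stabilizer G y) : ℤ) =
          ∑ g : G, if (∀ z, Commute (y.1.1 z) g) ∧ ∀ x ∈ y.1.2, g • x = x then
            (-1) ^ (y.1.2.card + 1) else 0 := by
      intro y
      rw [hsgn _ _ y.2, ← Finset.sum_filter, Finset.sum_const, nsmul_eq_mul, mul_comm,
        Nat.card_eq_fintype_card, Fintype.card_subtype]
      congr 3
      ext g
      simp only [Finset.mem_filter, Finset.mem_univ, true_and, MulAction.mem_stabilizer_iff]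
      constructor
      · intro h
        have h2 := congrArg Subtype.val h
        have h3 : (MulAut.conj g).toMonoidHom.comp y.1.1 = y.1.1 := congrArg Prod.fst h2
        have h4 : y.1.2.image (g • ·) = y.1.2 := congrArg Prod.snd h2
        refine ⟨fun z => ?_, fun x hx => smul_eq_of_image_eq hmono y.2.2.1 h4 hx⟩
        have h5 := DFunLike.congr_fun h3 z
        simp only [MonoidHom.comp_apply, MulEquiv.coe_toMonoidHom, MulAut.conj_apply] at h5
        exact (mul_inv_eq_iff_eq_mul.1 h5).symm
      · rintro ⟨h3, h4⟩
        refine Subtype.ext (Prod.ext ?_ ?_)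
        · change (MulAut.conj g).toMonoidHom.comp y.1.1 = y.1.1
          refine MonoidHom.ext fun z => ?_
          simp only [MonoidHom.comp_apply, MulEquiv.coe_toMonoidHom, MulAut.conj_apply]
          exact mul_inv_eq_iff_eq_mul.2 (h3 z).eq.symm
        · change y.1.2.image (g • ·) = y.1.2
          rw [Finset.image_congr (g := id) (fun x hx => h4 x hx), Finset.image_id]
    rw [Finset.sum_congr rfl fun y _ => h1 y,
      ← Finset.sum_subtype (Finset.univ.filter fun p :
      (Multiplicative (Fin r → ℤ) →* G) × Finset P => IsFixedChain S p.1 p.2)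
      (p := fun p => IsFixedChain S p.1 p.2) (by simp)
      (fun p => ∑ g : G, if (∀ z, Commute (p.1 z) g) ∧ ∀ x ∈ p.2, g • x = x then
            (-1 : ℤ) ^ (p.2.card + 1) else 0)]
    rw [Finset.sum_filter, Finset.sum_filter, Fintype.sum_prod_type, Fintype.sum_prod_type]
    refine Finset.sum_congr rfl fun X _ => ?_
    by_cases hX : S X
    · have h2 : ∀ c : Finset P, (if IsFixedChain S X c then
          ∑ g : G, if (∀ z, Commute (X z) g) ∧ ∀ x ∈ c, g • x = x then
            (-1 : ℤ) ^ (c.card + 1) else 0 else 0) =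
          ∑ g : G, if IsFixedChain S X c ∧ (∀ z, Commute (X z) g) ∧ ∀ x ∈ c, g • x = x then
            (-1 : ℤ) ^ (c.card + 1) else 0 := by
        intro c
        by_cases h : IsFixedChain S X c <;> simp [h]
      simp only [h2]
      rw [Finset.sum_comm]
      refine Finset.sum_congr rfl fun g _ => ?_
      by_cases hg : ∀ z, Commute (X z) g
      · rw [if_pos hg, reducedEulerChar_subtype, chains, Finset.filter_filter, Finset.sum_filter]
        refine Finset.sum_congr rfl fun c _ => ?_
        have hiff : (IsChain (· ≤ ·) (c : Set P) ∧
            ∀ x ∈ c, (∀ z, X z • x = x) ∧ g • x = x) ↔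
            IsFixedChain S X c ∧ (∀ z, Commute (X z) g) ∧ ∀ x ∈ c, g • x = x := by
          simp only [IsFixedChain, hX, true_and]
          constructor
          · rintro ⟨h3, h4⟩
            exact ⟨⟨h3, fun x hx => (h4 x hx).1⟩, hg, fun x hx => (h4 x hx).2⟩
          · rintro ⟨⟨h3, h4⟩, -, h5⟩
            exact ⟨h3, fun x hx => ⟨h4 x hx, h5 x hx⟩⟩
        by_cases h3 : IsFixedChain S X c ∧ (∀ z, Commute (X z) g) ∧ ∀ x ∈ c, g • x = x
        · rw [if_pos h3, if_pos (hiff.2 h3)]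
        · rw [if_neg h3, if_neg fun h4 => h3 (hiff.1 h4)]
      · rw [if_neg hg]
        exact (Finset.sum_eq_zero fun c _ => if_neg fun h => hg h.2.1).symm
    -- For `X` outside `S` there are no pairs on one side, and `hzero` makes the other side vanish.
    · have h3 : ∀ c : Finset P, ¬ IsFixedChain S X c := fun c h => hX h.1
      simp only [h3, if_false, Finset.sum_const_zero]
      refine Finset.sum_eq_zero fun g _ => ?_
      by_cases hg : ∀ z, Commute (X z) g
      · rw [if_pos hg, hzero X hX g hg]
      · rw [if_neg hg]
  · intro z hz
    obtain ⟨X, c, h, h'⟩ := hsurj z hz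
    exact ⟨⟨(X, c), h⟩, h'⟩
  · rintro ⟨⟨X, c⟩, h⟩ ⟨⟨X', c'⟩, h'⟩
    constructor
    · intro heq
      obtain ⟨g, hg1, hg2⟩ := hconj X c X' c' h h' heq
      exact ⟨g, Subtype.ext (Prod.ext hg1 hg2)⟩
    · rintro ⟨g, hg⟩
      have h2 := congrArg Subtype.val hg
      have h3 : (MulAut.conj g).toMonoidHom.comp X = X' := congrArg Prod.fst h2
      have h4 : c.image (g • ·) = c' := congrArg Prod.snd h2
      change inv X c = inv X' c'
      rw [← h3, ← h4, hinv X c h g]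

end Burnside

open Module Submodule

/-! ### Multiplicities in finite semisimple modules over a commutative ring. -/

section Multiplicity

variable (R : Type*) [CommRing R] (V : Type*) [AddCommGroup V] [Module R V]

/-- The dimension of the `m`-torsion of `V` over the residue field at `m`. -/
noncomputable def multAt (m : MaximalSpectrum R) : ℕ :=
  finrank (R ⧸ m.asIdeal) (torsionBySet R V m.asIdeal)

variable {R V}

/-- Distinct maximal ideals are comaximal, so 1 is a sum of two elements that kill `v`. -/
theorem disjoint_torsionBySet_of_ne {m m' : MaximalSpectrum R} (h : m ≠ m') {v : V}
    (hv : ∀ a ∈ m.asIdeal, a • v = 0) (hv' : ∀ a ∈ m'.asIdeal, a • v = 0) : v = 0 := by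
  have hs : m.asIdeal ⊔ m'.asIdeal = ⊤ :=
    m.isMaximal.coprime_of_ne m'.isMaximal fun h' => h (MaximalSpectrum.ext h')
  have h1 : (1 : R) ∈ m.asIdeal ⊔ m'.asIdeal := hs ▸ Submodule.mem_top
  obtain ⟨a, ha, b, hb, hab⟩ := Submodule.mem_sup.1 h1
  rw [← one_smul R v, ← hab, add_smul, hv a ha, hv' b hb, add_zero]

theorem multAt_ne_zero_iff [Finite V] {m : MaximalSpectrum R} :
    multAt R V m ≠ 0 ↔ ∃ v : V, v ≠ 0 ∧ ∀ a ∈ m.asIdeal, a • v = 0 := by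
  let _ := Ideal.Quotient.field m.asIdeal
  rw [multAt, ← Nat.pos_iff_ne_zero]
  have : Module.Finite (R ⧸ m.asIdeal) (torsionBySet R V m.asIdeal) := inferInstance
  constructor
  · intro h
    have : Nontrivial (torsionBySet R V m.asIdeal) := Module.nontrivial_of_finrank_pos h
    obtain ⟨v, hv⟩ := exists_ne (0 : torsionBySet R V m.asIdeal)
    exact ⟨v.1, fun h => hv (Subtype.ext h),
      fun a ha => (mem_torsionBySet_iff _ _).1 v.2 ⟨a, ha⟩⟩
  · rintro ⟨v, hv, h⟩
    have : Nontrivial (torsionBySet R V m.asIdeal) :=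
      ⟨⟨⟨v, (mem_torsionBySet_iff _ _).2 fun a => h a a.2⟩, 0,
        fun h' => hv (congrArg Subtype.val h')⟩⟩
    exact Module.finrank_pos

variable (R V) in
theorem finite_support_multAt [Finite V] : (Function.support (multAt R V)).Finite := by
  have h : ∀ m : Function.support (multAt R V), ∃ v : V, v ≠ 0 ∧ ∀ a ∈ m.1.asIdeal, a • v = 0 :=
    fun m => multAt_ne_zero_iff.1 m.2
  choose f hf hf' using h
  rw [Set.finite_coe_iff.symm]
  refine Finite.of_injective f fun m m' hm => ?_
  by_contra hne
  exact hf m (disjoint_torsionBySet_of_ne (fun h => hne (Subtype.ext h)) (hf' m)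
    (by rw [hm]; exact hf' m'))

variable (R V) in
/-- The multiplicities of the simple modules `R ⧸ m` in the socle of a finite module. -/
noncomputable def mult [Finite V] : MaximalSpectrum R →₀ ℕ :=
  Finsupp.ofSupportFinite (multAt R V) (finite_support_multAt R V)

theorem mult_apply [Finite V] (m : MaximalSpectrum R) : mult R V m = multAt R V m := rfl

variable {W : Type*} [AddCommGroup W] [Module R W]

theorem finrank_eq_of_linearEquiv (m : Ideal R) {M N : Type*} [AddCommGroup M] [Module R M]
    [AddCommGroup N] [Module R N] [Module (R ⧸ m) M] [Module (R ⧸ m) N] [IsScalarTower R (R ⧸ m) M]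
    [IsScalarTower R (R ⧸ m) N] (e : M ≃ₗ[R] N) :
    finrank (R ⧸ m) M = finrank (R ⧸ m) N :=
  LinearEquiv.finrank_eq (e.extendScalarsOfSurjective Ideal.Quotient.mk_surjective)

theorem mult_congr [Finite V] [Finite W] (e : V ≃ₗ[R] W) : mult R V = mult R W := by
  ext m
  rw [mult_apply, mult_apply]
  refine finrank_eq_of_linearEquiv m.asIdeal (e.ofSubmodules _ _ ?_)
  ext w
  simp only [mem_map, mem_torsionBySet_iff]
  constructor
  · rintro ⟨v, hv, rfl⟩ a
    change a.1 • e v = 0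
    rw [← map_smul, hv, map_zero]
  · intro h
    refine ⟨e.symm w, fun a => ?_, e.apply_symm_apply w⟩
    rw [← map_smul, h, map_zero]

theorem mult_prod [Finite V] [Finite W] : mult R (V × W) = mult R V + mult R W := by
  ext m
  rw [Finsupp.add_apply, mult_apply, mult_apply, mult_apply]
  let _ := Ideal.Quotient.field m.asIdeal
  rw [multAt, multAt, multAt, ← Module.finrank_prod]
  refine finrank_eq_of_linearEquiv m.asIdeal ?_
  exact
    { toFun := fun x => (⟨x.1.1, (mem_torsionBySet_iff _ _).2 fun a =>
          congrArg Prod.fst ((mem_torsionBySet_iff _ _).1 x.2 a)⟩,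
        ⟨x.1.2, (mem_torsionBySet_iff _ _).2 fun a =>
          congrArg Prod.snd ((mem_torsionBySet_iff _ _).1 x.2 a)⟩)
      invFun := fun y => ⟨(y.1.1, y.2.1), (mem_torsionBySet_iff _ _).2 fun a =>
        Prod.ext ((mem_torsionBySet_iff _ _).1 y.1.2 a) ((mem_torsionBySet_iff _ _).1 y.2.2 a)⟩
      map_add' := fun _ _ => rfl
      map_smul' := fun _ _ => rfl
      left_inv := fun _ => rfl
      right_inv := fun _ => rfl }

theorem mult_add_of_isCompl [Finite V] {p q : Submodule R V} (h : IsCompl p q) :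
    mult R p + mult R q = mult R V := by
  rw [← mult_prod, mult_congr (prodEquivOfIsCompl p q h)]

theorem mult_of_subsingleton [Finite V] [Subsingleton V] : mult R V = 0 := by
  ext m
  rw [mult_apply, Finsupp.zero_apply]
  by_contra h
  obtain ⟨v, hv, -⟩ := multAt_ne_zero_iff.1 h
  exact hv (Subsingleton.elim _ _)

/-- Take a nonzero vector of a simple submodule. This is the starting point of every induction
below, where a cyclic summand `R ⧸ m` is split off. -/
theorem exists_maximal_annihilator [IsSemisimpleModule R V] [Nontrivial V] :
    ∃ (m : MaximalSpectrum R) (v : V), v ≠ 0 ∧ ∀ a ∈ m.asIdeal, a • v = 0 := by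
  obtain ⟨S, hS⟩ := IsSemisimpleModule.exists_simple_submodule R V
  have := IsSimpleModule.nontrivial R S
  obtain ⟨v, hv⟩ := exists_ne (0 : S)
  refine ⟨⟨_, IsSimpleModule.ker_toSpanSingleton_isMaximal R hv⟩, v.1,
    fun h => hv (Subtype.ext h), fun a ha => ?_⟩
  exact congrArg Subtype.val (LinearMap.mem_ker.1 ha)

theorem subsingleton_of_mult_eq_zero [Finite V] [IsSemisimpleModule R V] (h : mult R V = 0) :
    Subsingleton V := by
  by_contra hne
  rw [not_subsingleton_iff_nontrivial] at hne
  obtain ⟨m, v, hv⟩ := exists_maximal_annihilator (R := R) (V := V)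
  have := multAt_ne_zero_iff.2 ⟨v, hv⟩
  rw [← mult_apply, h] at this
  exact this rfl

theorem mem_of_smul_eq_zero {m : MaximalSpectrum R} {v : V} (hv : v ≠ 0)
    (h : ∀ a ∈ m.asIdeal, a • v = 0) {a : R} (ha : a • v = 0) : a ∈ m.asIdeal := by
  by_contra hne
  obtain ⟨b, c, hc, hbc⟩ := m.isMaximal.exists_inv hne
  apply hv
  rw [← one_smul R v, ← hbc, add_smul, mul_smul, ha, smul_zero, h c hc, add_zero]

/-- A cyclic module generated by a vector with maximal annihilator `m` is `R ⧸ m`. -/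
noncomputable def spanSingletonEquiv {m : MaximalSpectrum R} {v : V} (hv : v ≠ 0)
    (h : ∀ a ∈ m.asIdeal, a • v = 0) : (R ⧸ m.asIdeal) ≃ₗ[R] (R ∙ v) :=
  (Submodule.quotEquivOfEq _ _ (by
    ext a
    rw [LinearMap.mem_ker, LinearMap.toSpanSingleton_apply]
    exact ⟨h a, mem_of_smul_eq_zero hv h⟩)).trans
    ((LinearMap.quotKerEquivRange (LinearMap.toSpanSingleton R V v)).trans
      (LinearEquiv.ofEq _ _ (LinearMap.range_toSpanSingleton v)))

theorem mult_quotient (m : MaximalSpectrum R) [Finite (R ⧸ m.asIdeal)] :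
    mult R (R ⧸ m.asIdeal) = Finsupp.single m 1 := by
  classical
  ext m'
  rw [mult_apply, Finsupp.single_apply]
  split_ifs with h
  · subst h
    let _ := Ideal.Quotient.field m.asIdeal
    rw [multAt, ← Module.finrank_self (R ⧸ m.asIdeal)]
    have htop : torsionBySet R (R ⧸ m.asIdeal) m.asIdeal = ⊤ := by
      rw [eq_top_iff]
      intro x _
      rw [mem_torsionBySet_iff]
      intro a
      obtain ⟨y, rfl⟩ := Ideal.Quotient.mk_surjective x
      rw [← Ideal.Quotient.mk_eq_mk, ← Submodule.Quotient.mk_smul, Submodule.Quotient.mk_eq_zero,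
        smul_eq_mul]
      exact Ideal.mul_mem_right _ _ a.2
    exact finrank_eq_of_linearEquiv m.asIdeal ((LinearEquiv.ofEq _ _ htop).trans topEquiv)
  · by_contra hne
    obtain ⟨v, hv, hv'⟩ := multAt_ne_zero_iff.1 hne
    refine hv (disjoint_torsionBySet_of_ne h (fun a ha => ?_) hv')
    obtain ⟨y, rfl⟩ := Ideal.Quotient.mk_surjective v
    rw [← Ideal.Quotient.mk_eq_mk, ← Submodule.Quotient.mk_smul, Submodule.Quotient.mk_eq_zero,
      smul_eq_mul]
    exact Ideal.mul_mem_right _ _ ha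

theorem mult_span_singleton [Finite V] {m : MaximalSpectrum R} {v : V} (hv : v ≠ 0)
    (h : ∀ a ∈ m.asIdeal, a • v = 0) : mult R (R ∙ v) = Finsupp.single m 1 := by
  have : Finite (R ⧸ m.asIdeal) := Finite.of_equiv _ (spanSingletonEquiv hv h).symm.toEquiv
  rw [← mult_congr (spanSingletonEquiv hv h), mult_quotient]

theorem natCard_lt_of_isCompl [Finite V] {p q : Submodule R V} (h : IsCompl p q) {v : V}
    (hv : v ≠ 0) (hvp : v ∈ p) : Nat.card q < Nat.card V := by
  refine Nat.lt_of_le_of_ne (Nat.card_le_card_of_injective _ q.injective_subtype) fun heq => hv ?_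
  have hsurj : Function.Surjective q.subtype :=
    (Nat.bijective_iff_injective_and_card _).2 ⟨q.injective_subtype, heq⟩ |>.2
  obtain ⟨w, hw⟩ := hsurj v
  have : v ∈ p ⊓ q := ⟨hvp, hw ▸ w.2⟩
  rwa [h.inf_eq_bot, mem_bot] at this

/-- Finite semisimple modules over a commutative ring are determined by their multiplicities. -/
theorem nonempty_linearEquiv_of_mult_eq [Finite V] [Finite W] [IsSemisimpleModule R V]
    [IsSemisimpleModule R W] (h : mult R V = mult R W) : Nonempty (V ≃ₗ[R] W) := by
  obtain ⟨n, hn⟩ : ∃ n, Nat.card V = n := ⟨_, rfl⟩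
  induction n using Nat.strong_induction_on generalizing V W with
  | _ n ih =>
  by_cases hV : Subsingleton V
  · have hW : Subsingleton W := subsingleton_of_mult_eq_zero (R := R) (by
      rw [← h, mult_of_subsingleton])
    exact ⟨LinearEquiv.ofLinearMap 0 0 (LinearMap.ext fun v => Subsingleton.elim _ _)
      (LinearMap.ext fun v => Subsingleton.elim _ _)⟩
  · rw [not_subsingleton_iff_nontrivial] at hV
    obtain ⟨m, v, hv, hmv⟩ := exists_maximal_annihilator (R := R) (V := V)
    -- The same simple module occurs in `W`. Once it is split off on both sides, the complements
    -- have equal multiplicities by cancellation.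
    have hW : multAt R W m ≠ 0 := by
      rw [← mult_apply, ← h]
      exact multAt_ne_zero_iff.2 ⟨v, hv, hmv⟩
    obtain ⟨w, hw, hmw⟩ := multAt_ne_zero_iff.1 hW
    obtain ⟨C, hC⟩ := exists_isCompl (R ∙ v)
    obtain ⟨D, hD⟩ := exists_isCompl (R ∙ w)
    have h1 := mult_add_of_isCompl hC
    have h2 := mult_add_of_isCompl hD
    rw [mult_span_singleton hv hmv] at h1
    rw [mult_span_singleton hw hmw, ← h, ← h1] at h2
    obtain ⟨e⟩ := ih (Nat.card C) (hn ▸ natCard_lt_of_isCompl hC hv (mem_span_singleton_self v))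
      (V := C) (W := D) (add_left_cancel h2).symm rfl
    exact ⟨(prodEquivOfIsCompl _ _ hC).symm.trans
      ((((spanSingletonEquiv hv hmv).symm.trans (spanSingletonEquiv hw hmw)).prodCongr e).trans
        (prodEquivOfIsCompl _ _ hD))⟩

theorem mult_comap_subtype [Finite V] {U W : Submodule R V} (h : W ≤ U) :
    mult R (W.comap U.subtype) = mult R W :=
  mult_congr (comapSubtypeEquivOfLe h)

theorem mult_map_subtype [Finite V] {U : Submodule R V} (W : Submodule R U) :
    mult R (W.map U.subtype) = mult R W :=
  mult_congr (equivMapOfInjective U.subtype U.injective_subtype W).symm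

theorem mult_eq_of_eq [Finite V] {U W : Submodule R V} (h : U = W) : mult R U = mult R W :=
  mult_congr (LinearEquiv.ofEq U W h)

theorem mult_sup_of_disjoint [Finite V] {p q : Submodule R V} (h : Disjoint p q) :
    mult R (p ⊔ q : Submodule R V) = mult R p + mult R q := by
  have hcompl : IsCompl (p.comap (p ⊔ q).subtype) (q.comap (p ⊔ q).subtype) := by
    constructor
    · rw [disjoint_iff, ← comap_inf, h.eq_bot, comap_bot, ker_subtype]
    · rw [codisjoint_iff, eq_top_iff]
      rintro ⟨x, hx⟩ _
      obtain ⟨y, hy, z, hz, rfl⟩ := mem_sup.1 hx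
      exact mem_sup.2 ⟨⟨y, mem_sup_left hy⟩, hy, ⟨z, mem_sup_right hz⟩, hz, rfl⟩
  rw [← mult_add_of_isCompl hcompl, mult_comap_subtype le_sup_left, mult_comap_subtype le_sup_right]

theorem mult_top [Finite V] : mult R (⊤ : Submodule R V) = mult R V := mult_congr topEquiv

theorem mult_bot [Finite V] : mult R (⊥ : Submodule R V) = 0 := mult_of_subsingleton

theorem mult_le [Finite V] [IsSemisimpleModule R V] (U : Submodule R V) :
    mult R U ≤ mult R V := by
  obtain ⟨C, hC⟩ := exists_isCompl U
  rw [← mult_add_of_isCompl hC]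
  exact le_self_add

theorem mult_mono [Finite V] [IsSemisimpleModule R V] {U W : Submodule R V} (h : U ≤ W) :
    mult R U ≤ mult R W := by
  rw [← mult_comap_subtype h]
  exact mult_le _

theorem eq_top_of_mult_eq [Finite V] [IsSemisimpleModule R V] {U : Submodule R V}
    (h : mult R U = mult R V) : U = ⊤ := by
  obtain ⟨C, hC⟩ := exists_isCompl U
  have h1 := mult_add_of_isCompl hC
  rw [h, add_eq_left] at h1
  have h2 := subsingleton_of_mult_eq_zero h1
  have h3 : C = ⊥ := Submodule.subsingleton_iff_eq_bot.1 h2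
  rw [h3] at hC
  exact hC.sup_eq_top ▸ (sup_bot_eq U).symm

theorem mult_strictMono [Finite V] [IsSemisimpleModule R V] {U W : Submodule R V} (h : U < W) :
    mult R U < mult R W := by
  refine lt_of_le_of_ne (mult_mono h.le) fun heq => h.not_ge ?_
  rw [← mult_comap_subtype h.le] at heq
  exact comap_subtype_eq_top.1 (eq_top_of_mult_eq heq)

theorem mult_eq_zero_iff [Finite V] [IsSemisimpleModule R V] {U : Submodule R V} :
    mult R U = 0 ↔ U = ⊥ := by
  constructor
  · intro h
    exact Submodule.subsingleton_iff_eq_bot.1 (subsingleton_of_mult_eq_zero h)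
  · rintro rfl
    exact mult_bot

/-- An isomorphism between submodules of isomorphic finite semisimple modules extends. -/
theorem exists_linearEquiv_extend [Finite V] [Finite W] [IsSemisimpleModule R V]
    [IsSemisimpleModule R W] (h : mult R V = mult R W) {U : Submodule R V} {U' : Submodule R W}
    (e : U ≃ₗ[R] U') : ∃ f : V ≃ₗ[R] W, ∀ u : U, f u = e u := by
  obtain ⟨C, hC⟩ := exists_isCompl U
  obtain ⟨D, hD⟩ := exists_isCompl U'
  have h1 := mult_add_of_isCompl hC
  have h2 := mult_add_of_isCompl hD
  rw [← mult_congr e, ← h, ← h1] at h2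
  obtain ⟨e'⟩ := nonempty_linearEquiv_of_mult_eq (add_left_cancel h2).symm
  refine ⟨(prodEquivOfIsCompl _ _ hC).symm.trans ((e.prodCongr e').trans
    (prodEquivOfIsCompl _ _ hD)), fun u => ?_⟩
  simp

theorem exists_greatest_of_isChain {P : Type*} [PartialOrder P] {s : Finset P}
    (hs : IsChain (· ≤ ·) (s : Set P)) (hne : s.Nonempty) : ∃ x ∈ s, ∀ y ∈ s, y ≤ x := by
  obtain ⟨x, hx⟩ := s.exists_maximal hne
  refine ⟨x, hx.1, fun y hy => ?_⟩
  rcases eq_or_ne x y with rfl | hxy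
  · exact le_rfl
  · rcases hs hx.1 hy hxy with h | h
    · exact hx.2 hy h
    · exact h

open scoped Classical in
/-- Chains of submodules with the same multiplicities are conjugate. -/
theorem exists_linearEquiv_map_chain [Finite V] [Finite W] [IsSemisimpleModule R V]
    [IsSemisimpleModule R W] (h : mult R V = mult R W) (c : Finset (Submodule R V))
    (c' : Finset (Submodule R W)) (hc : IsChain (· ≤ ·) (c : Set (Submodule R V)))
    (hc' : IsChain (· ≤ ·) (c' : Set (Submodule R W)))
    (him : c.image (fun U : Submodule R V => mult R U) =
      c'.image (fun U : Submodule R W => mult R U)) :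
    ∃ f : V ≃ₗ[R] W, ∀ U ∈ c, ∀ U' ∈ c', mult R U = mult R U' → U.map (f : V →ₗ[R] W) = U' := by
  obtain ⟨n, hn⟩ : ∃ n, c.card = n := ⟨_, rfl⟩
  induction n generalizing V W with
  | zero =>
    obtain ⟨f⟩ := nonempty_linearEquiv_of_mult_eq h
    rw [Finset.card_eq_zero] at hn
    exact ⟨f, fun U hU => by simp [hn] at hU⟩
  | succ n ih =>
    have hinj : ∀ U' ∈ c', ∀ W' ∈ c', mult R U' = mult R W' → U' = W' := by
      intro U' hU' W' hW' heq
      by_contra hne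
      rcases hc' hU' hW' hne with h1 | h1
      · exact (mult_strictMono (lt_of_le_of_ne h1 hne)).ne heq
      · exact (mult_strictMono (lt_of_le_of_ne h1 (Ne.symm hne))).ne heq.symm
    have hinjc : ∀ U' ∈ c, ∀ W' ∈ c, mult R U' = mult R W' → U' = W' := by
      intro U' hU' W' hW' heq
      by_contra hne
      rcases hc hU' hW' hne with h1 | h1
      · exact (mult_strictMono (lt_of_le_of_ne h1 hne)).ne heq
      · exact (mult_strictMono (lt_of_le_of_ne h1 (Ne.symm hne))).ne heq.symm
    obtain ⟨U, hU, hUmax⟩ := exists_greatest_of_isChain hc (Finset.card_pos.1 (by omega))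
    obtain ⟨U', hU', hUU'⟩ : ∃ U' ∈ c', mult R U' = mult R U := by
      rw [← Finset.mem_image, ← him]
      exact Finset.mem_image_of_mem _ hU
    have hUmax' : ∀ W' ∈ c', W' ≤ U' := by
      intro W' hW'
      obtain ⟨W1, hW1, hWW⟩ : ∃ W1 ∈ c, mult R W1 = mult R W' := by
        rw [← Finset.mem_image, him]
        exact Finset.mem_image_of_mem _ hW'
      by_contra hne
      rcases hc' hU' hW' (fun h' => hne h'.ge) with h1 | h1
      · have h2 := mult_strictMono (lt_of_le_not_ge h1 hne)
        rw [hUU', ← hWW] at h2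
        exact (mult_mono (hUmax W1 hW1)).not_gt h2
      · exact hne h1
    -- The induction takes place inside the greatest member: the remaining members are viewed as
    -- submodules of `U` and `U'`, and the isomorphism found between `U` and `U'` is extended to the
    -- whole modules.
    let d : Finset (Submodule R U) := (c.erase U).image (comap U.subtype)
    let d' : Finset (Submodule R U') := (c'.erase U').image (comap U'.subtype)
    have hd : IsChain (· ≤ ·) (d : Set (Submodule R U)) := by
      rw [Finset.coe_image]
      rintro _ ⟨x, hx, rfl⟩ _ ⟨y, hy, rfl⟩ hxy
      rcases hc (Finset.mem_of_mem_erase hx) (Finset.mem_of_mem_erase hy)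
        (fun h => hxy (by rw [h])) with h | h
      · exact Or.inl (comap_mono h)
      · exact Or.inr (comap_mono h)
    have hd' : IsChain (· ≤ ·) (d' : Set (Submodule R U')) := by
      rw [Finset.coe_image]
      rintro _ ⟨x, hx, rfl⟩ _ ⟨y, hy, rfl⟩ hxy
      rcases hc' (Finset.mem_of_mem_erase hx) (Finset.mem_of_mem_erase hy)
        (fun h => hxy (by rw [h])) with h | h
      · exact Or.inl (comap_mono h)
      · exact Or.inr (comap_mono h)
    have hdim : d.image (fun U : Submodule R _ => mult R U) =
        (c.image (fun U : Submodule R V => mult R U)).erase (mult R U) := by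
      ext N
      simp only [d, Finset.image_image, Finset.mem_image, Finset.mem_erase, Function.comp_apply]
      constructor
      · rintro ⟨x, ⟨hx1, hx2⟩, rfl⟩
        rw [mult_comap_subtype (hUmax x hx2)]
        exact ⟨fun h' => hx1 (hinjc x hx2 U hU h'), x, hx2, rfl⟩
      · rintro ⟨h1, x, hx, rfl⟩
        exact ⟨x, ⟨fun h' => h1 (by rw [h']), hx⟩, mult_comap_subtype (hUmax x hx)⟩
    have hdim' : d'.image (fun U : Submodule R _ => mult R U) =
        (c'.image (fun U : Submodule R W => mult R U)).erase (mult R U') := by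
      ext N
      simp only [d', Finset.image_image, Finset.mem_image, Finset.mem_erase, Function.comp_apply]
      constructor
      · rintro ⟨x, ⟨hx1, hx2⟩, rfl⟩
        rw [mult_comap_subtype (hUmax' x hx2)]
        exact ⟨fun h' => hx1 (hinj x hx2 U' hU' h'), x, hx2, rfl⟩
      · rintro ⟨h1, x, hx, rfl⟩
        exact ⟨x, ⟨fun h' => h1 (by rw [h']), hx⟩, mult_comap_subtype (hUmax' x hx)⟩
    have hcard : d.card = n := by
      rw [Finset.card_image_of_injOn, Finset.card_erase_of_mem hU, hn, Nat.add_sub_cancel]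
      intro x hx y hy hxy
      have hx' := hUmax x (Finset.mem_of_mem_erase hx)
      have hy' := hUmax y (Finset.mem_of_mem_erase hy)
      rw [← inf_eq_right.2 hx', ← inf_eq_right.2 hy', ← map_comap_subtype, ← map_comap_subtype, hxy]
    obtain ⟨e, he⟩ := ih (V := U) (W := U') hUU'.symm d d' hd hd' (by rw [hdim, hdim', him, hUU'])
      hcard
    obtain ⟨f, hf⟩ := exists_linearEquiv_extend h e
    refine ⟨f, fun x hx y hy hxy => ?_⟩
    have key : ∀ x : Submodule R V, x ≤ U → x.map (f : V →ₗ[R] W) =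
        ((x.comap U.subtype).map (e : U →ₗ[R] U')).map U'.subtype := by
      intro x hx
      ext w
      simp only [mem_map, mem_comap]
      constructor
      · rintro ⟨v, hv, rfl⟩
        exact ⟨e ⟨v, hx hv⟩, ⟨⟨v, hx hv⟩, hv, rfl⟩, (hf ⟨v, hx hv⟩).symm⟩
      · rintro ⟨_, ⟨v, hv, rfl⟩, rfl⟩
        exact ⟨v, hv, hf v⟩
    rw [key x (hUmax x hx)]
    by_cases hxU : x = U
    · subst hxU
      have : y = U' := hinj y hy U' hU' (by rw [← hxy, hUU'])
      subst this
      simp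
    · have hyU : y ≠ U' := fun h' => hxU (hinjc x hx U hU (by rw [hxy, h', hUU']))
      rw [he (x.comap U.subtype) (Finset.mem_image_of_mem _ (Finset.mem_erase.2 ⟨hxU, hx⟩))
        (y.comap U'.subtype) (Finset.mem_image_of_mem _ (Finset.mem_erase.2 ⟨hyU, hy⟩)) (by
          rw [mult_comap_subtype (hUmax x hx), mult_comap_subtype (hUmax' y hy), hxy]),
        map_comap_subtype, inf_eq_right.2 (hUmax' y hy)]

/-- A finite semisimple module has submodules of all smaller multiplicities. -/
theorem exists_submodule_mult_eq [Finite V] [IsSemisimpleModule R V] {N : MaximalSpectrum R →₀ ℕ}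
    (h : N ≤ mult R V) : ∃ U : Submodule R V, mult R U = N := by
  obtain ⟨n, hn⟩ : ∃ n, Nat.card V = n := ⟨_, rfl⟩
  induction n using Nat.strong_induction_on generalizing V N with
  | _ n ih =>
  by_cases hN : N = 0
  · exact ⟨⊥, by rw [mult_bot, hN]⟩
  · obtain ⟨m, hm⟩ : ∃ m, N m ≠ 0 := by
      by_contra! h'
      exact hN (Finsupp.ext h')
    have hV : multAt R V m ≠ 0 := by
      have := h m
      rw [mult_apply] at this
      omega
    obtain ⟨v, hv, hmv⟩ := multAt_ne_zero_iff.1 hV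
    obtain ⟨C, hC⟩ := exists_isCompl (R ∙ v)
    have h1 := mult_add_of_isCompl hC
    rw [mult_span_singleton hv hmv] at h1
    have hs : Finsupp.single m 1 ≤ N := by
      rw [Finsupp.single_le_iff]
      omega
    obtain ⟨U, hU⟩ := ih (Nat.card C) (hn ▸ natCard_lt_of_isCompl hC hv (mem_span_singleton_self v))
      (V := C) (N := N - Finsupp.single m 1) (by
        rw [tsub_le_iff_left, h1]
        exact h) rfl
    let W : Submodule R V := U.map C.subtype
    have hW : W ≤ C := map_subtype_le C U
    have hdisj : Disjoint (R ∙ v) W := hC.disjoint.mono_right hW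
    refine ⟨(R ∙ v) ⊔ W, ?_⟩
    rw [mult_sup_of_disjoint hdisj, mult_span_singleton hv hmv, mult_map_subtype, hU,
      add_tsub_cancel_of_le hs]

open scoped Classical in
/-- Chains of multiplicities are realized by chains of submodules. -/
theorem exists_chain_mult_eq [Finite V] [IsSemisimpleModule R V]
    (C : Finset (MaximalSpectrum R →₀ ℕ)) (hC : IsChain (· ≤ ·) (C : Set (MaximalSpectrum R →₀ ℕ)))
    (hle : ∀ N ∈ C, N ≤ mult R V) :
    ∃ s : (MaximalSpectrum R →₀ ℕ) → Submodule R V, (∀ N ∈ C, mult R (s N) = N) ∧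
      ∀ N ∈ C, ∀ N' ∈ C, N ≤ N' → s N ≤ s N' := by
  obtain ⟨n, hn⟩ : ∃ n, C.card = n := ⟨_, rfl⟩
  induction n generalizing V C with
  | zero =>
    rw [Finset.card_eq_zero] at hn
    subst hn
    exact ⟨fun _ => ⊥, by simp⟩
  | succ n ih =>
    obtain ⟨N₀, hN₀, hmax⟩ := exists_greatest_of_isChain hC (Finset.card_pos.1 (by omega))
    obtain ⟨U, hU⟩ := exists_submodule_mult_eq (hle N₀ hN₀)
    obtain ⟨s, hs1, hs2⟩ := ih (V := U) (C.erase N₀) (hC.mono (by simp))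
      (fun N hN => hU ▸ hmax N (Finset.mem_of_mem_erase hN))
      (by rw [Finset.card_erase_of_mem hN₀, hn, Nat.add_sub_cancel])
    refine ⟨fun N => if N = N₀ then U else (s N).map U.subtype, fun N hN => ?_,
      fun N hN N' hN' hNN => ?_⟩
    · by_cases h : N = N₀
      · exact (mult_eq_of_eq (if_pos h)).trans (hU.trans h.symm)
      · exact (mult_eq_of_eq (if_neg h)).trans ((mult_map_subtype _).trans
          (hs1 N (Finset.mem_erase.2 ⟨h, hN⟩)))
    · by_cases h' : N' = N₀
      · simp only [if_pos h']
        split_ifs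
        · exact le_rfl
        · exact map_subtype_le _ _
      · have h : N ≠ N₀ := fun h => h' (le_antisymm (hmax N' hN') (h ▸ hNN))
        simp only [if_neg h, if_neg h']
        exact map_mono (hs2 N (Finset.mem_erase.2 ⟨h, hN⟩) N' (Finset.mem_erase.2 ⟨h', hN'⟩) hNN)

/-- The total weight of a multiplicity function: the dimension of the corresponding module. -/
noncomputable def weight {I : Type*} (w : I → ℕ) (N : I →₀ ℕ) : ℕ := N.sum fun i k => k * w i

theorem weight_add {I : Type*} (w : I → ℕ) (N N' : I →₀ ℕ) :
    weight w (N + N') = weight w N + weight w N' := by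
  classical
  exact Finsupp.sum_add_index' (fun _ => zero_mul _) (fun _ _ _ => add_mul _ _ _)

theorem weight_single {I : Type*} (w : I → ℕ) (i : I) (k : ℕ) :
    weight w (Finsupp.single i k) = k * w i :=
  Finsupp.sum_single_index (zero_mul _)

theorem weight_zero {I : Type*} (w : I → ℕ) : weight w 0 = 0 := Finsupp.sum_zero_index

variable (F : Type*) [Field F] [Algebra F R]

/-- The residue degree of a maximal ideal. -/
noncomputable def degree (m : MaximalSpectrum R) : ℕ := finrank F (R ⧸ m.asIdeal)

/-- Every cyclic summand `R ⧸ m` that is split off contributes its residue degree. This makes the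
dimension `n` a condition on multiplicities. -/
theorem finrank_eq_weight_mult [Finite V] [Module F V] [IsScalarTower F R V]
    [IsSemisimpleModule R V] : finrank F V = weight (degree F) (mult R V) := by
  obtain ⟨n, hn⟩ : ∃ n, Nat.card V = n := ⟨_, rfl⟩
  induction n using Nat.strong_induction_on generalizing V with
  | _ n ih =>
  by_cases hV : Subsingleton V
  · rw [mult_of_subsingleton, weight_zero, Module.finrank_zero_of_subsingleton]
  · rw [not_subsingleton_iff_nontrivial] at hV
    obtain ⟨m, v, hv, hmv⟩ := exists_maximal_annihilator (R := R) (V := V)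
    obtain ⟨C, hC⟩ := exists_isCompl (R ∙ v)
    rw [← mult_add_of_isCompl hC, weight_add, mult_span_singleton hv hmv, weight_single, one_mul,
      ← ih (Nat.card C) (hn ▸ natCard_lt_of_isCompl hC hv (mem_span_singleton_self v)) (V := C) rfl,
      ← ((prodEquivOfIsCompl _ _ hC).restrictScalars F).finrank_eq, Module.finrank_prod, degree,
      ((spanSingletonEquiv hv hmv).restrictScalars F).finrank_eq]

end Multiplicity

/-! ### Norms and traces for an involution of a field. -/

section FiniteFields

/-- Norms from a finite field to the fixed field of an involution are surjective. -/
theorem exists_mul_map_eq {K : Type*} [Field K] [Finite K] (α : K →+* K)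
    (hα : ∀ x, α (α x) = x) (hne : ∃ x, α x ≠ x) {a : K} (ha : α a = a) (ha0 : a ≠ 0) :
    ∃ b, b * α b = a := by
  -- `N` is the norm and `D` sends `x` to `x / α x`. By Hilbert 90 the range of `D` is the kernel of
  -- `N`. Comparing orders, the range of `N`, which lies in the kernel of `D`, is all of it.
  let A : Kˣ →* Kˣ := Units.map (α : K →* K)
  let N : Kˣ →* Kˣ := MonoidHom.id _ * A
  let D : Kˣ →* Kˣ := MonoidHom.id _ / A
  have hAA : ∀ x, A (A x) = x := fun x => Units.ext (hα x)
  have h1 : D.range = N.ker := by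
    apply le_antisymm
    · rintro _ ⟨c, rfl⟩
      rw [MonoidHom.mem_ker]
      change c / A c * A (c / A c) = 1
      rw [map_div, hAA, div_mul_div_cancel, div_self']
    · intro b hb
      rw [MonoidHom.mem_ker] at hb
      have hb' : (b : K) * α b = 1 := congrArg Units.val hb
      -- The Hilbert 90 resolvent `y = x + b * α x` satisfies `b * α y = y`, because `b * α b = 1`.
      -- If it vanished for every `x`, then `x = 1` would give `b = -1`, and `α` would be the
      -- identity.
      obtain ⟨x, hx⟩ : ∃ x : K, x + b * α x ≠ 0 := by
        by_contra! h
        have hb1 : (b : K) = -1 := by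
          have := h 1
          rw [map_one, mul_one] at this
          exact (neg_eq_of_add_eq_zero_right this).symm
        obtain ⟨y, hy⟩ := hne
        have := h y
        rw [hb1] at this
        apply hy
        linear_combination -this
      refine ⟨Units.mk0 _ hx, Units.ext ?_⟩
      simp only [D, MonoidHom.div_apply, MonoidHom.id_apply]
      rw [Units.val_div_eq_div_val, Units.val_mk0]
      change _ / α (x + b * α x) = _
      rw [map_add, map_mul, hα]
      have h2 : α x + α b * x ≠ 0 := by
        intro h
        apply hx
        linear_combination (b : K) * h - x * hb'
      rw [div_eq_iff h2]
      linear_combination - x * hb'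
  have h2 : N.range ≤ D.ker := by
    rintro _ ⟨c, rfl⟩
    rw [MonoidHom.mem_ker]
    change c * A c / A (c * A c) = 1
    rw [map_mul, hAA, mul_comm, div_self']
  have h3 : Nat.card N.range = Nat.card D.ker := by
    have e1 := Subgroup.card_mul_index N.ker
    have e2 := Subgroup.card_mul_index D.ker
    rw [Subgroup.index_ker] at e1 e2
    rw [← h1, ← e2, mul_comm] at e1
    exact Nat.eq_of_mul_eq_mul_right Nat.card_pos e1
  have h4 : N.range = D.ker := Subgroup.eq_of_le_of_card_ge h2 h3.ge
  have h5 : Units.mk0 a ha0 ∈ D.ker := by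
    rw [MonoidHom.mem_ker]
    simp only [D, MonoidHom.div_apply, MonoidHom.id_apply]
    rw [div_eq_one]
    exact Units.ext ha.symm
  rw [← h4] at h5
  obtain ⟨b, hb⟩ := h5
  exact ⟨b, congrArg Units.val hb⟩

/-- Any element of nonzero trace can be normalized. The resulting `θ` replaces 1/2 and exists in
characteristic two as well. -/
theorem exists_add_map_eq_one {F : Type*} [Field F] (σ : F →+* F) (hσ : ∀ x, σ (σ x) = x)
    (hne : ∃ x, σ x ≠ x) : ∃ θ, θ + σ θ = 1 := by
  obtain ⟨a, ha⟩ : ∃ a, a + σ a ≠ 0 := by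
    by_contra! h
    obtain ⟨y, hy⟩ := hne
    have h1 := h 1
    rw [map_one] at h1
    apply hy
    linear_combination h y - y * h1
  refine ⟨a / (a + σ a), ?_⟩
  rw [map_div₀, map_add, hσ, add_comm (σ a) a, ← add_div, div_self ha]

end FiniteFields

/-! ### Linear functionals on residue fields. -/

section Functionals

variable {F R : Type*} [Field F] [CommRing R] [Algebra F R]

/-- A nonzero functional `l` makes `(a, r) ↦ l (a * r)` a nondegenerate pairing on the field `R ⧸
m`: an `a` outside `m` is invertible modulo `m`, and then `l` would vanish identically. -/
theorem mem_of_forall_functional_eq_zero {m : MaximalSpectrum R} {l : R →ₗ[F] F}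
    (hne : ∃ r, l r ≠ 0) (hl : ∀ a ∈ m.asIdeal, l a = 0) {a : R} (h : ∀ r, l (a * r) = 0) :
    a ∈ m.asIdeal := by
  by_contra hne'
  obtain ⟨b, c, hc, hbc⟩ := m.isMaximal.exists_inv hne'
  obtain ⟨r, hr⟩ := hne
  apply hr
  have h1 : r = a * (b * r) + c * r := by linear_combination -r * hbc
  rw [h1, map_add, h, hl _ (Ideal.mul_mem_right _ _ hc), add_zero]

/-- Any functional on the residue field is a multiple of a given nonzero one. -/
theorem exists_functional_eq_mul (m : MaximalSpectrum R) [Module.Finite F (R ⧸ m.asIdeal)]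
    {l l' : R →ₗ[F] F} (hne : ∃ r, l r ≠ 0) (hl : ∀ a ∈ m.asIdeal, l a = 0)
    (hl' : ∀ a ∈ m.asIdeal, l' a = 0) : ∃ a, ∀ r, l' r = l (a * r) := by
  let π : R →ₗ[F] (R ⧸ m.asIdeal) := (Ideal.Quotient.mkₐ F m.asIdeal).toLinearMap
  have hπ : Function.Surjective π := Ideal.Quotient.mkₐ_surjective F m.asIdeal
  obtain ⟨s, hs⟩ := π.exists_rightInverse_of_surjective (LinearMap.range_eq_top.2 hπ)
  have hs' : ∀ x, π (s x) = x := fun x => LinearMap.congr_fun hs x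
  have hker : ∀ {f : R →ₗ[F] F}, (∀ a ∈ m.asIdeal, f a = 0) → ∀ {x y}, π x = π y → f x = f y := by
    intro f hf x y hxy
    rw [← sub_eq_zero, ← map_sub]
    exact hf _ (Ideal.Quotient.eq.1 hxy)
  -- The pairing defined by `l` embeds the residue field into its dual space, and the dimensions
  -- agree.
  let T : (R ⧸ m.asIdeal) →ₗ[F] Dual F (R ⧸ m.asIdeal) :=
    (LinearMap.mul F (R ⧸ m.asIdeal)).compr₂ (l ∘ₗ s)
  have hT : ∀ a r, T (π a) (π r) = l (a * r) := by
    intro a r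
    change l (s (π a * π r)) = _
    exact hker hl ((hs' _).trans (map_mul (Ideal.Quotient.mkₐ F m.asIdeal) a r).symm)
  have hinj : Function.Injective T := by
    rw [injective_iff_map_eq_zero]
    intro x hx
    obtain ⟨a, rfl⟩ := hπ x
    have : a ∈ m.asIdeal := mem_of_forall_functional_eq_zero hne hl fun r => by
      rw [← hT, hx, LinearMap.zero_apply]
    exact Ideal.Quotient.eq_zero_iff_mem.2 this
  have hsurj := (LinearMap.injective_iff_surjective_of_finrank_eq_finrank
    (Subspace.dual_finrank_eq (K := F) (V := R ⧸ m.asIdeal)).symm).1 hinj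
  obtain ⟨x, hx⟩ := hsurj (l' ∘ₗ s)
  obtain ⟨a, rfl⟩ := hπ x
  refine ⟨a, fun r => ?_⟩
  rw [← hT, hx]
  exact hker hl' (hs' _).symm

variable (F) in
theorem exists_functional (m : MaximalSpectrum R) :
    ∃ l : R →ₗ[F] F, (∃ r, l r ≠ 0) ∧ ∀ a ∈ m.asIdeal, l a = 0 := by
  have h : (1 : R) ∉ m.asIdeal.restrictScalars F := fun h =>
    m.isMaximal.ne_top ((Ideal.eq_top_iff_one _).2 h)
  obtain ⟨f, hf, hf'⟩ := Submodule.exists_le_ker_of_notMem h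
  exact ⟨f, ⟨1, hf⟩, fun a ha => hf' ha⟩

end Functionals

/-! ### Hermitian modules over an algebra with involution. -/

/-- Compatible involutions on a field and on a commutative algebra over it. -/
structure IsSesqPair {F R : Type*} [Field F] [CommRing R] [Algebra F R] (σ : F →+* F)
    (τ : R →+* R) : Prop where
  sigma_sigma : ∀ a, σ (σ a) = a
  sigma_ne : ∃ a, σ a ≠ a
  tau_tau : ∀ r, τ (τ r) = r
  tau_algebraMap : ∀ a, τ (algebraMap F R a) = algebraMap F R (σ a)

/-- A nondegenerate Hermitian form on an `R`-module for which `τ` is the adjoint involution. -/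
structure IsHerm {F R V : Type*} [Field F] [CommRing R] [AddCommGroup V] [Module F V] [Module R V]
    (σ : F →+* F) (τ : R →+* R) (h : V → V → F) : Prop where
  add_left : ∀ u v w, h (u + v) w = h u w + h v w
  smul_left : ∀ (a : F) u v, h (a • u) v = a * h u v
  symm : ∀ u v, h v u = σ (h u v)
  adj : ∀ (r : R) u v, h (r • u) v = h u (τ r • v)
  nondeg : ∀ u, (∀ v, h u v = 0) → u = 0

section Hermitian

variable {F R : Type*} [Field F] [CommRing R] [Algebra F R] {σ : F →+* F} {τ : R →+* R}

/-- The involution induced on maximal ideals. -/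
def IsSesqPair.tauMax (hS : IsSesqPair (F := F) σ τ) (m : MaximalSpectrum R) : MaximalSpectrum R :=
  ⟨m.asIdeal.comap τ, by
    have := m.isMaximal
    exact Ideal.comap_isMaximal_of_surjective τ fun r => ⟨τ r, hS.tau_tau r⟩⟩

theorem IsSesqPair.mem_tauMax (hS : IsSesqPair (F := F) σ τ) {m : MaximalSpectrum R} {r : R} :
    r ∈ (hS.tauMax m).asIdeal ↔ τ r ∈ m.asIdeal := Iff.rfl

theorem IsSesqPair.tauMax_tauMax (hS : IsSesqPair (F := F) σ τ) (m : MaximalSpectrum R) :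
    hS.tauMax (hS.tauMax m) = m := by
  ext r
  rw [hS.mem_tauMax, hS.mem_tauMax, hS.tau_tau]

variable {V : Type*} [AddCommGroup V] [Module F V] [Module R V] {h : V → V → F}

namespace IsHerm

theorem add_right (hH : IsHerm (R := R) σ τ h) (u v w : V) : h u (v + w) = h u v + h u w := by
  rw [hH.symm, hH.add_left, map_add, ← hH.symm, ← hH.symm]

theorem zero_left (hH : IsHerm (R := R) σ τ h) (v : V) : h 0 v = 0 := by
  have := hH.add_left 0 0 v
  simpa using this

theorem zero_right (hH : IsHerm (R := R) σ τ h) (v : V) : h v 0 = 0 := by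
  rw [hH.symm, hH.zero_left, map_zero]

theorem smul_right (hH : IsHerm (R := R) σ τ h) (a : F) (u v : V) : h u (a • v) = σ a * h u v := by
  rw [hH.symm, hH.smul_left, map_mul, ← hH.symm]

theorem sub_right (hH : IsHerm (R := R) σ τ h) (u v w : V) : h u (v - w) = h u v - h u w := by
  rw [sub_eq_add_neg, hH.add_right, ← neg_one_smul F, hH.smul_right]
  simp [sub_eq_add_neg]

theorem eq_zero_comm (hH : IsHerm (R := R) σ τ h) {u v : V} (huv : h u v = 0) : h v u = 0 := by
  rw [hH.symm, huv, map_zero]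

theorem adj_right (hH : IsHerm (R := R) σ τ h)
    (hS : IsSesqPair (F := F) σ τ) (r : R) (u v : V) : h u (r • v) = h (τ r • u) v := by
  rw [hH.adj, hS.tau_tau]

/-- The functional `r ↦ h (r • u) w`. -/
def pair [IsScalarTower F R V] (hH : IsHerm (R := R) σ τ h) (u w : V) : R →ₗ[F] F where
  toFun r := h (r • u) w
  map_add' r s := by rw [add_smul, hH.add_left]
  map_smul' a r := by rw [smul_assoc, hH.smul_left]; rfl

theorem pair_apply [IsScalarTower F R V] (hH : IsHerm (R := R) σ τ h) (u w : V) (r : R) :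
    hH.pair u w r = h (r • u) w := rfl

/-- Every functional is represented by a vector. -/
theorem exists_eq_functional (hH : IsHerm (R := R) σ τ h) [Finite F] [Finite V] (f : V →ₗ[F] F) : ∃ w, ∀ x, f x = h x w := by
  -- `T` is only conjugate-linear, so its surjectivity is obtained from injectivity by counting
  -- elements.
  let T : V → Dual F V := fun w =>
    { toFun := fun x => h x w
      map_add' := fun x y => hH.add_left x y w
      map_smul' := fun a x => hH.smul_left a x w }
  have hT : Function.Injective T := by
    intro w w' hw
    rw [← sub_eq_zero]
    refine hH.nondeg _ fun v => hH.eq_zero_comm ?_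
    rw [hH.sub_right, sub_eq_zero]
    exact LinearMap.congr_fun hw v
  have hcard : Nat.card V = Nat.card (Dual F V) := by
    have e := LinearEquiv.ofFinrankEq V (Dual F V) (Subspace.dual_finrank_eq (K := F) (V := V)).symm
    exact Nat.card_congr e.toEquiv
  have : Finite (Dual F V) := Nat.finite_of_card_ne_zero (hcard ▸ Nat.card_pos.ne')
  obtain ⟨w, hw⟩ := ((Nat.bijective_iff_injective_and_card T).2 ⟨hT, hcard⟩).2 f
  exact ⟨w, fun x => by rw [← hw]; rfl⟩

/-- The orthogonal complement of a submodule. -/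
def perp (hS : IsSesqPair (F := F) σ τ) (hH : IsHerm (R := R) σ τ h) (D : Submodule R V) :
    Submodule R V where
  carrier := {v | ∀ x ∈ D, h x v = 0}
  add_mem' {v w} hv hw x hx := by rw [hH.add_right, hv x hx, hw x hx, add_zero]
  zero_mem' x _ := hH.zero_right x
  smul_mem' r v hv x hx := by
    rw [hH.adj_right hS]
    exact hv _ (D.smul_mem _ hx)

theorem restrict (hH : IsHerm (R := R) σ τ h) (hS : IsSesqPair (F := F) σ τ) [IsScalarTower F R V] {D : Submodule R V}
    (hD : Disjoint D (hH.perp hS D)) :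
    IsHerm (R := R) (V := D) σ τ (fun x y => h x y) where
  add_left _ _ _ := hH.add_left _ _ _
  smul_left _ _ _ := hH.smul_left _ _ _
  symm _ _ := hH.symm _ _
  adj _ _ _ := hH.adj _ _ _
  nondeg u hu := by
    have : (u : V) ∈ D ⊓ hH.perp hS D :=
      ⟨u.2, fun x hx => hH.eq_zero_comm (hu ⟨x, hx⟩)⟩
    rw [hD.eq_bot, mem_bot] at this
    exact Subtype.ext this

/-- Pairing with `v` is represented on the nondegenerate `D` by some `d`, and then `v - d` is
orthogonal to `D`. -/
theorem isCompl_perp (hH : IsHerm (R := R) σ τ h) (hS : IsSesqPair (F := F) σ τ) [IsScalarTower F R V] [Finite F] [Finite V]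
    {D : Submodule R V} (hD : Disjoint D (hH.perp hS D)) : IsCompl D (hH.perp hS D) := by
  refine ⟨hD, ?_⟩
  rw [codisjoint_iff, eq_top_iff]
  intro v _
  obtain ⟨d, hd⟩ := (hH.restrict hS hD).exists_eq_functional
    { toFun := fun x : D => h x v
      map_add' := fun x y => hH.add_left x y v
      map_smul' := fun a x => hH.smul_left a x v }
  refine mem_sup.2 ⟨d, d.2, v - d, fun x hx => ?_, by abel⟩
  rw [hH.sub_right, sub_eq_zero]
  exact hd ⟨x, hx⟩

/-- A vector of the complement that is orthogonal to the complement is orthogonal to everything.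
With `restrict`, this makes the complement a Hermitian module to which induction applies. -/
theorem disjoint_perp_perp (hH : IsHerm (R := R) σ τ h) (hS : IsSesqPair (F := F) σ τ) [IsScalarTower F R V] [Finite F]
    [Finite V] {D : Submodule R V} (hD : Disjoint D (hH.perp hS D)) :
    Disjoint (hH.perp hS D) (hH.perp hS (hH.perp hS D)) := by
  rw [disjoint_iff, eq_bot_iff]
  rintro v ⟨hv1, hv2⟩
  rw [mem_bot]
  refine hH.nondeg v fun w => hH.eq_zero_comm ?_
  have hw : w ∈ D ⊔ hH.perp hS D := (hH.isCompl_perp hS hD).sup_eq_top ▸ mem_top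
  obtain ⟨d, hd, p, hp, rfl⟩ := mem_sup.1 hw
  rw [hH.add_left, hv1 d hd, hv2 p hp, add_zero]

/-- A vector outside a submodule pairs nontrivially with a vector orthogonal to the submodule,
which may be chosen annihilated by the dual maximal ideal. -/
theorem exists_pairing (hH : IsHerm (R := R) σ τ h) (hS : IsSesqPair (F := F) σ τ) [IsScalarTower F R V] [Finite F] [Finite V]
    [IsSemisimpleModule R V] {m : MaximalSpectrum R} {u : V} (hmu : ∀ a ∈ m.asIdeal, a • u = 0)
    {U : Submodule R V} (hu : u ∉ U) :
    ∃ w ∈ hH.perp hS U, h u w ≠ 0 ∧ ∀ a ∈ (hS.tauMax m).asIdeal, a • w = 0 := by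
  obtain ⟨f, hf, hf'⟩ := Submodule.exists_le_ker_of_notMem (p := U.restrictScalars F) hu
  obtain ⟨w, hw⟩ := hH.exists_eq_functional f
  have hwU : w ∈ hH.perp hS U := fun x hx => by
    rw [← hw]
    exact hf' hx
  -- Decompose `w = y + t` with `y` in `J • Q` and `t` in a complement. Moving `J` across the form
  -- lands in `m`, which kills `u`, so `y` pairs to zero with `u`. And `J` kills `t`, because `J •
  -- t` lies in both summands.
  let Q := hH.perp hS U
  let J := (hS.tauMax m).asIdeal
  obtain ⟨C, hC⟩ := exists_isCompl (J • (⊤ : Submodule R Q))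
  have hw' : (⟨w, hwU⟩ : Q) ∈ J • (⊤ : Submodule R Q) ⊔ C := by
    rw [hC.sup_eq_top]
    exact mem_top
  obtain ⟨y, hy, t, ht, hyt⟩ := mem_sup.1 hw'
  have h1 : ∀ y ∈ J • (⊤ : Submodule R Q), h u (y : V) = 0 := by
    intro y hy
    refine Submodule.smul_induction_on hy (fun r hr x _ => ?_) (fun x y hx hy => ?_)
    · change h u (r • (x : V)) = 0
      rw [hH.adj_right hS, hmu _ hr, hH.zero_left]
    · change h u ((x : V) + (y : V)) = 0
      rw [hH.add_right, hx, hy, add_zero]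
  refine ⟨t, t.2, ?_, fun a ha => ?_⟩
  · have h2 : w = (y : V) + (t : V) := congrArg Subtype.val hyt.symm
    rw [hw, h2, hH.add_right, h1 y hy, zero_add] at hf
    exact hf
  · have h3 : a • t ∈ J • (⊤ : Submodule R Q) ⊓ C :=
      ⟨smul_mem_smul ha mem_top, C.smul_mem a ht⟩
    rw [hC.inf_eq_bot, mem_bot] at h3
    exact congrArg Subtype.val h3

end IsHerm

end Hermitian

/-! ### Anisotropic vectors, hyperbolic pairs and gluing of isometries. -/

section Hermitian

variable {F R : Type*} [Field F] [CommRing R] [Algebra F R] {σ : F →+* F} {τ : R →+* R}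
variable {V : Type*} [AddCommGroup V] [Module F V] [Module R V] {h : V → V → F}

theorem finite_quotient_of_smul_eq_zero [Finite V] {m : MaximalSpectrum R} {v : V} (hv : v ≠ 0)
    (hmv : ∀ a ∈ m.asIdeal, a • v = 0) : Finite (R ⧸ m.asIdeal) :=
  Finite.of_equiv _ (spanSingletonEquiv hv hmv).symm.toEquiv

namespace IsHerm

theorem pair_eq_zero (hH : IsHerm (R := R) σ τ h) [IsScalarTower F R V] {m : MaximalSpectrum R}
    {u : V} (hmu : ∀ a ∈ m.asIdeal, a • u = 0) (w : V) : ∀ a ∈ m.asIdeal, hH.pair u w a = 0 := by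
  intro a ha
  rw [pair_apply, hmu a ha, hH.zero_left]

/-- A self-dual isotypic component contains a vector generating a nondegenerate submodule. -/
theorem exists_anisotropic (hH : IsHerm (R := R) σ τ h) (hS : IsSesqPair (F := F) σ τ)
    [IsScalarTower F R V] [Finite F] [Finite V] [IsSemisimpleModule R V] {m : MaximalSpectrum R}
    (hm : hS.tauMax m = m) {u : V} (hu : u ≠ 0) (hmu : ∀ a ∈ m.asIdeal, a • u = 0) :
    ∃ v, (∀ a ∈ m.asIdeal, a • v = 0) ∧ ∃ r, hH.pair v v r ≠ 0 := by
  by_contra! hcon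
  obtain ⟨w, -, huw, hmw⟩ := hH.exists_pairing hS hmu (U := ⊥) (by simpa using hu)
  rw [hm] at hmw
  have hcon' : ∀ v, (∀ a ∈ m.asIdeal, a • v = 0) → ∀ r : R, h (r • v) v = 0 := hcon
  have hsw : ∀ s : R, ∀ a ∈ m.asIdeal, a • (s • w) = 0 := fun s a ha => by
    rw [smul_comm, hmw a ha, smul_zero]
  have hone : ∃ r, hH.pair u w r ≠ 0 := ⟨1, by rwa [pair_apply, one_smul]⟩
  -- Polarization: expand `h (r • v) v = 0` for `v = u + s • w`.
  have E : ∀ r s : R, hH.pair u w (τ s * r) + σ (hH.pair u w (τ r * τ s)) = 0 := by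
    intro r s
    have h1 := hcon' (u + s • w) (fun a ha => by
      rw [smul_add, hmu a ha, hsw s a ha, add_zero]) r
    rw [smul_add, hH.add_left, hH.add_right, hH.add_right, hcon' u hmu r,
      hcon' (s • w) (hsw s) r, zero_add, add_zero, hH.adj_right hS, smul_smul,
      hH.symm u (r • s • w), smul_smul, hH.adj_right hS, map_mul] at h1
    exact h1
  have hσ : Function.Injective σ := σ.injective
  -- Comparing two instances of `E` shows that `τ` is trivial modulo `m`. This is impossible, since
  -- on scalars `τ` restricts to `σ`, which is not the identity.
  have key : ∀ s : R, τ s - s ∈ m.asIdeal := by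
    intro s
    refine mem_of_forall_functional_eq_zero hone (hH.pair_eq_zero hmu w) fun y => ?_
    have h1 := E (τ y) s
    have h2 := E (τ s * τ y) 1
    rw [hS.tau_tau] at h1
    rw [map_one, one_mul, map_mul τ, hS.tau_tau, hS.tau_tau, mul_one] at h2
    have h3 : hH.pair u w (y * τ s) = hH.pair u w (s * y) := hσ (by linear_combination h1 - h2)
    rw [sub_mul, map_sub, sub_eq_zero, mul_comm, h3]
  obtain ⟨a, ha⟩ := hS.sigma_ne
  have h1 := key (algebraMap F R a)
  rw [hS.tau_algebraMap, ← map_sub] at h1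
  exact m.isMaximal.ne_top (Ideal.eq_top_of_isUnit_mem _ h1
    ((sub_ne_zero.2 ha).isUnit.map (algebraMap F R)))

/-- A vector generating an isotropic simple submodule has a hyperbolic partner with prescribed
pairing, orthogonal to a given submodule. -/
theorem exists_hyperbolic_partner (hH : IsHerm (R := R) σ τ h) (hS : IsSesqPair (F := F) σ τ)
    [IsScalarTower F R V] [Finite F] [Finite V] [IsSemisimpleModule R V] {m : MaximalSpectrum R}
    {u : V} (hmu : ∀ a ∈ m.asIdeal, a • u = 0) (huu : ∀ r : R, h (r • u) u = 0)
    {U : Submodule R V} (huU : u ∉ U) (hUu : ∀ x ∈ U, h x u = 0) {l : R →ₗ[F] F}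
    (hl : ∃ r, l r ≠ 0) (hlm : ∀ a ∈ m.asIdeal, l a = 0) :
    ∃ w, (∀ x ∈ U, h x w = 0) ∧ (∀ r : R, h (r • u) w = l r) ∧ (∀ r : R, h (r • w) w = 0) ∧
      ∀ a ∈ (hS.tauMax m).asIdeal, a • w = 0 := by
  have hu : u ≠ 0 := fun hu => huU (hu ▸ U.zero_mem)
  have := finite_quotient_of_smul_eq_zero hu hmu
  obtain ⟨w₀, hw₀U, huw₀, hmw₀⟩ := hH.exists_pairing hS hmu huU
  have hone : ∃ r, hH.pair u w₀ r ≠ 0 := ⟨1, by rwa [pair_apply, one_smul]⟩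
  obtain ⟨a, ha⟩ := exists_functional_eq_mul m hone (hH.pair_eq_zero hmu w₀) hlm
  have hw₁ : ∃ w, w ∈ hH.perp hS U ∧ (∀ r : R, h (r • u) w = l r) ∧
      ∀ a ∈ (hS.tauMax m).asIdeal, a • w = 0 := by
    refine ⟨τ a • w₀, Submodule.smul_mem _ _ hw₀U, fun r => ?_, fun b hb => ?_⟩
    · rw [hH.adj_right hS, hS.tau_tau, smul_smul, ha, pair_apply]
    · rw [smul_comm, hmw₀ b hb, smul_zero]
  obtain ⟨w, hwU, hwl, hmw⟩ := hw₁
  have hk : ∀ b ∈ m.asIdeal, hH.pair w w b = 0 := fun b hb => by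
    rw [pair_apply, hH.adj, hmw _ (by rwa [hS.mem_tauMax, hS.tau_tau]), hH.zero_right]
  by_cases hm : hS.tauMax m = m
  -- Adding `s • u` to `w` does not change its pairings with multiples of `u`. With `s` chosen so,
  -- the two cross terms are `-θ` and `-σ θ` times `h (r • w) w` and cancel it, because `θ + σ θ =
  -- 1`.
  · obtain ⟨θ, hθ⟩ := exists_add_map_eq_one σ hS.sigma_sigma hS.sigma_ne
    obtain ⟨s, hs⟩ := exists_functional_eq_mul m (l' := (-θ) • hH.pair w w) hl hlm (fun b hb => by
      rw [LinearMap.smul_apply, hk b hb, smul_zero])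
    refine ⟨w + s • u, fun x hx => ?_, fun r => ?_, fun r => ?_, fun b hb => ?_⟩
    · rw [hH.add_right, hwU x hx, hH.adj_right hS, hUu _ (U.smul_mem _ hx), add_zero]
    · rw [hH.add_right, hwl, hH.adj_right hS, smul_smul, huu, add_zero]
    · have h1 : h (r • s • u) w = - θ * h (r • w) w := by
        rw [smul_smul, hwl, mul_comm, ← hs]
        rfl
      have h2 : h (r • w) (s • u) = - σ θ * h (r • w) w := by
        have h3 : h (τ r • s • u) w = - θ * h (τ r • w) w := by
          rw [smul_smul, hwl, mul_comm, ← hs]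
          rfl
        rw [hH.symm (s • u), hH.adj_right hS, h3, map_mul, map_neg, ← hH.symm, hH.adj_right hS,
          hS.tau_tau]
      rw [smul_add, hH.add_left, hH.add_right, hH.add_right, h1, h2, smul_smul,
        hH.adj_right hS s, smul_smul, huu]
      linear_combination (- h (r • w) w) * hθ
    · rw [smul_add, hmw b hb, zero_add, smul_comm, hmu b (hm ▸ hb), smul_zero]
  -- When `m` is not self-dual, `r` is a sum of an element of the dual ideal, which kills `w`, and
  -- one of `m`, which kills `w` after being moved across the form. So `w` is isotropic without
  -- correction.
  · refine ⟨w, hwU, hwl, fun r => ?_, hmw⟩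
    have hs : m.asIdeal ⊔ (hS.tauMax m).asIdeal = ⊤ :=
      m.isMaximal.coprime_of_ne (hS.tauMax m).isMaximal fun h' => hm (MaximalSpectrum.ext h'.symm)
    have h1 : r ∈ m.asIdeal ⊔ (hS.tauMax m).asIdeal := hs ▸ Submodule.mem_top
    obtain ⟨b, hb, c, hc, rfl⟩ := Submodule.mem_sup.1 h1
    rw [add_smul, hH.add_left, hmw c hc, hH.zero_left, add_zero]
    exact hk b hb

/-- If `r • v` is orthogonal to all multiples of `v`, the pairing of the residue field attached to
`v` puts `r` into `m`. -/
theorem disjoint_perp_span_singleton (hH : IsHerm (R := R) σ τ h) (hS : IsSesqPair (F := F) σ τ)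
    [IsScalarTower F R V] {m : MaximalSpectrum R} {v : V} (hmv : ∀ a ∈ m.asIdeal, a • v = 0)
    (hne : ∃ r, hH.pair v v r ≠ 0) : Disjoint (R ∙ v) (hH.perp hS (R ∙ v)) := by
  rw [disjoint_iff, eq_bot_iff]
  rintro x ⟨hx, hx'⟩
  obtain ⟨r, rfl⟩ := mem_span_singleton.1 hx
  rw [mem_bot]
  refine hmv r (mem_of_forall_functional_eq_zero hne (hH.pair_eq_zero hmv v) fun s => ?_)
  rw [mul_comm, pair_apply, mul_smul, hH.adj]
  have := hx' (τ s • v) (Submodule.smul_mem _ _ (mem_span_singleton_self v))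
  exact hH.eq_zero_comm this

section Hyperbolic

variable {m : MaximalSpectrum R} {u w : V} {l : R →ₗ[F] F}

theorem smul_eq_zero_of_hyperbolic (hH : IsHerm (R := R) σ τ h)
    (hmu : ∀ a ∈ m.asIdeal, a • u = 0) (hl : ∃ r, l r ≠ 0) (hlm : ∀ a ∈ m.asIdeal, l a = 0)
    (hS : IsSesqPair (F := F) σ τ)
    (huw : ∀ r : R, h (r • u) w = l r) {r : R} (hr : ∀ t : R, h (r • u) (t • w) = 0) :
    r • u = 0 := by
  refine hmu r (mem_of_forall_functional_eq_zero hl hlm fun t => ?_)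
  rw [← huw, mul_comm, mul_smul, ← hS.tau_tau t, ← hH.adj_right hS]
  exact hr _

theorem disjoint_hyperbolic (hH : IsHerm (R := R) σ τ h) (hS : IsSesqPair (F := F) σ τ)
    (hmu : ∀ a ∈ m.asIdeal, a • u = 0) (hl : ∃ r, l r ≠ 0) (hlm : ∀ a ∈ m.asIdeal, l a = 0)
    (huw : ∀ r : R, h (r • u) w = l r) (hww : ∀ r : R, h (r • w) w = 0) :
    Disjoint (R ∙ u) (R ∙ w) := by
  rw [disjoint_iff, eq_bot_iff]
  rintro x ⟨hx, hx'⟩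
  obtain ⟨r, rfl⟩ := mem_span_singleton.1 hx
  obtain ⟨s, hs⟩ := mem_span_singleton.1 hx'
  rw [mem_bot]
  refine hH.smul_eq_zero_of_hyperbolic hmu hl hlm hS huw fun t => ?_
  rw [← hs, hH.adj_right hS, smul_smul, hww]

theorem disjoint_perp_hyperbolic (hH : IsHerm (R := R) σ τ h) (hS : IsSesqPair (F := F) σ τ)
    (hmu : ∀ a ∈ m.asIdeal, a • u = 0) (hmw : ∀ a ∈ (hS.tauMax m).asIdeal, a • w = 0)
    (hl : ∃ r, l r ≠ 0) (hlm : ∀ a ∈ m.asIdeal, l a = 0) (huu : ∀ r : R, h (r • u) u = 0)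
    (huw : ∀ r : R, h (r • u) w = l r) (hww : ∀ r : R, h (r • w) w = 0) :
    Disjoint ((R ∙ u) ⊔ (R ∙ w)) (hH.perp hS ((R ∙ u) ⊔ (R ∙ w))) := by
  rw [disjoint_iff, eq_bot_iff]
  rintro x ⟨hx, hx'⟩
  obtain ⟨_, hy, _, hz, rfl⟩ := mem_sup.1 hx
  obtain ⟨r, rfl⟩ := mem_span_singleton.1 hy
  obtain ⟨s, rfl⟩ := mem_span_singleton.1 hz
  have h1 : r • u = 0 := by
    refine hH.smul_eq_zero_of_hyperbolic hmu hl hlm hS huw fun t => hH.eq_zero_comm ?_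
    have := hx' (t • w) (mem_sup_right (Submodule.smul_mem _ _ (mem_span_singleton_self w)))
    rwa [hH.add_right, hH.adj_right hS s, smul_smul, hww, add_zero] at this
  have h2 : s • w = 0 := by
    refine hmw s ?_
    rw [hS.mem_tauMax]
    refine mem_of_forall_functional_eq_zero hl hlm fun t => ?_
    have := hx' (t • u) (mem_sup_left (Submodule.smul_mem _ _ (mem_span_singleton_self u)))
    rwa [hH.add_right, hH.adj_right hS r, smul_smul, huu, zero_add, hH.adj_right hS, smul_smul,
      huw] at this
  rw [h1, h2, add_zero]
  exact zero_mem _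

/-- The value depends on the functional `l` alone, so hyperbolic pairs with the same `l` span
isometric submodules even in different modules. -/
theorem gram_hyperbolic (hH : IsHerm (R := R) σ τ h) (hS : IsSesqPair (F := F) σ τ)
    (huu : ∀ r : R, h (r • u) u = 0)
    (huw : ∀ r : R, h (r • u) w = l r) (hww : ∀ r : R, h (r • w) w = 0) (r s r' s' : R) :
    h (r • u + s • w) (r' • u + s' • w) = l (τ s' * r) + σ (l (τ s * r')) := by
  rw [hH.add_left, hH.add_right, hH.add_right, hH.adj_right hS r', smul_smul, huu,
    hH.adj_right hS s' (s • w), smul_smul, hww, hH.adj_right hS s', smul_smul, huw,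
    hH.symm (r' • u), hH.adj_right hS s, smul_smul, huw]
  ring

end Hyperbolic

variable {V' : Type*} [AddCommGroup V'] [Module F V'] [Module R V'] {h' : V' → V' → F}

/-- If `φ x = 0`, then `φ' x` is orthogonal to the range of `φ'`, which is nondegenerate. -/
theorem ker_le_of_gram (hH : IsHerm (R := R) σ τ h) (hH' : IsHerm (R := R) σ τ h')
    (hS : IsSesqPair (F := F) σ τ) {M : Type*}
    [AddCommGroup M] [Module R M] (φ : M →ₗ[R] V) (φ' : M →ₗ[R] V')
    (hgram : ∀ x y, h (φ x) (φ y) = h' (φ' x) (φ' y))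
    (hD' : Disjoint (LinearMap.range φ') (hH'.perp hS (LinearMap.range φ'))) :
    LinearMap.ker φ ≤ LinearMap.ker φ' := by
  intro x hx
  rw [LinearMap.mem_ker] at hx ⊢
  have : φ' x ∈ LinearMap.range φ' ⊓ hH'.perp hS (LinearMap.range φ') := by
    refine ⟨⟨x, rfl⟩, ?_⟩
    rintro _ ⟨y, rfl⟩
    rw [← hgram, hx, hH.zero_right]
  rwa [hD'.eq_bot, mem_bot] at this

/-- Maps with equal Gram matrices and nondegenerate images have isometric images. -/
theorem exists_range_equiv_of_gram (hH : IsHerm (R := R) σ τ h) (hH' : IsHerm (R := R) σ τ h')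
    (hS : IsSesqPair (F := F) σ τ) {M : Type*}
    [AddCommGroup M] [Module R M] (φ : M →ₗ[R] V) (φ' : M →ₗ[R] V')
    (hgram : ∀ x y, h (φ x) (φ y) = h' (φ' x) (φ' y))
    (hD : Disjoint (LinearMap.range φ) (hH.perp hS (LinearMap.range φ)))
    (hD' : Disjoint (LinearMap.range φ') (hH'.perp hS (LinearMap.range φ'))) :
    ∃ e : LinearMap.range φ ≃ₗ[R] LinearMap.range φ', ∀ x, (e ⟨φ x, x, rfl⟩ : V') = φ' x := by
  have hker : LinearMap.ker φ = LinearMap.ker φ' :=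
    le_antisymm (hH.ker_le_of_gram hH' hS φ φ' hgram hD')
      (hH'.ker_le_of_gram hH hS φ' φ (fun x y => (hgram x y).symm) hD)
  refine ⟨φ.quotKerEquivRange.symm.trans ((Submodule.quotEquivOfEq _ _ hker).trans
    φ'.quotKerEquivRange), fun x => ?_⟩
  have h1 : φ.quotKerEquivRange.symm ⟨φ x, x, rfl⟩ = Submodule.Quotient.mk x := by
    rw [LinearEquiv.symm_apply_eq]
    rfl
  simp only [LinearEquiv.trans_apply]
  rw [h1]
  rfl

/-- Gluing isometries along an orthogonal decomposition. -/
theorem exists_isometry_of_gram (hH : IsHerm (R := R) σ τ h) (hH' : IsHerm (R := R) σ τ h')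
    (hS : IsSesqPair (F := F) σ τ) [IsScalarTower F R V] [IsScalarTower F R V'] [Finite F]
    [Finite V] [Finite V'] {M : Type*}
    [AddCommGroup M] [Module R M] (φ : M →ₗ[R] V) (φ' : M →ₗ[R] V')
    (hgram : ∀ x y, h (φ x) (φ y) = h' (φ' x) (φ' y)) {D : Submodule R V} {D' : Submodule R V'}
    (hφ : LinearMap.range φ = D) (hφ' : LinearMap.range φ' = D')
    (hD : Disjoint D (hH.perp hS D)) (hD' : Disjoint D' (hH'.perp hS D'))
    (ψ : hH.perp hS D ≃ₗ[R] hH'.perp hS D') (hψ : ∀ x y, h' (ψ x) (ψ y) = h x y) :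
    ∃ f : V ≃ₗ[R] V', (∀ x y, h' (f x) (f y) = h x y) ∧ (∀ x, f (φ x) = φ' x) ∧
      ∀ x : hH.perp hS D, f x = ψ x := by
  subst hφ hφ'
  obtain ⟨e, he⟩ := hH.exists_range_equiv_of_gram hH' hS φ φ' hgram hD hD'
  have hC := hH.isCompl_perp hS hD
  have hC' := hH'.isCompl_perp hS hD'
  let f : V ≃ₗ[R] V' := (prodEquivOfIsCompl _ _ hC).symm.trans ((e.prodCongr ψ).trans
    (prodEquivOfIsCompl _ _ hC'))
  have h1 : ∀ x, f (φ x) = φ' x := by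
    intro x
    have : (prodEquivOfIsCompl _ _ hC).symm (φ x) = (⟨φ x, x, rfl⟩, 0) :=
      prodEquivOfIsCompl_symm_apply_left _ _ hC ⟨φ x, x, rfl⟩
    simp only [f, LinearEquiv.trans_apply]
    rw [this]
    simp [he]
  have h2 : ∀ x : hH.perp hS (LinearMap.range φ), f x = ψ x := by
    intro x
    have : (prodEquivOfIsCompl _ _ hC).symm x = (0, x) :=
      prodEquivOfIsCompl_symm_apply_right _ _ hC x
    simp only [f, LinearEquiv.trans_apply]
    rw [this]
    simp
  refine ⟨f, fun x y => ?_, h1, h2⟩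
  have hx : x ∈ LinearMap.range φ ⊔ hH.perp hS (LinearMap.range φ) := hC.sup_eq_top ▸ mem_top
  have hy : y ∈ LinearMap.range φ ⊔ hH.perp hS (LinearMap.range φ) := hC.sup_eq_top ▸ mem_top
  obtain ⟨_, ⟨x₁, rfl⟩, x₂, hx₂, rfl⟩ := mem_sup.1 hx
  obtain ⟨_, ⟨y₁, rfl⟩, y₂, hy₂, rfl⟩ := mem_sup.1 hy
  have e1 : f x₂ = ψ ⟨x₂, hx₂⟩ := h2 ⟨x₂, hx₂⟩
  have e2 : f y₂ = ψ ⟨y₂, hy₂⟩ := h2 ⟨y₂, hy₂⟩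
  rw [map_add, map_add, h1, h1, e1, e2, hH.add_left, hH.add_right, hH.add_right, hH'.add_left,
    hH'.add_right, hH'.add_right, hψ, ← hgram, hy₂ (φ x₁) ⟨x₁, rfl⟩,
    hH.eq_zero_comm (hx₂ (φ y₁) ⟨y₁, rfl⟩), (ψ ⟨y₂, hy₂⟩).2 (φ' x₁) ⟨x₁, rfl⟩,
    hH'.eq_zero_comm ((ψ ⟨x₂, hx₂⟩).2 (φ' y₁) ⟨y₁, rfl⟩)]

end IsHerm

end Hermitian

universe v v'

/-! ### Witt's theorem and self-duality of multiplicities. -/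

section Hermitian

variable {F R : Type*} [Field F] [CommRing R] [Algebra F R] {σ : F →+* F} {τ : R →+* R}

namespace IsHerm

/-- The inductive step for Witt's theorem. The simple summand generated by `u` gets a hyperbolic
partner orthogonal to the image of `C`, so the rest of the isotropic module survives in the
complement of the plane. -/
theorem exists_hyperbolic_split (hS : IsSesqPair (F := F) σ τ) {V T : Type*} [AddCommGroup V]
    [Module F V] [Module R V] [IsScalarTower F R V] [Finite F] [Finite V] [IsSemisimpleModule R V]
    {h : V → V → F} (hH : IsHerm (R := R) σ τ h) [AddCommGroup T] [Module R T] {φ : T →ₗ[R] V}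
    (hφ : Function.Injective φ) (hiso : ∀ x y, h (φ x) (φ y) = 0) {m : MaximalSpectrum R} {u : T}
    (hu : u ≠ 0) (hmu : ∀ a ∈ m.asIdeal, a • u = 0) {C : Submodule R T} (hC : IsCompl (R ∙ u) C)
    {l : R →ₗ[F] F} (hl : ∃ r, l r ≠ 0) (hlm : ∀ a ∈ m.asIdeal, l a = 0) :
    ∃ w, (∀ r : R, h (r • φ u) w = l r) ∧ (∀ r : R, h (r • w) w = 0) ∧
      Disjoint ((R ∙ φ u) ⊔ (R ∙ w)) (hH.perp hS ((R ∙ φ u) ⊔ (R ∙ w))) ∧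
      (∀ c ∈ C, φ c ∈ hH.perp hS ((R ∙ φ u) ⊔ (R ∙ w))) ∧
      mult R ((R ∙ φ u) ⊔ (R ∙ w) : Submodule R V) =
        Finsupp.single m 1 + Finsupp.single (hS.tauMax m) 1 := by
  have hmu' : ∀ a ∈ m.asIdeal, a • φ u = 0 := fun a ha => by rw [← map_smul, hmu a ha, map_zero]
  have hu' : φ u ≠ 0 := fun h0 => hu (hφ (h0.trans (map_zero φ).symm))
  have huu : ∀ r : R, h (r • φ u) (φ u) = 0 := fun r => by rw [← map_smul, hiso]
  have huC : φ u ∉ C.map φ := by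
    rintro ⟨c, hc, hcu⟩
    have hcu' := hφ hcu
    subst hcu'
    have : c ∈ (R ∙ c) ⊓ C := ⟨mem_span_singleton_self c, hc⟩
    rw [hC.inf_eq_bot, mem_bot] at this
    exact hu this
  obtain ⟨w, hwC, huw, hww, hmw⟩ := hH.exists_hyperbolic_partner hS hmu' huu huC (by
    rintro _ ⟨c, -, rfl⟩
    exact hiso c u) hl hlm
  have hw : w ≠ 0 := by
    rintro rfl
    obtain ⟨r, hr⟩ := hl
    rw [← huw, hH.zero_right] at hr
    exact hr rfl
  refine ⟨w, huw, hww, hH.disjoint_perp_hyperbolic hS hmu' hmw hl hlm huu huw hww, ?_, ?_⟩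
  · intro c hc x hx
    obtain ⟨_, hy, _, hz, rfl⟩ := mem_sup.1 hx
    obtain ⟨r, rfl⟩ := mem_span_singleton.1 hy
    obtain ⟨s, rfl⟩ := mem_span_singleton.1 hz
    rw [hH.add_left, ← map_smul, hiso, zero_add, hH.adj]
    refine hH.eq_zero_comm (hwC _ ?_)
    rw [← map_smul]
    exact mem_map_of_mem (C.smul_mem _ hc)
  · rw [mult_sup_of_disjoint (hH.disjoint_hyperbolic hS hmu' hl hlm huw hww),
      mult_span_singleton hu' hmu', mult_span_singleton hw hmw]

/-- Vectors generating isomorphic nondegenerate simple submodules can be rescaled to generate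
isometric ones. -/
theorem exists_smul_pair_eq (hS : IsSesqPair (F := F) σ τ) {V V' : Type*} [AddCommGroup V]
    [Module F V] [Module R V] [IsScalarTower F R V] [Finite V] [AddCommGroup V']
    [Module F V'] [Module R V'] [IsScalarTower F R V']
    {h : V → V → F} (hH : IsHerm (R := R) σ τ h) {h' : V' → V' → F}
    (hH' : IsHerm (R := R) σ τ h') {m : MaximalSpectrum R} (hm : hS.tauMax m = m) {v : V} {v' : V'}
    (hmv : ∀ a ∈ m.asIdeal, a • v = 0) (hmv' : ∀ a ∈ m.asIdeal, a • v' = 0)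
    (hv : ∃ r, hH.pair v v r ≠ 0) (hv' : ∃ r, hH'.pair v' v' r ≠ 0) :
    ∃ b : R, ∀ r, hH.pair (b • v) (b • v) r = hH'.pair v' v' r := by
  have hv0 : v ≠ 0 := by
    rintro rfl
    obtain ⟨r, hr⟩ := hv
    rw [pair_apply, hH.zero_right] at hr
    exact hr rfl
  have := finite_quotient_of_smul_eq_zero hv0 hmv
  let _ := Ideal.Quotient.field m.asIdeal
  obtain ⟨a, ha⟩ := exists_functional_eq_mul m hv (hH.pair_eq_zero hmv v)
    (hH'.pair_eq_zero hmv' v')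
  have hherm : ∀ r, hH.pair v v (τ r) = σ (hH.pair v v r) := fun r => by
    rw [pair_apply, pair_apply, hH.adj, hS.tau_tau, hH.symm]
  have hherm' : ∀ r, hH'.pair v' v' (τ r) = σ (hH'.pair v' v' r) := fun r => by
    rw [pair_apply, pair_apply, hH'.adj, hS.tau_tau, hH'.symm]
  -- Both pairings are Hermitian, so their ratio `a` is fixed by the involution of the residue
  -- field. It is therefore a norm, and scaling `v` by `b` multiplies its pairing by the norm of
  -- `b`.
  have ha' : τ a - a ∈ m.asIdeal := by
    refine mem_of_forall_functional_eq_zero hv (hH.pair_eq_zero hmv v) fun r => ?_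
    have h1 := hherm' (τ r)
    rw [hS.tau_tau, ha, ha, ← hherm, map_mul τ, hS.tau_tau] at h1
    rw [sub_mul, map_sub, h1, sub_self]
  have ha0 : a ∉ m.asIdeal := by
    intro ha0
    obtain ⟨r, hr⟩ := hv'
    rw [ha] at hr
    exact hr (hH.pair_eq_zero hmv v _ (Ideal.mul_mem_right _ _ ha0))
  let α : R ⧸ m.asIdeal →+* R ⧸ m.asIdeal :=
    Ideal.quotientMap m.asIdeal τ (by
      intro r hr
      have : r ∈ (hS.tauMax m).asIdeal := by
        rw [hm]
        exact hr
      exact this)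
  have hα : ∀ r, α (Ideal.Quotient.mk _ r) = Ideal.Quotient.mk _ (τ r) := fun r =>
    Ideal.quotientMap_mk
  obtain ⟨b, hb⟩ := exists_mul_map_eq α (fun x => by
      obtain ⟨r, rfl⟩ := Ideal.Quotient.mk_surjective x
      rw [hα, hα, hS.tau_tau]) (by
      obtain ⟨x, hx⟩ := hS.sigma_ne
      refine ⟨Ideal.Quotient.mk _ (algebraMap F R x), fun h1 => ?_⟩
      rw [hα, hS.tau_algebraMap, Ideal.Quotient.eq, ← map_sub] at h1
      exact m.isMaximal.ne_top (Ideal.eq_top_of_isUnit_mem _ h1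
        ((sub_ne_zero.2 hx).isUnit.map (algebraMap F R))))
    (a := Ideal.Quotient.mk _ a) (by rw [hα, Ideal.Quotient.eq]; exact ha')
    (fun h0 => ha0 (Ideal.Quotient.eq_zero_iff_mem.1 h0))
  obtain ⟨b, rfl⟩ := Ideal.Quotient.mk_surjective b
  rw [hα, ← map_mul, Ideal.Quotient.eq] at hb
  refine ⟨b, fun r => ?_⟩
  rw [ha, pair_apply, hH.adj_right hS, smul_smul, smul_smul, ← pair_apply hH, ← sub_eq_zero,
    ← map_sub]
  apply hH.pair_eq_zero hmv v
  have : τ b * r * b - a * r = (b * τ b - a) * r := by ring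
  rw [this]
  exact Ideal.mul_mem_right _ _ hb

/-- `R` is the sum of `m` and its dual ideal: the first kills `v` on the left of the form, the
second on the right. -/
theorem self_pair_eq_zero (hS : IsSesqPair (F := F) σ τ) {V : Type*} [AddCommGroup V]
    [Module F V] [Module R V] {h : V → V → F} (hH : IsHerm (R := R) σ τ h)
    {m : MaximalSpectrum R} (hm : hS.tauMax m ≠ m) {v : V} (hmv : ∀ a ∈ m.asIdeal, a • v = 0)
    (r : R) : h (r • v) v = 0 := by
  have hs : m.asIdeal ⊔ (hS.tauMax m).asIdeal = ⊤ :=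
    m.isMaximal.coprime_of_ne (hS.tauMax m).isMaximal fun h' => hm (MaximalSpectrum.ext h'.symm)
  have h1 : r ∈ m.asIdeal ⊔ (hS.tauMax m).asIdeal := hs ▸ Submodule.mem_top
  obtain ⟨b, hb, c, hc, rfl⟩ := Submodule.mem_sup.1 h1
  rw [add_smul, hH.add_left, hmv b hb, hH.zero_left, zero_add, hH.adj, hmv _ hc, hH.zero_right]

/-- Witt's theorem for semisimple Hermitian modules. -/
theorem exists_isometry_comp_eq (hS : IsSesqPair (F := F) σ τ) {V T : Type v} {V' : Type v'}
    [AddCommGroup V] [Module F V] [Module R V] [IsScalarTower F R V] [Finite F] [Finite V]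
    [IsSemisimpleModule R V] [AddCommGroup V'] [Module F V'] [Module R V'] [IsScalarTower F R V']
    [Finite V'] [IsSemisimpleModule R V'] {h : V → V → F} (hH : IsHerm (R := R) σ τ h)
    {h' : V' → V' → F} (hH' : IsHerm (R := R) σ τ h') [AddCommGroup T] [Module R T]
    {φ : T →ₗ[R] V} (hφ : Function.Injective φ) (hiso : ∀ x y, h (φ x) (φ y) = 0)
    {φ' : T →ₗ[R] V'} (hφ' : Function.Injective φ') (hiso' : ∀ x y, h' (φ' x) (φ' y) = 0)
    (hmult : mult R V = mult R V') :
    ∃ f : V ≃ₗ[R] V', (∀ x y, h' (f x) (f y) = h x y) ∧ ∀ t, f (φ t) = φ' t := by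
  obtain ⟨n, hn⟩ : ∃ n, Nat.card V = n := ⟨_, rfl⟩
  induction n using Nat.strong_induction_on generalizing V V' T with
  | _ n ih =>
  -- For nonzero `T`, split off hyperbolic planes with the same functional `l` in both modules and
  -- apply induction to their complements. `T` is kept arbitrary because the case of zero isotropic
  -- part also reduces to this one.
  have step : ∀ {T : Type v} [AddCommGroup T] [Module R T] {φ : T →ₗ[R] V}
      (_ : Function.Injective φ) (_ : ∀ x y, h (φ x) (φ y) = 0) {φ' : T →ₗ[R] V'}
      (_ : Function.Injective φ') (_ : ∀ x y, h' (φ' x) (φ' y) = 0), Nontrivial T →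
      ∃ f : V ≃ₗ[R] V', (∀ x y, h' (f x) (f y) = h x y) ∧ ∀ t, f (φ t) = φ' t := by
    intro T _ _ φ hφ hiso φ' hφ' hiso' hT
    have : IsSemisimpleModule R T := IsSemisimpleModule.of_injective φ hφ
    obtain ⟨m, u, hu, hmu⟩ := exists_maximal_annihilator (R := R) (V := T)
    obtain ⟨C, hC⟩ := exists_isCompl (R ∙ u)
    obtain ⟨l, hl, hlm⟩ := exists_functional F m
    obtain ⟨w, huw, hww, hD, hCD, hmD⟩ := hH.exists_hyperbolic_split hS hφ hiso hu hmu hC hl hlm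
    obtain ⟨w', huw', hww', hD', hCD', hmD'⟩ :=
      hH'.exists_hyperbolic_split hS hφ' hiso' hu hmu hC hl hlm
    have h1 := mult_add_of_isCompl (hH.isCompl_perp hS hD)
    have h2 := mult_add_of_isCompl (hH'.isCompl_perp hS hD')
    rw [hmD] at h1
    rw [hmD', ← hmult, ← h1] at h2
    have hu' : φ u ≠ 0 := fun h0 => hu (hφ (h0.trans (map_zero φ).symm))
    obtain ⟨ψ, hψ, hψ'⟩ := ih _ (hn ▸ natCard_lt_of_isCompl (hH.isCompl_perp hS hD) hu'
      (mem_sup_left (mem_span_singleton_self _))) (hH.restrict hS (hH.disjoint_perp_perp hS hD))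
      (hH'.restrict hS (hH'.disjoint_perp_perp hS hD'))
      (φ := (φ ∘ₗ C.subtype).codRestrict _ (fun c => hCD c c.2))
      (fun x y hxy => Subtype.ext (hφ (congrArg Subtype.val hxy))) (fun x y => hiso _ _)
      (φ' := (φ' ∘ₗ C.subtype).codRestrict _ (fun c => hCD' c c.2))
      (fun x y hxy => Subtype.ext (hφ' (congrArg Subtype.val hxy))) (fun x y => hiso' _ _)
      (add_left_cancel h2).symm rfl
    have huu : ∀ r : R, h (r • φ u) (φ u) = 0 := fun r => by rw [← map_smul, hiso]
    have huu' : ∀ r : R, h' (r • φ' u) (φ' u) = 0 := fun r => by rw [← map_smul, hiso']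
    obtain ⟨f, hf, hf1, hf2⟩ := hH.exists_isometry_of_gram hH' hS
      ((LinearMap.toSpanSingleton R V (φ u)).coprod (LinearMap.toSpanSingleton R V w))
      ((LinearMap.toSpanSingleton R V' (φ' u)).coprod (LinearMap.toSpanSingleton R V' w'))
      (fun x y => (hH.gram_hyperbolic hS huu huw hww _ _ _ _).trans
        (hH'.gram_hyperbolic hS huu' huw' hww' _ _ _ _).symm)
      (by rw [LinearMap.range_coprod, LinearMap.range_toSpanSingleton,
        LinearMap.range_toSpanSingleton])
      (by rw [LinearMap.range_coprod, LinearMap.range_toSpanSingleton,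
        LinearMap.range_toSpanSingleton]) hD hD' ψ hψ
    refine ⟨f, hf, fun t => ?_⟩
    have ht : t ∈ (R ∙ u) ⊔ C := hC.sup_eq_top ▸ mem_top
    obtain ⟨_, hy, c, hc, rfl⟩ := mem_sup.1 ht
    obtain ⟨r, rfl⟩ := mem_span_singleton.1 hy
    have e1 : f (φ c) = φ' c :=
      (hf2 ⟨φ c, hCD c hc⟩).trans (congrArg Subtype.val (hψ' ⟨c, hc⟩))
    have e2 : f (r • φ u) = r • φ' u := by
      have := hf1 (r, 0)
      simpa using this
    rw [map_add φ, map_add φ', map_smul φ, map_smul φ', map_add f, e1, e2]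
  by_cases hT : Nontrivial T
  · exact step hφ hiso hφ' hiso' hT
  rw [not_nontrivial_iff_subsingleton] at hT
  suffices hsuff : ∃ f : V ≃ₗ[R] V', ∀ x y, h' (f x) (f y) = h x y by
    obtain ⟨f, hf⟩ := hsuff
    refine ⟨f, hf, fun t => ?_⟩
    rw [Subsingleton.elim t 0, map_zero, map_zero, map_zero]
  by_cases hV : Nontrivial V
  · obtain ⟨m, v₀, hv₀, hmv₀⟩ := exists_maximal_annihilator (R := R) (V := V)
    have hV' : multAt R V' m ≠ 0 := by
      rw [← mult_apply, ← hmult]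
      exact multAt_ne_zero_iff.2 ⟨v₀, hv₀, hmv₀⟩
    obtain ⟨v₀', hv₀', hmv₀'⟩ := multAt_ne_zero_iff.1 hV'
    -- For self-dual `m`, both sides contain anisotropic vectors, which can be scaled to match and
    -- split off orthogonally. For other `m` every simple submodule of this type is isotropic, so
    -- `step` applies to it.
    by_cases hm : hS.tauMax m = m
    · obtain ⟨v₁, hmv₁, hne₁⟩ := hH.exists_anisotropic hS hm hv₀ hmv₀
      obtain ⟨v', hmv', hne'⟩ := hH'.exists_anisotropic hS hm hv₀' hmv₀'
      obtain ⟨v, hmv, hb⟩ : ∃ v, (∀ a ∈ m.asIdeal, a • v = 0) ∧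
          ∀ r, hH.pair v v r = hH'.pair v' v' r := by
        obtain ⟨b, hb⟩ := hH.exists_smul_pair_eq hS hH' hm hmv₁ hmv' hne₁ hne'
        refine ⟨b • v₁, fun a ha => ?_, hb⟩
        rw [smul_comm, hmv₁ a ha, smul_zero]
      have hne : ∃ r, hH.pair v v r ≠ 0 := by
        obtain ⟨r, hr⟩ := hne'
        exact ⟨r, by rwa [hb]⟩
      have hD := hH.disjoint_perp_span_singleton hS hmv hne
      have hD' := hH'.disjoint_perp_span_singleton hS hmv' hne'
      have hv : v ≠ 0 := by
        intro hv
        obtain ⟨r, hr⟩ := hne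
        rw [pair_apply, hv, hH.zero_right] at hr
        exact hr rfl
      have hv' : v' ≠ 0 := by
        rintro rfl
        obtain ⟨r, hr⟩ := hne'
        rw [pair_apply, hH'.zero_right] at hr
        exact hr rfl
      have h1 := mult_add_of_isCompl (hH.isCompl_perp hS hD)
      have h2 := mult_add_of_isCompl (hH'.isCompl_perp hS hD')
      rw [mult_span_singleton hv hmv] at h1
      rw [mult_span_singleton hv' hmv', ← hmult, ← h1] at h2
      obtain ⟨ψ, hψ, -⟩ := ih _ (hn ▸ natCard_lt_of_isCompl (hH.isCompl_perp hS hD) hv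
        (mem_span_singleton_self _)) (hH.restrict hS (hH.disjoint_perp_perp hS hD))
        (hH'.restrict hS (hH'.disjoint_perp_perp hS hD'))
        (T := PUnit) (φ := 0) (Function.injective_of_subsingleton _)
        (fun x y => hH.zero_left _) (φ' := 0) (Function.injective_of_subsingleton _)
        (fun x y => hH'.zero_left _) (add_left_cancel h2).symm rfl
      obtain ⟨f, hf, -, -⟩ := hH.exists_isometry_of_gram hH' hS
        (LinearMap.toSpanSingleton R V v) (LinearMap.toSpanSingleton R V' v')
        (fun x y => by
          simp only [LinearMap.toSpanSingleton_apply]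
          rw [hH.adj_right hS, hH'.adj_right hS, smul_smul, smul_smul]
          exact hb _)
        (LinearMap.range_toSpanSingleton _) (LinearMap.range_toSpanSingleton _) hD hD' ψ hψ
      exact ⟨f, hf⟩
    · have e := (spanSingletonEquiv hv₀ hmv₀).symm.trans (spanSingletonEquiv hv₀' hmv₀')
      have hspan : ∀ x ∈ (R ∙ v₀), ∀ y ∈ (R ∙ v₀), h x y = 0 := by
        intro x hx y hy
        obtain ⟨r, rfl⟩ := mem_span_singleton.1 hx
        obtain ⟨s, rfl⟩ := mem_span_singleton.1 hy
        rw [hH.adj_right hS, smul_smul, hH.self_pair_eq_zero hS hm hmv₀]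
      have hspan' : ∀ x ∈ (R ∙ v₀'), ∀ y ∈ (R ∙ v₀'), h' x y = 0 := by
        intro x hx y hy
        obtain ⟨r, rfl⟩ := mem_span_singleton.1 hx
        obtain ⟨s, rfl⟩ := mem_span_singleton.1 hy
        rw [hH'.adj_right hS, smul_smul, hH'.self_pair_eq_zero hS hm hmv₀']
      obtain ⟨f, hf, -⟩ := step (φ := (R ∙ v₀).subtype) (injective_subtype _)
        (fun x y => hspan x x.2 y y.2) (φ' := (R ∙ v₀').subtype ∘ₗ (e : _ →ₗ[R] _))
        ((injective_subtype _).comp e.injective) (fun x y => hspan' _ (e x).2 _ (e y).2)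
        ⟨⟨⟨v₀, mem_span_singleton_self _⟩, 0, fun h0 => hv₀ (congrArg Subtype.val h0)⟩⟩
      exact ⟨f, hf⟩
  · rw [not_nontrivial_iff_subsingleton] at hV
    have hV' : Subsingleton V' := subsingleton_of_mult_eq_zero (R := R) (by
      rw [← hmult, mult_of_subsingleton])
    refine ⟨LinearEquiv.ofLinearMap 0 0 (LinearMap.ext fun v => Subsingleton.elim _ _)
      (LinearMap.ext fun v => Subsingleton.elim _ _), fun x y => ?_⟩
    rw [Subsingleton.elim x 0, hH.zero_left, map_zero, hH'.zero_left]

/-- The multiplicities of a semisimple Hermitian module are self-dual, and those of an isotropic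
submodule together with their duals are bounded by them. -/
theorem mult_add_mapDomain_le (hS : IsSesqPair (F := F) σ τ) {V T : Type v}
    [AddCommGroup V] [Module F V] [Module R V] [IsScalarTower F R V] [Finite F] [Finite V]
    [IsSemisimpleModule R V] {h : V → V → F} (hH : IsHerm (R := R) σ τ h)
    [AddCommGroup T] [Module R T] [Finite T]
    {φ : T →ₗ[R] V} (hφ : Function.Injective φ) (hiso : ∀ x y, h (φ x) (φ y) = 0) :
    mult R T + (mult R T).mapDomain hS.tauMax ≤ mult R V ∧
      (mult R V).mapDomain hS.tauMax = mult R V := by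
  obtain ⟨n, hn⟩ : ∃ n, Nat.card V = n := ⟨_, rfl⟩
  induction n using Nat.strong_induction_on generalizing V T with
  | _ n ih =>
  -- Removing a hyperbolic plane takes `m` and its dual away from `V`, and `m` away from `T`, so
  -- both claims pass from the complement to `V`.
  have step : ∀ {T : Type v} [AddCommGroup T] [Module R T] [Finite T] {φ : T →ₗ[R] V}
      (_ : Function.Injective φ) (_ : ∀ x y, h (φ x) (φ y) = 0), Nontrivial T →
      mult R T + (mult R T).mapDomain hS.tauMax ≤ mult R V ∧
      (mult R V).mapDomain hS.tauMax = mult R V := by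
    intro T _ _ _ φ hφ hiso hT
    have : IsSemisimpleModule R T := IsSemisimpleModule.of_injective φ hφ
    obtain ⟨m, u, hu, hmu⟩ := exists_maximal_annihilator (R := R) (V := T)
    obtain ⟨C, hC⟩ := exists_isCompl (R ∙ u)
    obtain ⟨l, hl, hlm⟩ := exists_functional F m
    obtain ⟨w, huw, hww, hD, hCD, hmD⟩ := hH.exists_hyperbolic_split hS hφ hiso hu hmu hC hl hlm
    have h1 := mult_add_of_isCompl (hH.isCompl_perp hS hD)
    have h2 := mult_add_of_isCompl hC
    rw [hmD] at h1
    rw [mult_span_singleton hu hmu] at h2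
    have hu' : φ u ≠ 0 := fun h0 => hu (hφ (h0.trans (map_zero φ).symm))
    obtain ⟨h3, h4⟩ := ih _ (hn ▸ natCard_lt_of_isCompl (hH.isCompl_perp hS hD) hu'
      (mem_sup_left (mem_span_singleton_self _))) (hH.restrict hS (hH.disjoint_perp_perp hS hD))
      (φ := (φ ∘ₗ C.subtype).codRestrict _ (fun c => hCD c c.2))
      (fun x y hxy => Subtype.ext (hφ (congrArg Subtype.val hxy))) (fun x y => hiso _ _) rfl
    rw [← h1, ← h2]
    simp only [Finsupp.mapDomain_add, Finsupp.mapDomain_single, hS.tauMax_tauMax, h4]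
    refine ⟨?_, by rw [add_comm (Finsupp.single _ _)]⟩
    rw [add_add_add_comm]
    exact add_le_add_right h3 _
  by_cases hT : Nontrivial T
  · exact step hφ hiso hT
  rw [not_nontrivial_iff_subsingleton] at hT
  rw [mult_of_subsingleton (V := T), Finsupp.mapDomain_zero, add_zero]
  refine ⟨zero_le, ?_⟩
  by_cases hV : Nontrivial V
  · obtain ⟨m, v₀, hv₀, hmv₀⟩ := exists_maximal_annihilator (R := R) (V := V)
    by_cases hm : hS.tauMax m = m
    · obtain ⟨v, hmv, hne⟩ := hH.exists_anisotropic hS hm hv₀ hmv₀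
      have hD := hH.disjoint_perp_span_singleton hS hmv hne
      have hv : v ≠ 0 := by
        rintro rfl
        obtain ⟨r, hr⟩ := hne
        rw [pair_apply, hH.zero_right] at hr
        exact hr rfl
      have h1 := mult_add_of_isCompl (hH.isCompl_perp hS hD)
      rw [mult_span_singleton hv hmv] at h1
      have h2 := (ih _ (hn ▸ natCard_lt_of_isCompl (hH.isCompl_perp hS hD) hv
        (mem_span_singleton_self _)) (hH.restrict hS (hH.disjoint_perp_perp hS hD))
        (T := PUnit) (φ := 0) (Function.injective_of_subsingleton _)
        (fun x y => hH.zero_left _) rfl).2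
      rw [← h1, Finsupp.mapDomain_add, Finsupp.mapDomain_single, hm, h2]
    · have hspan : ∀ x ∈ (R ∙ v₀), ∀ y ∈ (R ∙ v₀), h x y = 0 := by
        intro x hx y hy
        obtain ⟨r, rfl⟩ := mem_span_singleton.1 hx
        obtain ⟨s, rfl⟩ := mem_span_singleton.1 hy
        rw [hH.adj_right hS, smul_smul, hH.self_pair_eq_zero hS hm hmv₀]
      exact (step (φ := (R ∙ v₀).subtype) (injective_subtype _)
        (fun x y => hspan x x.2 y y.2)
        ⟨⟨⟨v₀, mem_span_singleton_self _⟩, 0, fun h0 => hv₀ (congrArg Subtype.val h0)⟩⟩).2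
  · rw [not_nontrivial_iff_subsingleton] at hV
    rw [mult_of_subsingleton (V := V), Finsupp.mapDomain_zero]

end IsHerm

end Hermitian

-- Existence of Hermitian modules with prescribed multiplicities.

universe u

/-- A finite semisimple Hermitian module together with an isotropic submodule. -/
structure HermModel {F : Type*} {R : Type u} [Field F] [CommRing R] [Algebra F R] (σ : F →+* F)
    (τ : R →+* R) where
  /-- the underlying module -/
  V : Type u
  [addCommGroup : AddCommGroup V]
  [moduleField : Module F V]
  [module : Module R V]
  [isScalarTower : IsScalarTower F R V]
  [finite : Finite V]
  [isSemisimple : IsSemisimpleModule R V]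
  /-- the Hermitian form -/
  h : V → V → F
  herm : IsHerm (R := R) σ τ h
  /-- the isotropic submodule -/
  U : Submodule R V
  isotropic : ∀ x ∈ U, ∀ y ∈ U, h x y = 0

attribute [instance] HermModel.addCommGroup HermModel.moduleField HermModel.module
  HermModel.isScalarTower HermModel.finite HermModel.isSemisimple

section Models

variable {F : Type*} {R : Type u} [Field F] [CommRing R] [Algebra F R] {σ : F →+* F} {τ : R →+* R}

theorem isSemisimpleModule_prod {V W : Type*} [AddCommGroup V] [Module R V] [AddCommGroup W]
    [Module R W] [IsSemisimpleModule R V] [IsSemisimpleModule R W] :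
    IsSemisimpleModule R (V × W) := by
  have h1 : IsSemisimpleModule R (LinearMap.range (LinearMap.inl R V W)) :=
    IsSemisimpleModule.range _
  have h2 : IsSemisimpleModule R (LinearMap.range (LinearMap.inr R V W)) :=
    IsSemisimpleModule.range _
  have h3 := IsSemisimpleModule.sup h1 h2
  rw [LinearMap.sup_range_inl_inr] at h3
  exact IsSemisimpleModule.congr (topEquiv (R := R) (M := V × W)).symm

theorem isSemisimpleModule_quotient (m : MaximalSpectrum R) :
    IsSemisimpleModule R (R ⧸ m.asIdeal) := by
  have : IsSimpleModule R (R ⧸ m.asIdeal) := isSimpleModule_iff_isCoatom.2 m.isMaximal.out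
  infer_instance

theorem IsHerm.prod {V W : Type*} [AddCommGroup V] [Module F V] [Module R V] [AddCommGroup W]
    [Module F W] [Module R W] {h : V → V → F} {k : W → W → F} (hh : IsHerm (R := R) σ τ h)
    (hk : IsHerm (R := R) σ τ k) :
    IsHerm (R := R) (V := V × W) σ τ (fun x y => h x.1 y.1 + k x.2 y.2) where
  add_left x y z := by
    rw [Prod.fst_add, Prod.snd_add, hh.add_left, hk.add_left]
    ring
  smul_left a x y := by
    rw [Prod.smul_fst, Prod.smul_snd, hh.smul_left, hk.smul_left]
    ring
  symm x y := by rw [map_add, ← hh.symm, ← hk.symm]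
  adj r x y := by
    rw [Prod.smul_fst, Prod.smul_snd, hh.adj, hk.adj, Prod.smul_fst, Prod.smul_snd]
  nondeg x hx := by
    refine Prod.ext (hh.nondeg _ fun v => ?_) (hk.nondeg _ fun w => ?_)
    · have := hx (v, 0)
      rwa [hk.zero_right, add_zero] at this
    · have := hx (0, w)
      rwa [hh.zero_right, zero_add] at this

theorem mult_prod_submodule {V W : Type*} [AddCommGroup V] [Module R V] [AddCommGroup W]
    [Module R W] [Finite V] [Finite W] (p : Submodule R V) (q : Submodule R W) :
    mult R (p.prod q) = mult R p + mult R q := by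
  let e : p.prod q ≃ₗ[R] p × q :=
    { toFun := fun x => (⟨x.1.1, x.2.1⟩, ⟨x.1.2, x.2.2⟩)
      invFun := fun x => ⟨(x.1.1, x.2.1), x.1.2, x.2.2⟩
      map_add' := fun _ _ => rfl
      map_smul' := fun _ _ => rfl
      left_inv := fun _ => rfl
      right_inv := fun _ => rfl }
  rw [mult_congr e, mult_prod]

/-- The orthogonal sum of two models. -/
def HermModel.prod (X Y : HermModel (F := F) σ τ) : HermModel (F := F) σ τ :=
  have := isSemisimpleModule_prod (R := R) (V := X.V) (W := Y.V)
  { V := X.V × Y.V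
    h := fun x y => X.h x.1 y.1 + Y.h x.2 y.2
    herm := X.herm.prod Y.herm
    U := X.U.prod Y.U
    isotropic := fun x hx y hy => by
      rw [X.isotropic _ hx.1 _ hy.1, Y.isotropic _ hx.2 _ hy.2, add_zero] }

theorem HermModel.mult_prod_V (X Y : HermModel (F := F) σ τ) :
    mult R (X.prod Y).V = mult R X.V + mult R Y.V := mult_prod

theorem HermModel.mult_prod_U (X Y : HermModel (F := F) σ τ) :
    mult R (X.prod Y).U = mult R X.U + mult R Y.U := by
  exact mult_prod_submodule X.U Y.U

theorem eq_zero_of_forall_functional {m : MaximalSpectrum R} {l : R ⧸ m.asIdeal →ₗ[F] F}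
    (hl : l ≠ 0) (x : R ⧸ m.asIdeal) (hx : ∀ y, l (x * y) = 0) : x = 0 := by
  by_contra hne
  obtain ⟨y, hxy⟩ := (Ideal.Quotient.maximal_ideal_iff_isField_quotient m.asIdeal).1
    m.isMaximal |>.mul_inv_cancel hne
  apply hl
  apply LinearMap.ext
  intro z
  have h := hx (y * z)
  rw [← mul_assoc, hxy, one_mul] at h
  rw [h, LinearMap.zero_apply]

variable (F) in
theorem exists_dual_ne_zero (m : MaximalSpectrum R) :
    ∃ l : R ⧸ m.asIdeal →ₗ[F] F, l ≠ 0 := by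
  have : Nontrivial (R ⧸ m.asIdeal) := Ideal.Quotient.nontrivial_iff.2 m.isMaximal.ne_top
  exact exists_ne (0 : Dual F (R ⧸ m.asIdeal))

/-- The ring homomorphism induced by `τ` on residue rings has the expected properties. -/
theorem IsSesqPair.exists_ringHom_quotient (hS : IsSesqPair (F := F) σ τ) (m m' : Ideal R)
    (hm : m' = m.comap τ) : ∃ α : R ⧸ m' →+* R ⧸ m, Function.Bijective α ∧
      (∀ (a : F) x, α (a • x) = σ a • α x) ∧ (∀ (r : R) x, α (r • x) = τ r • α x) ∧
      ∀ r : R, α (Ideal.Quotient.mk m' r) = Ideal.Quotient.mk m (τ r) := by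
  have h1 : ∀ (r : R) x, Ideal.quotientMap m τ hm.le (r • x) =
      τ r • Ideal.quotientMap m τ hm.le x := by
    intro r x
    obtain ⟨x, rfl⟩ := Ideal.Quotient.mk_surjective x
    rw [Algebra.smul_def, Algebra.smul_def, map_mul]
    rfl
  refine ⟨Ideal.quotientMap m τ hm.le, ⟨Ideal.quotientMap_injective' hm.ge,
    Ideal.quotientMap_surjective fun r => ⟨τ r, hS.tau_tau r⟩⟩, fun a x => ?_, h1, fun r => rfl⟩
  rw [← algebraMap_smul R a, ← algebraMap_smul R (σ a), h1, hS.tau_algebraMap]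

section Forms

variable {K K' : Type*} [CommRing K] [CommRing K'] [Algebra F K] [Algebra R K] [Algebra F K']
  [Algebra R K'] {l : K →ₗ[F] F}

/-- The hyperbolic plane on a self-dual pair of modules. -/
theorem IsSesqPair.isHerm_hyperbolic (hS : IsSesqPair (F := F) σ τ) (α : K' →+* K)
    (hα : Function.Bijective α) (hαF : ∀ (a : F) x, α (a • x) = σ a • α x)
    (hαR : ∀ (r : R) x, α (r • x) = τ r • α x) (hl : ∀ x, (∀ y, l (x * y) = 0) → x = 0) :
    IsHerm (R := R) (V := K × K') σ τ (fun x y => l (x.1 * α y.2) + σ (l (y.1 * α x.2))) where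
  add_left x y z := by
    simp only [Prod.fst_add, Prod.snd_add, map_add, add_mul, mul_add]
    ring
  smul_left a x y := by
    rw [Prod.smul_fst, Prod.smul_snd, hαF, smul_mul_assoc, mul_smul_comm,
      map_smul, map_smul, smul_eq_mul, smul_eq_mul, map_mul σ, hS.sigma_sigma]
    ring
  symm x y := by
    rw [map_add, hS.sigma_sigma, add_comm]
  adj r x y := by
    rw [Prod.smul_fst, Prod.smul_snd, Prod.smul_fst, Prod.smul_snd, hαR,
      hαR, hS.tau_tau, smul_mul_assoc, mul_smul_comm, smul_mul_assoc, mul_smul_comm]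
  nondeg x hx := by
    have h1 : x.1 = 0 := by
      refine hl _ fun z => ?_
      obtain ⟨y, rfl⟩ := hα.2 z
      have := hx (0, y)
      rwa [zero_mul, map_zero, map_zero, add_zero] at this
    have h2 : α x.2 = 0 := by
      refine hl _ fun z => ?_
      have := hx (z, 0)
      rw [map_zero, mul_zero, map_zero, zero_add, map_eq_zero] at this
      rw [mul_comm, this]
    exact Prod.ext h1 (hα.1 (h2.trans (map_zero α).symm))

/-- An involution on a module with enough functionals carries a Hermitian form. -/
theorem IsSesqPair.exists_isHerm (hS : IsSesqPair (F := F) σ τ) (α : K →+* K)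
    (hαα : ∀ x, α (α x) = x) (hαF : ∀ (a : F) x, α (a • x) = σ a • α x)
    (hαR : ∀ (r : R) x, α (r • x) = τ r • α x) {l₀ : K →ₗ[F] F} (hl₀ : l₀ ≠ 0)
    (hl : ∀ l : K →ₗ[F] F, l ≠ 0 → ∀ x, (∀ y, l (x * y) = 0) → x = 0) :
    ∃ h : K → K → F, IsHerm (R := R) σ τ h := by
  -- Symmetrize `l₀` under the involution. If the result is zero, replace `l₀` by `a • l₀` with `σ a
  -- ≠ a`: both symmetrizations cannot vanish.
  have key : ∃ l : K →ₗ[F] F, l ≠ 0 ∧ ∀ x, l (α x) = σ (l x) := by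
    let T : (K →ₗ[F] F) → (K →ₗ[F] F) := fun l =>
      { toFun := fun x => l x + σ (l (α x))
        map_add' := fun x y => by
          simp only [map_add]
          ring
        map_smul' := fun a x => by
          rw [hαF, map_smul, map_smul, smul_eq_mul, smul_eq_mul, map_mul, hS.sigma_sigma,
            RingHom.id_apply, smul_eq_mul]
          ring }
    have hT : ∀ l x, T l (α x) = σ (T l x) := by
      intro l x
      change l (α x) + σ (l (α (α x))) = σ (l x + σ (l (α x)))
      rw [hαα, map_add, hS.sigma_sigma, add_comm]
    by_cases h0 : T l₀ = 0
    · obtain ⟨a, ha⟩ := hS.sigma_ne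
      refine ⟨T (a • l₀), fun h1 => hl₀ ?_, hT _⟩
      apply LinearMap.ext
      intro x
      have e1 : l₀ x + σ (l₀ (α x)) = 0 := LinearMap.congr_fun h0 x
      have e2 : a * l₀ x + σ (a * l₀ (α x)) = 0 := LinearMap.congr_fun h1 x
      rw [map_mul] at e2
      have e3 : (a - σ a) * l₀ x = 0 := by linear_combination e2 - σ a * e1
      rcases mul_eq_zero.1 e3 with h2 | h2
      · exact absurd (sub_eq_zero.1 h2).symm ha
      · rw [h2, LinearMap.zero_apply]
    · exact ⟨T l₀, h0, hT _⟩
  obtain ⟨l, hl', hlα⟩ := key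
  refine ⟨fun x y => l (x * α y), ?_, ?_, ?_, ?_, ?_⟩
  · intro x y z
    rw [add_mul, map_add]
  · intro a x y
    rw [smul_mul_assoc, map_smul, smul_eq_mul]
  · intro x y
    rw [← hlα, map_mul α, hαα, mul_comm]
  · intro r x y
    rw [hαR, hS.tau_tau, smul_mul_assoc, mul_smul_comm]
  · intro x hx
    refine hl l hl' x fun z => ?_
    rw [← hαα z]
    exact hx _

end Forms

/-- The nondegenerate form on a self-dual simple module `R ⧸ m`. -/
theorem IsSesqPair.exists_isHerm_quotient (hS : IsSesqPair (F := F) σ τ) {m : MaximalSpectrum R}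
    (hm : hS.tauMax m = m) : ∃ h : R ⧸ m.asIdeal → R ⧸ m.asIdeal → F, IsHerm (R := R) σ τ h := by
  have hle : m.asIdeal = m.asIdeal.comap τ := congrArg MaximalSpectrum.asIdeal hm.symm
  obtain ⟨α, -, hαF, hαR, hmk⟩ := hS.exists_ringHom_quotient _ _ hle
  obtain ⟨l₀, hl₀⟩ := exists_dual_ne_zero F m
  refine hS.exists_isHerm α (fun x => ?_) hαF hαR hl₀ fun l hl => eq_zero_of_forall_functional hl
  obtain ⟨r, rfl⟩ := Ideal.Quotient.mk_surjective x
  rw [hmk, hmk, hS.tau_tau]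

theorem isHerm_zero : IsHerm (F := F) (R := R) (V := PUnit) σ τ (fun _ _ => 0) where
  add_left _ _ _ := (add_zero 0).symm
  smul_left _ _ _ := (mul_zero _).symm
  symm _ _ := (map_zero σ).symm
  adj _ _ _ := rfl
  nondeg _ _ := rfl

/-- The zero Hermitian module. -/
def HermModel.zero : HermModel (F := F) (R := R) σ τ :=
  have : IsSemisimpleModule R PUnit.{u + 1} :=
    (isSemisimpleModule_iff R _).2 ⟨fun x => ⟨⊤, disjoint_iff.2 (Subsingleton.elim _ _),
      codisjoint_iff.2 (Subsingleton.elim _ _)⟩⟩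
  { V := PUnit
    h := fun _ _ => 0
    herm := isHerm_zero
    U := ⊥
    isotropic := fun _ _ _ _ => rfl }

/-- Existence of semisimple Hermitian modules with isotropic submodules of given multiplicities. -/
theorem IsSesqPair.exists_hermModel (hS : IsSesqPair (F := F) σ τ)
    (hfin : ∀ m : MaximalSpectrum R, Finite (R ⧸ m.asIdeal)) {M N : MaximalSpectrum R →₀ ℕ}
    (hM : M.mapDomain hS.tauMax = M) (hN : N + N.mapDomain hS.tauMax ≤ M) :
    ∃ X : HermModel (F := F) σ τ, mult R X.V = M ∧ mult R X.U = N := by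
  classical
  obtain ⟨n, hn⟩ : ∃ n, M.degree = n := ⟨_, rfl⟩
  have hinj : Function.Injective hS.tauMax :=
    (show Function.Involutive hS.tauMax from hS.tauMax_tauMax).injective
  induction n using Nat.strong_induction_on generalizing M N with
  | _ n ih =>
  have hyp : ∀ m : MaximalSpectrum R, ∀ M' : MaximalSpectrum R →₀ ℕ,
      Finsupp.single m 1 + Finsupp.single (hS.tauMax m) 1 + M' = M →
      M'.mapDomain hS.tauMax = M' ∧ M'.degree < n := by
    rintro m M' rfl
    constructor
    · simp only [Finsupp.mapDomain_add, Finsupp.mapDomain_single, hS.tauMax_tauMax] at hM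
      rw [add_comm (Finsupp.single (hS.tauMax m) 1)] at hM
      exact add_left_cancel hM
    · rw [← hn]
      simp only [map_add, Finsupp.degree_single]
      omega
  -- A hyperbolic plane whose isotropic submodule lies in the first factor. Taking `W = ⊤` uses up
  -- one simple factor of `N`; taking `W = ⊥` only fills up `M`.
  have block : ∀ m : MaximalSpectrum R, ∀ W : Submodule R (R ⧸ m.asIdeal),
      ∃ X : HermModel (F := F) σ τ,
        mult R X.V = Finsupp.single m 1 + Finsupp.single (hS.tauMax m) 1 ∧
        mult R X.U = mult R W := by
    intro m W
    obtain ⟨l, hl⟩ := exists_dual_ne_zero F m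
    have := isSemisimpleModule_quotient m
    have := isSemisimpleModule_quotient (hS.tauMax m)
    have := isSemisimpleModule_prod (R := R) (V := R ⧸ m.asIdeal)
      (W := R ⧸ (hS.tauMax m).asIdeal)
    obtain ⟨α, hα, hαF, hαR, -⟩ :=
      hS.exists_ringHom_quotient m.asIdeal (hS.tauMax m).asIdeal rfl
    have hH := hS.isHerm_hyperbolic α hα hαF hαR (eq_zero_of_forall_functional hl)
    refine ⟨{ V := (R ⧸ m.asIdeal) × (R ⧸ (hS.tauMax m).asIdeal), h := _,
              herm := hH, U := W.prod ⊥, isotropic := ?_ }, ?_, ?_⟩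
    · rintro x ⟨-, hx⟩ y ⟨-, hy⟩
      have hx' : x.2 = 0 := (mem_bot R).1 hx
      have hy' : y.2 = 0 := (mem_bot R).1 hy
      rw [hx', hy', map_zero, mul_zero, mul_zero, map_zero, map_zero, add_zero]
    · change mult R ((R ⧸ m.asIdeal) × (R ⧸ (hS.tauMax m).asIdeal)) = _
      rw [mult_prod, mult_quotient, mult_quotient]
    · change mult R (W.prod (⊥ : Submodule R (R ⧸ (hS.tauMax m).asIdeal))) = _
      rw [mult_prod_submodule, mult_bot, add_zero]
  -- Induction on the total multiplicity of `M`. As long as `N` is nonzero, a plane is split off for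
  -- one of its simple factors; afterwards `M` is filled with self-dual simple modules and with
  -- planes for dual pairs.
  by_cases hN0 : N = 0
  · subst hN0
    by_cases hM0 : M = 0
    · subst hM0
      exact ⟨HermModel.zero, mult_of_subsingleton (V := PUnit), mult_bot (V := PUnit)⟩
    · obtain ⟨m, hm⟩ : ∃ m, M m ≠ 0 := by
        by_contra! h'
        exact hM0 (Finsupp.ext h')
      by_cases hmm : hS.tauMax m = m
      · obtain ⟨M', rfl⟩ := le_iff_exists_add.1 (show Finsupp.single m 1 ≤ M by
          rw [Finsupp.single_le_iff]
          omega)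
        have hM' : M'.mapDomain hS.tauMax = M' := by
          rw [Finsupp.mapDomain_add, Finsupp.mapDomain_single, hmm] at hM
          exact add_left_cancel hM
        obtain ⟨Y, hY1, hY2⟩ := ih M'.degree (by
          rw [← hn]
          simp) hM' (N := 0) (by simp) rfl
        obtain ⟨h, hh⟩ := hS.exists_isHerm_quotient hmm
        have := isSemisimpleModule_quotient m
        let X : HermModel (F := F) σ τ :=
          { V := R ⧸ m.asIdeal, h := h, herm := hh, U := ⊥, isotropic := fun x hx y _ => by
              rw [(mem_bot R).1 hx, hh.zero_left] }
        refine ⟨X.prod Y, ?_, ?_⟩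
        · rw [HermModel.mult_prod_V, hY1]
          exact congrArg (· + M') (mult_quotient m)
        · rw [HermModel.mult_prod_U, hY2, add_zero]
          exact mult_bot
      · obtain ⟨M', hM'⟩ := le_iff_exists_add.1
          (show Finsupp.single m 1 + Finsupp.single (hS.tauMax m) 1 ≤ M by
            have h1 : M (hS.tauMax m) = M m := by
              rw [← Finsupp.mapDomain_apply hinj M m, hM]
            rw [Finsupp.le_def]
            intro i
            rw [Finsupp.add_apply, Finsupp.single_apply, Finsupp.single_apply]
            split_ifs with h2 h3 h3
            · exact absurd (h3.trans h2.symm) hmm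
            · rw [← h2]
              omega
            · rw [← h3]
              omega
            · omega)
        obtain ⟨h1, h2⟩ := hyp m M' hM'.symm
        obtain ⟨Y, hY1, hY2⟩ := ih M'.degree h2 h1 (N := 0) (by simp) rfl
        obtain ⟨X, hX1, hX2⟩ := block m ⊥
        exact ⟨X.prod Y, by rw [HermModel.mult_prod_V, hX1, hY1, hM'],
          by rw [HermModel.mult_prod_U, hX2, hY2, mult_bot, add_zero]⟩
  · obtain ⟨m, hm⟩ : ∃ m, N m ≠ 0 := by
      by_contra! h'
      exact hN0 (Finsupp.ext h')
    obtain ⟨N', rfl⟩ := le_iff_exists_add.1 (show Finsupp.single m 1 ≤ N by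
      rw [Finsupp.single_le_iff]
      omega)
    rw [Finsupp.mapDomain_add, Finsupp.mapDomain_single, add_add_add_comm] at hN
    obtain ⟨M', hM'⟩ := le_iff_exists_add.1 (le_self_add.trans hN)
    obtain ⟨h1, h2⟩ := hyp m M' hM'.symm
    rw [hM'] at hN
    obtain ⟨Y, hY1, hY2⟩ := ih M'.degree h2 h1 (le_of_add_le_add_left hN) rfl
    obtain ⟨X, hX1, hX2⟩ := block m ⊤
    exact ⟨X.prod Y, by rw [HermModel.mult_prod_V, hX1, hY1, hM'],
      by rw [HermModel.mult_prod_U, hX2, hY2, mult_top, mult_quotient]⟩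

end Models

/-! ### Homomorphisms to linear groups as modules over the group algebra. -/

section RepModule

variable {F V A : Type*} [Field F] [AddCommGroup V] [Module F V] [CommGroup A]

/-- The representation given by a homomorphism to the group of linear automorphisms. -/
noncomputable def autRep (X : A →* (V ≃ₗ[F] V)) : Representation F A V :=
  LinearEquiv.automorphismGroup.toLinearMapMonoidHom.comp X

/-- The module over the group algebra given by a homomorphism to the group of automorphisms. -/
abbrev RepModule (X : A →* (V ≃ₗ[F] V)) := (autRep X).asModule

/-- The identity map from the representation module to the underlying space. -/
noncomputable def repEquiv (X : A →* (V ≃ₗ[F] V)) : RepModule X ≃ₗ[F] V := (autRep X).asModuleEquiv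

theorem repEquiv_smul (X : A →* (V ≃ₗ[F] V)) (a : A) (v : RepModule X) :
    repEquiv X (MonoidAlgebra.of F A a • v) = X a (repEquiv X v) := by
  rw [repEquiv, Representation.asModuleEquiv_map_smul, Representation.asAlgebraHom_of]
  rfl

instance finite_repModule [Finite V] (X : A →* (V ≃ₗ[F] V)) : Finite (RepModule X) :=
  Finite.of_equiv V (repEquiv X).toEquiv.symm

theorem closed_smul_of_closed {W : Type*} [AddCommGroup W] [Module F W]
    [Module (MonoidAlgebra F A) W] [IsScalarTower F (MonoidAlgebra F A) W] (U : Submodule F W)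
    (hU : ∀ a, ∀ v ∈ U, MonoidAlgebra.of F A a • v ∈ U) (r : MonoidAlgebra F A) {v : W}
    (hv : v ∈ U) : r • v ∈ U := by
  induction r using MonoidAlgebra.induction_on with
  | of a => exact hU a v hv
  | add x y hx hy =>
    rw [add_smul]
    exact U.add_mem hx hy
  | smul a x hx =>
    rw [smul_assoc]
    exact U.smul_mem a hx

/-- Additive maps commuting with scalars and group elements are linear over the group algebra. -/
noncomputable def linearEquivOfCommute {W W' : Type*} [AddCommGroup W] [Module F W]
    [Module (MonoidAlgebra F A) W] [IsScalarTower F (MonoidAlgebra F A) W] [AddCommGroup W']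
    [Module F W'] [Module (MonoidAlgebra F A) W'] [IsScalarTower F (MonoidAlgebra F A) W']
    (f : W ≃ₗ[F] W')
    (hf : ∀ a v, f (MonoidAlgebra.of F A a • v) = MonoidAlgebra.of F A a • f v) :
    W ≃ₗ[MonoidAlgebra F A] W' :=
  { f with
    map_smul' := fun r v => by
      simp only [RingHom.id_apply]
      change f (r • v) = r • f v
      induction r using MonoidAlgebra.induction_on with
      | of a => exact hf a v
      | add x y hx hy => rw [add_smul, map_add, hx, hy, add_smul]
      | smul a x hx => rw [smul_assoc, map_smul, hx, smul_assoc] }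

theorem linearEquivOfCommute_apply {W W' : Type*} [AddCommGroup W] [Module F W]
    [Module (MonoidAlgebra F A) W] [IsScalarTower F (MonoidAlgebra F A) W] [AddCommGroup W']
    [Module F W'] [Module (MonoidAlgebra F A) W'] [IsScalarTower F (MonoidAlgebra F A) W']
    (f : W ≃ₗ[F] W')
    (hf : ∀ a v, f (MonoidAlgebra.of F A a • v) = MonoidAlgebra.of F A a • f v) (v : W) :
    linearEquivOfCommute f hf v = f v := rfl

/-- The submodule over the group algebra generated by a subspace. -/
noncomputable def genSub (X : A →* (V ≃ₗ[F] V)) (U : Submodule F V) :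
    Submodule (MonoidAlgebra F A) (RepModule X) := span _ (repEquiv X ⁻¹' U)

/-- The subspace underlying a submodule over the group algebra. -/
noncomputable def subspace (X : A →* (V ≃ₗ[F] V))
    (W : Submodule (MonoidAlgebra F A) (RepModule X)) : Submodule F V :=
  (W.restrictScalars F).map (repEquiv X : RepModule X →ₗ[F] V)

theorem mem_subspace {X : A →* (V ≃ₗ[F] V)} {W : Submodule (MonoidAlgebra F A) (RepModule X)}
    {v : RepModule X} : repEquiv X v ∈ subspace X W ↔ v ∈ W := by
  constructor
  · rintro ⟨w, hw, hwv⟩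
    exact (repEquiv X).injective hwv ▸ hw
  · exact fun h => ⟨v, h, rfl⟩

/-- A subspace stable under the group is stable under its linear span, the group algebra, so
generating a submodule adds nothing. -/
theorem mem_genSub {X : A →* (V ≃ₗ[F] V)} {U : Submodule F V}
    (hU : ∀ a, U.map (X a : V →ₗ[F] V) = U) {v : RepModule X} :
    v ∈ genSub X U ↔ repEquiv X v ∈ U := by
  constructor
  · intro h
    refine span_induction (fun x hx => hx) ?_ (fun x y _ _ hx hy => ?_) (fun r x _ hx => ?_) h
    · rw [map_zero]
      exact U.zero_mem
    · rw [map_add]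
      exact U.add_mem hx hy
    · refine closed_smul_of_closed (U.comap (repEquiv X : RepModule X →ₗ[F] V))
        (fun a w hw => ?_) r hx
      rw [mem_comap] at hw ⊢
      change repEquiv X _ ∈ U
      rw [repEquiv_smul]
      have : X a (repEquiv X w) ∈ U.map (X a : V →ₗ[F] V) := ⟨_, hw, rfl⟩
      rwa [hU] at this
  · exact fun h => subset_span h

theorem genSub_subspace (X : A →* (V ≃ₗ[F] V))
    (W : Submodule (MonoidAlgebra F A) (RepModule X)) : genSub X (subspace X W) = W := by
  refine le_antisymm (span_le.2 fun v hv => mem_subspace.1 hv) fun v hv => subset_span ?_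
  exact mem_subspace.2 hv

theorem map_subspace (X : A →* (V ≃ₗ[F] V))
    (W : Submodule (MonoidAlgebra F A) (RepModule X)) (a : A) :
    (subspace X W).map (X a : V →ₗ[F] V) = subspace X W := by
  have key : ∀ a, (subspace X W).map (X a : V →ₗ[F] V) ≤ subspace X W := by
    rintro a _ ⟨_, ⟨w, hw, rfl⟩, rfl⟩
    refine ⟨MonoidAlgebra.of F A a • w, W.smul_mem _ hw, ?_⟩
    exact repEquiv_smul X a w
  refine le_antisymm (key a) fun v hv => ⟨X a⁻¹ v, key a⁻¹ ⟨v, hv, rfl⟩, ?_⟩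
  change (X a * X a⁻¹) v = v
  rw [← map_mul, mul_inv_cancel, map_one]
  rfl

theorem subspace_genSub {X : A →* (V ≃ₗ[F] V)} {U : Submodule F V}
    (hU : ∀ a, U.map (X a : V →ₗ[F] V) = U) : subspace X (genSub X U) = U := by
  ext v
  obtain ⟨v, rfl⟩ := (repEquiv X).surjective v
  rw [mem_subspace, mem_genSub hU]

theorem genSub_le_genSub {X : A →* (V ≃ₗ[F] V)} {U U' : Submodule F V} (h : U ≤ U') :
    genSub X U ≤ genSub X U' := span_mono fun _ hx => h hx

theorem genSub_le_iff {X : A →* (V ≃ₗ[F] V)} {U U' : Submodule F V}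
    (hU' : ∀ a, U'.map (X a : V →ₗ[F] V) = U') : genSub X U ≤ genSub X U' ↔ U ≤ U' := by
  refine ⟨fun h v hv => ?_, genSub_le_genSub⟩
  obtain ⟨v, rfl⟩ := (repEquiv X).surjective v
  exact (mem_genSub hU').1 (h (subset_span hv))

theorem subspace_le_iff {X : A →* (V ≃ₗ[F] V)}
    {W W' : Submodule (MonoidAlgebra F A) (RepModule X)} :
    subspace X W ≤ subspace X W' ↔ W ≤ W' := by
  constructor
  · intro h v hv
    exact mem_subspace.1 (h (mem_subspace.2 hv))
  · rintro h _ ⟨w, hw, rfl⟩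
    exact ⟨w, h hw, rfl⟩

theorem subspace_bot (X : A →* (V ≃ₗ[F] V)) : subspace X ⊥ = ⊥ := by
  ext v
  obtain ⟨v, rfl⟩ := (repEquiv X).surjective v
  rw [mem_subspace, mem_bot, mem_bot, LinearEquiv.map_eq_zero_iff]

theorem subspace_top (X : A →* (V ≃ₗ[F] V)) : subspace X ⊤ = ⊤ := by
  ext v
  obtain ⟨v, rfl⟩ := (repEquiv X).surjective v
  rw [mem_subspace]
  simp

theorem subspace_inf (X : A →* (V ≃ₗ[F] V)) (W W' : Submodule (MonoidAlgebra F A) (RepModule X)) :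
    subspace X (W ⊓ W') = subspace X W ⊓ subspace X W' := by
  ext v
  obtain ⟨v, rfl⟩ := (repEquiv X).surjective v
  rw [mem_inf, mem_subspace, mem_subspace, mem_subspace, mem_inf]

/-- An automorphism of the space conjugating two homomorphisms is an isomorphism of modules. -/
noncomputable def repIso {X X' : A →* (V ≃ₗ[F] V)} (g : V ≃ₗ[F] V)
    (hg : ∀ a, g * X a = X' a * g) : RepModule X ≃ₗ[MonoidAlgebra F A] RepModule X' :=
  linearEquivOfCommute ((repEquiv X).trans (g.trans (repEquiv X').symm)) fun a v => by
    apply (repEquiv X').injective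
    rw [repEquiv_smul]
    simp only [LinearEquiv.trans_apply, LinearEquiv.apply_symm_apply]
    rw [repEquiv_smul]
    exact LinearEquiv.congr_fun (hg a) _

theorem map_repIso_genSub {X X' : A →* (V ≃ₗ[F] V)} (g : V ≃ₗ[F] V)
    (hg : ∀ a, g * X a = X' a * g) (U : Submodule F V) :
    (genSub X U).map (repIso g hg : RepModule X →ₗ[MonoidAlgebra F A] RepModule X') =
      genSub X' (U.map (g : V →ₗ[F] V)) := by
  rw [genSub, map_span, genSub]
  congr 1

theorem mult_genSub_map [Finite V] {X X' : A →* (V ≃ₗ[F] V)} (g : V ≃ₗ[F] V)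
    (hg : ∀ a, g * X a = X' a * g) (U : Submodule F V) :
    mult (MonoidAlgebra F A) (genSub X' (U.map (g : V →ₗ[F] V))) =
      mult (MonoidAlgebra F A) (genSub X U) := by
  rw [← mult_eq_of_eq (map_repIso_genSub g hg U)]
  exact (mult_congr ((repIso g hg).submoduleMap (genSub X U))).symm

end RepModule

/-! ### The socle of a finite module. -/

section Socle

variable {R M : Type*} [CommRing R] [AddCommGroup M] [Module R M]

variable (R M) in
/-- The socle: the sum of all simple submodules. -/
def socle : Submodule R M := sSup {a | IsAtom a}

theorem map_socle (f : M ≃ₗ[R] M) : (socle R M).map (f : M →ₗ[R] M) = socle R M := by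
  have key : ∀ f : M ≃ₗ[R] M, (socle R M).map (f : M →ₗ[R] M) ≤ socle R M := by
    intro f
    rw [map_le_iff_le_comap]
    refine sSup_le fun a ha => ?_
    rw [← map_le_iff_le_comap]
    refine le_sSup ?_
    exact (OrderIso.isAtom_iff (Submodule.orderIsoMapComap f) a).2 ha
  refine le_antisymm (key f) fun v hv => ⟨f.symm v, key f.symm ⟨v, hv, rfl⟩, ?_⟩
  simp

/-- By finiteness `W` contains a simple submodule, and this lies in the socle. -/
theorem inf_socle_ne_bot [Finite M] {W : Submodule R M} (hW : W ≠ ⊥) : W ⊓ socle R M ≠ ⊥ := by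
  have : Finite (Submodule R M) := inferInstance
  obtain ⟨a, ha, haW⟩ := (eq_bot_or_exists_atom_le W).resolve_left hW
  have h : a ≤ W ⊓ socle R M := le_inf haW (le_sSup ha)
  exact fun h' => ha.1 (le_bot_iff.1 (h' ▸ h))

theorem isSemisimpleModule_of_socle_eq_top (h : socle R M = ⊤) : IsSemisimpleModule R M :=
  IsSemisimpleModule.of_sSup_simples_eq_top (by
    simp_rw [isSimpleModule_iff_isAtom]
    exact h)

end Socle

/-! ### Equivariant Euler characteristics in terms of multiplicities. -/

section Invariants

/-- The group algebra of the free abelian group of rank `r`. -/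
abbrev GroupAlg (F : Type*) [Field F] (r : ℕ) := MonoidAlgebra F (Multiplicative (Fin r → ℤ))

variable {F V G P : Type*} [Field F] [AddCommGroup V] [Module F V] [Finite V] [Group G] [Finite G]
  [PartialOrder P] [Finite P] [MulAction G P] {r : ℕ}

open scoped Classical in
/-- The multiplicities of the module and of the members of a chain of subspaces. -/
noncomputable def chainInv (ι : G →* (V ≃ₗ[F] V)) (val : P → Submodule F V)
    (X : Multiplicative (Fin r → ℤ) →* G) (c : Finset P) :
    (MaximalSpectrum (GroupAlg F r) →₀ ℕ) ×
      Finset (MaximalSpectrum (GroupAlg F r) →₀ ℕ) :=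
  (mult (GroupAlg F r) (RepModule (ι.comp X)),
    c.image fun x =>
      mult (GroupAlg F r) (genSub (ι.comp X) (val x)))

/-- The homomorphisms that give semisimple modules. -/
def IsSemisimpleHom (ι : G →* (V ≃ₗ[F] V)) (X : Multiplicative (Fin r → ℤ) →* G) : Prop :=
  IsSemisimpleModule (GroupAlg F r) (RepModule (ι.comp X))

open scoped Classical in
/-- The equivariant Euler characteristic of a poset of subspaces as a sum over multiplicities. -/
theorem equivariantEulerChar_eq_sum_mult (ι : G →* (V ≃ₗ[F] V)) (hι : Function.Injective ι)
    (val : P → Submodule F V) (hval : ∀ x y, val x ≤ val y ↔ x ≤ y)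
    (hsmul : ∀ (g : G) x, val (g • x) = (val x).map (ι g : V →ₗ[F] V))
    (hzero : ∀ X : Multiplicative (Fin r → ℤ) →* G, ¬ IsSemisimpleHom ι X →
      ∀ g : G, (∀ z, Commute (X z) g) →
      reducedEulerChar {x : P // (∀ z, X z • x = x) ∧ g • x = x} = 0)
    (Z : Finset ((MaximalSpectrum (GroupAlg F r) →₀ ℕ) ×
      Finset (MaximalSpectrum (GroupAlg F r) →₀ ℕ)))
    (hmem : ∀ X c, IsFixedChain (IsSemisimpleHom ι) X c → chainInv ι val X c ∈ Z)
    (hsurj : ∀ z ∈ Z, ∃ X c, IsFixedChain (IsSemisimpleHom ι) X c ∧ chainInv ι val X c = z)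
    (hconj : ∀ X c X' c', IsFixedChain (IsSemisimpleHom ι) X c →
      IsFixedChain (IsSemisimpleHom ι) X' c' → chainInv ι val X c = chainInv ι val X' c' →
      ∃ (g : G) (f : RepModule (ι.comp X) ≃ₗ[GroupAlg F r]
        RepModule (ι.comp X')), (∀ v, repEquiv _ (f v) = ι g (repEquiv _ v)) ∧
        ∀ x ∈ c, ∀ x' ∈ c',
          mult (GroupAlg F r) (genSub (ι.comp X) (val x)) =
          mult (GroupAlg F r) (genSub (ι.comp X') (val x')) →
          (genSub (ι.comp X) (val x)).map (f : RepModule (ι.comp X) →ₗ[GroupAlg F r] RepModule (ι.comp X')) = genSub (ι.comp X') (val x')) :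
    equivariantEulerChar (r + 1) P G = ((∑ z ∈ Z, (-1) ^ (z.2.card + 1) : ℤ) : ℚ) := by
  have hval' : Function.Injective val := fun x y h =>
    le_antisymm ((hval _ _).1 h.le) ((hval _ _).1 h.ge)
  have hfix : ∀ (X : Multiplicative (Fin r → ℤ) →* G) x, (∀ z, X z • x = x) →
      ∀ z, (val x).map (ι.comp X z : V →ₗ[F] V) = val x := by
    intro X x hx z
    exact (hsmul _ _).symm.trans (congrArg val (hx z))
  have hgX : ∀ (g : G) (X : Multiplicative (Fin r → ℤ) →* G) z,
      ι g * ι.comp X z = ι.comp ((MulAut.conj g).toMonoidHom.comp X) z * ι g := by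
    intro g X z
    simp [← map_mul]
  refine equivariantEulerChar_succ_eq_sum (fun g x y h => ?_) (IsSemisimpleHom ι) (fun X hX g => ?_)
    hzero Z (chainInv ι val) hmem hsurj (fun X c hc g => ?_) (fun X c X' c' hc hc' he => ?_)
    (fun z => (-1) ^ (z.2.card + 1)) (fun X c hc => ?_)
  · rw [← hval, hsmul, hsmul]
    exact map_mono ((hval _ _).2 h)
  · have : IsSemisimpleModule _ _ := hX
    exact IsSemisimpleModule.congr (repIso (ι g) (hgX g X)).symm
  · refine Prod.ext ?_ ?_
    · exact (mult_congr (repIso (ι g) (hgX g X))).symm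
    · change (c.image _).image _ = c.image _
      rw [Finset.image_image]
      refine Finset.image_congr fun x _ => ?_
      refine Eq.trans ?_ (mult_genSub_map (ι g) (hgX g X) (val x))
      exact mult_eq_of_eq (congrArg _ (hsmul g x))
  · obtain ⟨g, f, hf, hmap⟩ := hconj X c X' c' hc hc' he
    -- Linearity of `f` over the group algebra says that `g` conjugates `X` to `X'`.
    have h1 : ∀ z, ι g * ι.comp X z = ι.comp X' z * ι g := by
      intro z
      apply LinearEquiv.ext
      intro v
      obtain ⟨v, rfl⟩ := (repEquiv (ι.comp X)).surjective v
      change ι g (ι.comp X z (repEquiv _ v)) = ι.comp X' z (ι g (repEquiv _ v))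
      rw [← hf, ← repEquiv_smul, ← repEquiv_smul, ← hf, map_smul]
    -- A stable subspace is recovered from the submodule that it generates, so what `f` does to
    -- submodules determines what `g` does to members of the chain.
    have h2 : ∀ x ∈ c, ∀ x' ∈ c',
        mult (GroupAlg F r) (genSub (ι.comp X) (val x)) =
        mult (GroupAlg F r) (genSub (ι.comp X') (val x')) →
        g • x = x' := by
      intro x hx x' hx' h
      apply hval'
      rw [hsmul, ← subspace_genSub (hfix X' x' (hc'.2.2 x' hx')), ← hmap x hx x' hx' h]
      ext v
      obtain ⟨v, rfl⟩ := (repEquiv (ι.comp X')).surjective v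
      rw [mem_subspace]
      constructor
      · rintro ⟨u, hu, huv⟩
        refine ⟨(repEquiv (ι.comp X)).symm u, ?_, ?_⟩
        · refine (mem_genSub (hfix X x (hc.2.2 x hx))).2 ?_
          simpa using hu
        · apply (repEquiv (ι.comp X')).injective
          refine (hf _).trans ?_
          rw [LinearEquiv.apply_symm_apply]
          exact huv
      · rintro ⟨w, hw, rfl⟩
        exact ⟨repEquiv _ w, (mem_genSub (hfix X x (hc.2.2 x hx))).1 hw, (hf w).symm⟩
    have h3 := congrArg Prod.snd he
    refine ⟨g, ?_, ?_⟩
    · apply MonoidHom.ext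
      intro z
      apply hι
      have := h1 z
      simp only [MonoidHom.comp_apply] at this
      simp only [MulEquiv.toMonoidHom_eq_coe, MonoidHom.coe_comp, MonoidHom.coe_coe,
        Function.comp_apply, MulAut.conj_apply, map_mul, map_inv]
      rw [this, mul_inv_cancel_right]
    · ext x'
      rw [Finset.mem_image]
      constructor
      · rintro ⟨x, hx, rfl⟩
        have h4 := Finset.mem_image_of_mem (fun x => mult (GroupAlg F r) (genSub (ι.comp X) (val x))) hx
        obtain ⟨y, hy, hyx⟩ := Finset.mem_image.1 (h3.subset h4)
        change g • x ∈ c'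
        rw [h2 x hx y hy hyx.symm]
        exact hy
      · intro hx'
        have h4 := Finset.mem_image_of_mem (fun x => mult (GroupAlg F r) (genSub (ι.comp X') (val x))) hx'
        obtain ⟨y, hy, hyx⟩ := Finset.mem_image.1 (h3.superset h4)
        exact ⟨y, hy, h2 y hy x' hx' hyx⟩
  · have hss : IsSemisimpleModule _ _ := hc.1
    change (-1 : ℤ) ^ ((c.image _).card + 1) = _
    rw [Finset.card_image_of_injOn]
    intro x hx y hy hxy
    by_contra hne
    -- Multiplicities increase strictly along a chain, so passing to them preserves the number of
    -- members and hence the sign.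
    have key : ∀ x ∈ c, ∀ y ∈ c, x ≤ y → x ≠ y →
        mult (GroupAlg F r) (genSub (ι.comp X) (val x)) ≠
        mult (GroupAlg F r) (genSub (ι.comp X) (val y)) := by
      intro x hx y hy hle hne
      refine (mult_strictMono (lt_of_le_not_ge (genSub_le_genSub ((hval _ _).2 hle)) fun h => ?_)).ne
      rw [genSub_le_iff (hfix X x (hc.2.2 x hx)), hval] at h
      exact hne (le_antisymm hle h)
    rcases hc.2.1 hx hy hne with h | h
    · exact key x hx y hy h hne hxy
    · exact key y hy x hx h (Ne.symm hne) hxy.symm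

end Invariants

-- The invariants to be counted are pairs of a multiplicity `M` and a chain of admissible `N`.
-- Grouping them by `M` turns their signed count into a sum of Euler characteristics.
open scoped Classical in
theorem exists_finset_chains {ι κ : Type*} [PartialOrder κ] (Ms : Finset ι) (Q : ι → κ → Prop)
    [∀ M, Finite {N // Q M N}] : ∃ Z : Finset (ι × Finset κ),
      (∀ z, z ∈ Z ↔ z.1 ∈ Ms ∧ IsChain (· ≤ ·) (z.2 : Set κ) ∧ ∀ N ∈ z.2, Q z.1 N) ∧
      ∑ z ∈ Z, (-1 : ℤ) ^ (z.2.card + 1) = ∑ M ∈ Ms, reducedEulerChar {N // Q M N} := by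
  have := fun M => Fintype.ofFinite {N // Q M N}
  refine ⟨Ms.biUnion fun M => (chains {N // Q M N}).image fun s =>
    (M, s.map (Function.Embedding.subtype _)), fun z => ?_, ?_⟩
  · obtain ⟨M, C⟩ := z
    simp only [Finset.mem_biUnion, Finset.mem_image, mem_chains, Prod.mk.injEq]
    constructor
    · rintro ⟨M, hM, s, hs, rfl, rfl⟩
      refine ⟨hM, (isChain_map_iff (OrderEmbedding.subtype _) s).2 hs, fun N hN => ?_⟩
      obtain ⟨x, -, rfl⟩ := Finset.mem_map.1 hN
      exact x.2
    · rintro ⟨hM, hC, hQ⟩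
      refine ⟨M, hM, C.subtype _, ?_, rfl, Finset.subtype_map_of_mem hQ⟩
      rw [← isChain_map_iff (OrderEmbedding.subtype _)]
      have := Finset.subtype_map_of_mem hQ
      convert hC using 2
      exact this
  · rw [Finset.sum_biUnion]
    · refine Finset.sum_congr rfl fun M _ => ?_
      rw [Finset.sum_image, reducedEulerChar_eq_sum]
      · exact Finset.sum_congr rfl fun s _ => by rw [Finset.card_map]
      · intro s _ t _ hst
        exact Finset.map_injective _ (congrArg Prod.snd hst)
    · intro M _ M' _ hne
      rw [Function.onFun, Finset.disjoint_left]
      rintro z hz hz'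
      obtain ⟨s, -, rfl⟩ := Finset.mem_image.1 hz
      obtain ⟨s', -, h⟩ := Finset.mem_image.1 hz'
      exact hne (congrArg Prod.fst h).symm

theorem isChain_finset_image {α β : Type*} [Preorder α] [Preorder β] [DecidableEq β] {c : Finset α}
    (hc : IsChain (· ≤ ·) (c : Set α)) {f : α → β} (hf : Monotone f) :
    IsChain (· ≤ ·) ((c.image f : Finset β) : Set β) := by
  rw [Finset.coe_image]
  rintro _ ⟨x, hx, rfl⟩ _ ⟨y, hy, rfl⟩ hne
  rcases hc hx hy (fun h => hne (by rw [h])) with h | h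
  · exact Or.inl (hf h)
  · exact Or.inr (hf h)

/-! ### Realizing multiplicities by homomorphisms and chains. -/

section Existence

variable {R : Type u} [CommRing R]

/-- Direct sums of the simple modules `R ⧸ m` suffice. -/
theorem exists_module_mult_eq (hfin : ∀ m : MaximalSpectrum R, Finite (R ⧸ m.asIdeal))
    (M : MaximalSpectrum R →₀ ℕ) : ∃ (W : Type u) (_ : AddCommGroup W) (_ : Module R W)
      (_ : Finite W), IsSemisimpleModule R W ∧ mult R W = M := by
  have hadd : ∀ M M' : MaximalSpectrum R →₀ ℕ,
      (∃ (W : Type u) (_ : AddCommGroup W) (_ : Module R W)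
        (_ : Finite W), IsSemisimpleModule R W ∧ mult R W = M) →
      (∃ (W : Type u) (_ : AddCommGroup W) (_ : Module R W)
        (_ : Finite W), IsSemisimpleModule R W ∧ mult R W = M') →
      ∃ (W : Type u) (_ : AddCommGroup W) (_ : Module R W)
        (_ : Finite W), IsSemisimpleModule R W ∧ mult R W = M + M' := by
    rintro M M' ⟨W, _, _, _, hW, rfl⟩ ⟨W', _, _, _, hW', rfl⟩
    exact ⟨W × W', inferInstance, inferInstance, inferInstance, isSemisimpleModule_prod, mult_prod⟩
  have hzero : ∃ (W : Type u) (_ : AddCommGroup W) (_ : Module R W)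
      (_ : Finite W), IsSemisimpleModule R W ∧ mult R W = 0 :=
    ⟨PUnit, inferInstance, inferInstance, inferInstance,
      (isSemisimpleModule_iff R _).2 ⟨fun _ => ⟨⊤, disjoint_iff.2 (Subsingleton.elim _ _),
      codisjoint_iff.2 (Subsingleton.elim _ _)⟩⟩, mult_of_subsingleton⟩
  induction M using Finsupp.induction_linear with
  | zero => exact hzero
  | add M M' h h' => exact hadd M M' h h'
  | single m k =>
    induction k with
    | zero =>
      rw [Finsupp.single_zero]
      exact hzero
    | succ k ih =>
      rw [Finsupp.single_add]
      have := isSemisimpleModule_quotient m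
      exact hadd _ _ ih ⟨R ⧸ m.asIdeal, inferInstance, inferInstance, inferInstance, this,
        mult_quotient m⟩

end Existence

section Transport

variable {F V W A : Type*} [Field F] [AddCommGroup V] [Module F V] [CommGroup A] [AddCommGroup W]
  [Module F W] [Module (MonoidAlgebra F A) W] [IsScalarTower F (MonoidAlgebra F A) W]

/-- A module over the group algebra, transported to another space, is given by a homomorphism. -/
theorem exists_hom_of_module (e : W ≃ₗ[F] V) : ∃ (X : A →* (V ≃ₗ[F] V))
    (f : W ≃ₗ[MonoidAlgebra F A] RepModule X), ∀ w, repEquiv X (f w) = e w := by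
  have hmul : ∀ a b : A, ∀ w : W, MonoidAlgebra.of F A a • MonoidAlgebra.of F A b • w =
      MonoidAlgebra.of F A (a * b) • w := fun a b w => by rw [smul_smul, map_mul]
  have hinv : ∀ a : A, ∀ w : W,
      MonoidAlgebra.of F A a • MonoidAlgebra.of F A a⁻¹ • w = w := fun a w => by
    rw [hmul, mul_inv_cancel, map_one, one_smul]
  have hinv' : ∀ a : A, ∀ w : W,
      MonoidAlgebra.of F A a⁻¹ • MonoidAlgebra.of F A a • w = w := fun a w => by
    rw [hmul, inv_mul_cancel, map_one, one_smul]
  let Y : A → W ≃ₗ[F] W := fun a =>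
    { toFun := fun w => MonoidAlgebra.of F A a • w
      map_add' := fun _ _ => smul_add _ _ _
      map_smul' := fun x w => by
        rw [RingHom.id_apply, ← algebraMap_smul (MonoidAlgebra F A) x, smul_comm, algebraMap_smul]
      invFun := fun w => MonoidAlgebra.of F A a⁻¹ • w
      left_inv := hinv' a
      right_inv := hinv a }
  let X : A →* (V ≃ₗ[F] V) :=
    { toFun := fun a => e.symm.trans ((Y a).trans e)
      map_one' := by
        apply LinearEquiv.ext
        intro v
        change e (MonoidAlgebra.of F A 1 • e.symm v) = v
        rw [map_one, one_smul, e.apply_symm_apply]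
      map_mul' := fun a b => by
        apply LinearEquiv.ext
        intro v
        change e (MonoidAlgebra.of F A (a * b) • e.symm v) =
          e (MonoidAlgebra.of F A a • e.symm (e (MonoidAlgebra.of F A b • e.symm v)))
        rw [e.symm_apply_apply, hmul] }
  refine ⟨X, linearEquivOfCommute (e.trans (repEquiv X).symm) fun a w => ?_, fun w => ?_⟩
  · apply (repEquiv X).injective
    rw [repEquiv_smul, LinearEquiv.trans_apply, LinearEquiv.trans_apply,
      LinearEquiv.apply_symm_apply, LinearEquiv.apply_symm_apply]
    change _ = e (MonoidAlgebra.of F A a • e.symm (e w))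
    rw [e.symm_apply_apply]
  · rw [linearEquivOfCommute_apply, LinearEquiv.trans_apply, LinearEquiv.apply_symm_apply]

end Transport

/-- Zariski's lemma: the group algebra is a finitely generated algebra, so its residue fields are
finite over `F`. -/
theorem finite_quotient_groupAlg {F : Type*} [Field F] [Finite F] {r : ℕ}
    (m : MaximalSpectrum (GroupAlg F r)) : Finite (GroupAlg F r ⧸ m.asIdeal) := by
  have : Monoid.FG (Multiplicative (Fin r → ℤ)) := inferInstance
  have hft : Algebra.FiniteType F (GroupAlg F r) := inferInstance
  have := m.isMaximal
  let _ := Ideal.Quotient.field m.asIdeal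
  have : Algebra.FiniteType F (GroupAlg F r ⧸ m.asIdeal) :=
    Algebra.FiniteType.of_surjective (Ideal.Quotient.mkₐ F m.asIdeal)
      (Ideal.Quotient.mkₐ_surjective F m.asIdeal)
  have : Module.Finite F (GroupAlg F r ⧸ m.asIdeal) :=
    finite_of_finite_type_of_isJacobsonRing F (GroupAlg F r ⧸ m.asIdeal)
  exact Module.finite_of_finite F

section FixedChains

variable {F V G P : Type*} [Field F] [AddCommGroup V] [Module F V] [Group G]
  [PartialOrder P] [MulAction G P] {r : ℕ}

theorem bot_lt_genSub {A : Type*} [CommGroup A] (X : A →* (V ≃ₗ[F] V)) {U : Submodule F V}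
    (h : ⊥ < U) : ⊥ < genSub X U := by
  rw [bot_lt_iff_ne_bot] at h ⊢
  intro h'
  apply h
  rw [eq_bot_iff]
  intro v hv
  obtain ⟨v, rfl⟩ := (repEquiv X).surjective v
  have : v ∈ genSub X U := subset_span hv
  rw [h', mem_bot] at this
  rw [this, map_zero]
  exact zero_mem _

theorem genSub_lt_top {A : Type*} [CommGroup A] {X : A →* (V ≃ₗ[F] V)} {U : Submodule F V}
    (hU : ∀ a, U.map (X a : V →ₗ[F] V) = U) (h : U < ⊤) : genSub X U < ⊤ := by
  rw [lt_top_iff_ne_top] at h ⊢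
  intro h'
  apply h
  rw [← subspace_genSub hU, h', subspace_top]

theorem bot_lt_subspace {A : Type*} [CommGroup A] {X : A →* (V ≃ₗ[F] V)}
    {W : Submodule (MonoidAlgebra F A) (RepModule X)} (h : W ≠ ⊥) : ⊥ < subspace X W := by
  rw [bot_lt_iff_ne_bot]
  intro h'
  rw [← subspace_bot X] at h'
  exact h (le_antisymm (subspace_le_iff.1 h'.le) bot_le)

theorem subspace_lt_top {A : Type*} [CommGroup A] {X : A →* (V ≃ₗ[F] V)}
    {W : Submodule (MonoidAlgebra F A) (RepModule X)} (h : W ≠ ⊤) : subspace X W < ⊤ := by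
  rw [lt_top_iff_ne_top]
  intro h'
  rw [← subspace_top X] at h'
  exact h (le_antisymm le_top (subspace_le_iff.1 h'.ge))

/-- The socle is stable under automorphisms commuting with the action. -/
theorem map_subspace_socle {A : Type*} [CommGroup A] (X : A →* (V ≃ₗ[F] V)) (g : V ≃ₗ[F] V)
    (hg : ∀ a, g * X a = X a * g) :
    (subspace X (socle _ _)).map (g : V →ₗ[F] V) = subspace X (socle _ _) := by
  have h := map_repIso_genSub g hg (subspace X (socle _ _))
  rw [genSub_subspace, map_socle] at h
  have hinv : ∀ a, ((subspace X (socle _ _)).map (g : V →ₗ[F] V)).map (X a : V →ₗ[F] V) =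
      (subspace X (socle _ _)).map (g : V →ₗ[F] V) := by
    intro a
    conv_rhs => rw [← map_subspace X _ a]
    rw [← Submodule.map_comp, ← Submodule.map_comp]
    congr 1
    apply LinearMap.ext
    intro v
    exact (LinearEquiv.congr_fun (hg a) v).symm
  rw [← subspace_genSub hinv, ← h]

open scoped Classical in
theorem isChain_image_genSub {A : Type*} [CommGroup A] (X : A →* (V ≃ₗ[F] V))
    {val : P → Submodule F V} (hval : ∀ x y, val x ≤ val y ↔ x ≤ y) {c : Finset P}
    (hc : IsChain (· ≤ ·) (c : Set P)) :
    IsChain (· ≤ ·) ((c.image fun x => genSub X (val x) :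
      Finset (Submodule (MonoidAlgebra F A) (RepModule X))) :
      Set (Submodule (MonoidAlgebra F A) (RepModule X))) :=
  isChain_finset_image hc fun x y h => genSub_le_genSub ((hval x y).2 h)

variable [Finite V]

-- Passes from submodules with the prescribed multiplicities to elements of the poset. It proves
-- surjectivity of the invariant in both the linear and the unitary case.
open scoped Classical in
theorem exists_fixedChain (ι : G →* (V ≃ₗ[F] V)) (val : P → Submodule F V)
    (hval : ∀ x y, val x ≤ val y ↔ x ≤ y)
    (hsmul : ∀ (g : G) x, val (g • x) = (val x).map (ι g : V →ₗ[F] V))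
    (X : Multiplicative (Fin r → ℤ) →* G) (hX : IsSemisimpleHom ι X)
    (C : Finset (MaximalSpectrum (GroupAlg F r) →₀ ℕ))
    (hC : IsChain (· ≤ ·) (C : Set (MaximalSpectrum (GroupAlg F r) →₀ ℕ)))
    (s : (MaximalSpectrum (GroupAlg F r) →₀ ℕ) → Submodule (GroupAlg F r) (RepModule (ι.comp X)))
    (hs : ∀ N ∈ C, mult (GroupAlg F r) (s N) = N)
    (hs' : ∀ N ∈ C, ∀ N' ∈ C, N ≤ N' → s N ≤ s N')
    (hP : ∀ N ∈ C, ∃ x : P, val x = subspace (ι.comp X) (s N)) :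
    ∃ c, IsFixedChain (IsSemisimpleHom ι) X c ∧ (chainInv ι val X c).2 = C := by
  have hval' : Function.Injective val := fun x y h =>
    le_antisymm ((hval _ _).1 h.le) ((hval _ _).1 h.ge)
  rcases C.eq_empty_or_nonempty with rfl | ⟨N₀, hN₀⟩
  · exact ⟨∅, ⟨hX, by simp, by simp⟩, rfl⟩
  have : Nonempty P := ⟨(hP N₀ hN₀).choose⟩
  choose! t ht using hP
  refine ⟨C.image t, ⟨hX, ?_, fun x hx z => ?_⟩, ?_⟩
  · rw [Finset.coe_image]
    rintro _ ⟨N, hN, rfl⟩ _ ⟨N', hN', rfl⟩ hne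
    rcases hC hN hN' (fun h => hne (by rw [h])) with h | h
    · refine Or.inl ((hval _ _).1 ?_)
      rw [ ht N hN, ht N' hN', subspace_le_iff]
      exact hs' N hN N' hN' h
    · refine Or.inr ((hval _ _).1 ?_)
      rw [ht N hN, ht N' hN', subspace_le_iff]
      exact hs' N' hN' N hN h
  · obtain ⟨N, hN, rfl⟩ := Finset.mem_image.1 hx
    apply hval'
    rw [hsmul, ht N hN]
    exact map_subspace _ _ z
  · change (C.image t).image _ = C
    rw [Finset.image_image]
    conv_rhs => rw [← Finset.image_id (s := C)]
    refine Finset.image_congr fun N hN => ?_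
    refine Eq.trans (mult_eq_of_eq ?_) (hs N hN)
    rw [ht N hN, genSub_subspace]

end FixedChains

/-! ### The general linear group. -/

section Linear

variable {K : Type*} [Field K] [Finite K] {r n : ℕ}

/-- If the module is not semisimple, its socle is a proper nonzero subspace, stable under `X` and
under whatever commutes with `X`. Every nonzero submodule meets it, so intersecting with the socle
retracts the fixed poset onto one whose greatest element is the socle. -/
theorem reducedEulerChar_fixed_eq_zero_linear
    {X : Multiplicative (Fin r → ℤ) →* ((Fin n → K) ≃ₗ[K] (Fin n → K))}
    (hX : ¬ IsSemisimpleHom (MonoidHom.id _) X) {g : (Fin n → K) ≃ₗ[K] (Fin n → K)}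
    (hg : ∀ z, Commute (X z) g) :
    reducedEulerChar {x : SubspacePoset K n // (∀ z, X z • x = x) ∧ g • x = x} = 0 := by
  let S₀ := socle (GroupAlg K r) (RepModule X)
  have hS1 : S₀ ≠ ⊤ := fun h => hX (isSemisimpleModule_of_socle_eq_top h)
  have hS0 : S₀ ≠ ⊥ := by
    intro h
    have h1 : (⊤ : Submodule (GroupAlg K r) (RepModule X)) ≠ ⊥ := fun h' => hS1 (by rw [h, h'])
    have := inf_socle_ne_bot h1
    rw [top_inf_eq] at this
    exact this h
  have hSg : (subspace X S₀).map (g : (Fin n → K) →ₗ[K] (Fin n → K)) = subspace X S₀ :=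
    map_subspace_socle X g fun z => (hg z).symm
  let s : {x : SubspacePoset K n // (∀ z, X z • x = x) ∧ g • x = x} :=
    ⟨⟨subspace X S₀, bot_lt_subspace hS0, subspace_lt_top hS1⟩,
      fun z => Subtype.ext (map_subspace X S₀ z), Subtype.ext hSg⟩
  have hinv : ∀ x : {x : SubspacePoset K n // (∀ z, X z • x = x) ∧ g • x = x}, ∀ z,
      x.1.1.map (X z : (Fin n → K) →ₗ[K] (Fin n → K)) = x.1.1 :=
    fun x z => congrArg Subtype.val (x.2.1 z)
  have hinvg : ∀ x : {x : SubspacePoset K n // (∀ z, X z • x = x) ∧ g • x = x},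
      x.1.1.map (g : (Fin n → K) →ₗ[K] (Fin n → K)) = x.1.1 :=
    fun x => congrArg Subtype.val x.2.2
  have hmapinf : ∀ (g : (Fin n → K) ≃ₗ[K] (Fin n → K)) (U U' : Submodule K (Fin n → K)),
      U.map (g : (Fin n → K) →ₗ[K] (Fin n → K)) = U →
      U'.map (g : (Fin n → K) →ₗ[K] (Fin n → K)) = U' →
      (U ⊓ U').map (g : (Fin n → K) →ₗ[K] (Fin n → K)) = U ⊓ U' := by
    intro g U U' h h'
    rw [Submodule.map_inf _ g.injective, h, h']
  let f : {x : SubspacePoset K n // (∀ z, X z • x = x) ∧ g • x = x} →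
      {x : SubspacePoset K n // (∀ z, X z • x = x) ∧ g • x = x} := fun x =>
    ⟨⟨x.1.1 ⊓ subspace X S₀, by
        rw [← subspace_genSub (hinv x), ← subspace_inf]
        exact bot_lt_subspace (inf_socle_ne_bot (bot_lt_genSub X x.1.2.1).ne'),
        inf_le_left.trans_lt x.1.2.2⟩,
      fun z => Subtype.ext (hmapinf _ _ _ (hinv x z) (map_subspace X S₀ z)),
      Subtype.ext (hmapinf _ _ _ (hinvg x) hSg)⟩
  have hf : ∀ x, (f x).1.1 = x.1.1 ⊓ subspace X S₀ := fun _ => rfl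
  have hmono : Monotone f := fun x y h => by
    change (f x).1.1 ≤ (f y).1.1
    rw [hf, hf]
    exact inf_le_inf_right _ h
  have hle : ∀ x, f x ≤ x := fun x => by
    change (f x).1.1 ≤ x.1.1
    rw [hf]
    exact inf_le_left
  have hidem : ∀ x, f (f x) = f x := fun x => by
    refine Subtype.ext (Subtype.ext ?_)
    rw [hf, hf, inf_assoc, inf_idem]
  rw [reducedEulerChar_retract_of_le f hmono hle hidem]
  refine reducedEulerChar_eq_zero_of_isGreatest ⟨s, Subtype.ext (Subtype.ext (inf_idem _))⟩
    fun x => ?_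
  have : f x.1 ≤ s := by
    change (f x.1).1.1 ≤ subspace X S₀
    rw [hf]
    exact inf_le_right
  rwa [x.2] at this

instance finite_between {I : Type*} (M : I →₀ ℕ) : Finite {N : I →₀ ℕ // N ≠ 0 ∧ N < M} := by
  classical
  exact ((Set.finite_Iic M).subset fun N hN => hN.2.le).to_subtype

open scoped Classical in
/-- The equivariant Euler characteristic of the general linear group as a sum over multiplicities
of maximal ideals. -/
theorem chiGL_succ_eq_sum (Ms : Finset (MaximalSpectrum (GroupAlg K r) →₀ ℕ))
    (hMs : ∀ M, M ∈ Ms ↔ weight (degree K) M = n) :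
    chiGL K (r + 1) n = ((∑ M ∈ Ms, reducedEulerChar {N // N ≠ 0 ∧ N < M} : ℤ) : ℚ) := by
  obtain ⟨Z, hZ, hsum⟩ := exists_finset_chains Ms
    (fun M N : MaximalSpectrum (GroupAlg K r) →₀ ℕ => N ≠ 0 ∧ N < M)
  rw [chiGL, ← hsum]
  have hfix : ∀ (X : Multiplicative (Fin r → ℤ) →* ((Fin n → K) ≃ₗ[K] (Fin n → K)))
      (x : SubspacePoset K n), (∀ z, X z • x = x) → ∀ z,
        x.1.map (X z : (Fin n → K) →ₗ[K] (Fin n → K)) = x.1 :=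
    fun X x hx z => congrArg Subtype.val (hx z)
  refine equivariantEulerChar_eq_sum_mult (P := SubspacePoset K n) (MonoidHom.id _)
    Function.injective_id (fun x => x.1) (fun _ _ => Iff.rfl) (fun _ _ => rfl)
    (fun X hX g hg => reducedEulerChar_fixed_eq_zero_linear hX hg) Z (fun X c hc => ?_)
    (fun z hz => ?_) (fun X c X' c' hc hc' he => ?_)
  · have : IsSemisimpleModule (GroupAlg K r) (RepModule ((MonoidHom.id _).comp X)) := hc.1
    refine (hZ _).2 ⟨(hMs _).2 ?_, ?_, fun N hN => ?_⟩
    · change weight _ (mult _ _) = n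
      rw [← finrank_eq_weight_mult, (repEquiv _).finrank_eq, finrank_fin_fun]
    · exact isChain_finset_image hc.2.1 fun x y h => mult_mono (genSub_le_genSub h)
    · obtain ⟨x, hx, rfl⟩ := Finset.mem_image.1 hN
      refine ⟨fun h => (bot_lt_genSub _ x.2.1).ne' (mult_eq_zero_iff.1 h), ?_⟩
      refine (mult_strictMono (genSub_lt_top (hfix X x (hc.2.2 x hx)) x.2.2)).trans_eq mult_top
  -- Surjectivity of the invariant: a semisimple module of multiplicity `M` has dimension `n`, so
  -- its structure can be transported to `K^n`.
  · obtain ⟨M, C⟩ := z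
    obtain ⟨hM, hC, hQ⟩ := (hZ _).1 hz
    obtain ⟨W, _, _, _, hW, hWM⟩ := exists_module_mult_eq finite_quotient_groupAlg M
    let _ : Module K W := Module.compHom W (algebraMap K (GroupAlg K r))
    have : IsScalarTower K (GroupAlg K r) W := ⟨fun a x w => by
      rw [Algebra.smul_def, mul_smul]
      rfl⟩
    have hdim : finrank K W = finrank K (Fin n → K) := by
      rw [finrank_eq_weight_mult (R := GroupAlg K r), hWM, (hMs M).1 hM, finrank_fin_fun]
    obtain ⟨X, f, hf⟩ := exists_hom_of_module (A := Multiplicative (Fin r → ℤ))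
      (LinearEquiv.ofFinrankEq W (Fin n → K) hdim)
    have hX : IsSemisimpleModule (GroupAlg K r) (RepModule X) := IsSemisimpleModule.congr f.symm
    have hXM : mult (GroupAlg K r) (RepModule X) = M := (mult_congr f).symm.trans hWM
    obtain ⟨s, hs, hs'⟩ := exists_chain_mult_eq (V := RepModule X) C hC
      fun N hN => hXM ▸ (hQ N hN).2.le
    have hP : ∀ N ∈ C, ∃ x : SubspacePoset K n, x.1 = subspace X (s N) := by
      intro N hN
      refine ⟨⟨subspace X (s N), bot_lt_subspace fun h => ?_, subspace_lt_top fun h => ?_⟩, rfl⟩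
      · exact (hQ N hN).1 ((hs N hN).symm.trans ((mult_eq_of_eq h).trans mult_bot))
      · exact (hQ N hN).2.ne ((hs N hN).symm.trans ((mult_eq_of_eq h).trans (mult_top.trans hXM)))
    obtain ⟨c, hc, hcC⟩ := exists_fixedChain (P := SubspacePoset K n) (MonoidHom.id _)
      (fun x => x.1) (fun _ _ => Iff.rfl) (fun _ _ => rfl) X hX C hC s hs hs' hP
    exact ⟨X, c, hc, Prod.ext hXM hcC⟩
  · have : IsSemisimpleModule (GroupAlg K r) (RepModule ((MonoidHom.id _).comp X)) := hc.1
    have : IsSemisimpleModule (GroupAlg K r) (RepModule ((MonoidHom.id _).comp X')) := hc'.1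
    have him := congrArg Prod.snd he
    obtain ⟨f, hf⟩ := exists_linearEquiv_map_chain (congrArg Prod.fst he) _ _
      (isChain_image_genSub ((MonoidHom.id _).comp X) (val := fun x : SubspacePoset K n => x.1)
        (fun _ _ => Iff.rfl) hc.2.1)
      (isChain_image_genSub ((MonoidHom.id _).comp X') (val := fun x : SubspacePoset K n => x.1)
        (fun _ _ => Iff.rfl) hc'.2.1) (by
        rw [Finset.image_image, Finset.image_image]
        exact him)
    refine ⟨(repEquiv _).symm.trans ((f.restrictScalars K).trans (repEquiv _)), f, fun v => ?_,
      fun x hx x' hx' h => hf (genSub ((MonoidHom.id _).comp X) x.1)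
        (Finset.mem_image.2 ⟨x, hx, rfl⟩) (genSub ((MonoidHom.id _).comp X') x'.1)
        (Finset.mem_image.2 ⟨x', hx', rfl⟩) h⟩
    change _ = repEquiv _ (f ((repEquiv _).symm (repEquiv _ v)))
    rw [LinearEquiv.symm_apply_apply]

end Linear

/-! ### The Hermitian form and the involution of the group algebra. -/

section Frobenius

variable {F : Type*} [Field F] [Finite F] {q : ℕ}

theorem pow_pow_eq_self (hF : Nat.card F = q ^ 2) (x : F) : (x ^ q) ^ q = x := by
  have := Fintype.ofFinite F
  rw [← pow_mul, ← sq, ← hF, Nat.card_eq_fintype_card, FiniteField.pow_card]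

/-- The polynomial `X ^ q - X` has at most `q` roots, fewer than the field has elements. -/
theorem exists_pow_ne_self (hq : 1 < q) (hF : Nat.card F = q ^ 2) : ∃ x : F, x ^ q ≠ x := by
  by_contra! h
  have := Fintype.ofFinite F
  have h1 := FiniteField.X_pow_card_sub_X_natDegree_eq F hq
  have h2 := FiniteField.X_pow_card_sub_X_ne_zero F hq
  have h3 := Polynomial.card_le_degree_of_subset_roots
    (p := (Polynomial.X ^ q - Polynomial.X : Polynomial F)) (Z := Finset.univ) (by
      intro x _
      rw [Polynomial.mem_roots h2]
      simp [h x])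
  rw [h1, Finset.card_univ, ← Nat.card_eq_fintype_card, hF] at h3
  nlinarith

end Frobenius

section Involution

variable {F A : Type*} [Field F] [CommGroup A]

variable (A) in
/-- The involution of the group algebra that inverts group elements and acts as `σ` on scalars. -/
noncomputable def algInv (σ : F →+* F) : MonoidAlgebra F A →+* MonoidAlgebra F A :=
  (MonoidAlgebra.mapRingHom A σ).comp (MonoidAlgebra.mapDomainRingHom F (invMonoidHom : A →* A))

theorem algInv_single (σ : F →+* F) (a : A) (x : F) :
    algInv A σ (MonoidAlgebra.single a x) = MonoidAlgebra.single a⁻¹ (σ x) := by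
  simp [algInv]

theorem isSesqPair_algInv {σ : F →+* F} (hσ : ∀ x, σ (σ x) = x) (hne : ∃ x, σ x ≠ x) :
    IsSesqPair (F := F) σ (algInv A σ) where
  sigma_sigma := hσ
  sigma_ne := hne
  tau_tau x := by
    induction x using MonoidAlgebra.induction_linear with
    | zero => rw [map_zero, map_zero]
    | add x y hx hy => rw [map_add, map_add, hx, hy]
    | single a x => rw [algInv_single, algInv_single, inv_inv, hσ]
  tau_algebraMap x := by
    rw [MonoidAlgebra.coe_algebraMap]
    simp [algInv_single]

theorem isSesqPair_self {σ : F →+* F} (hσ : ∀ x, σ (σ x) = x) (hne : ∃ x, σ x ≠ x) :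
    IsSesqPair (F := F) σ σ := ⟨hσ, hne, hσ, fun _ => rfl⟩

variable {V : Type*} [AddCommGroup V] [Module F V] {h : V → V → F} {σ : F →+* F}

theorem IsHerm.restrictScalars {R : Type*} [CommRing R] [Algebra F R] [Module R V]
    {τ : R →+* R} (hh : IsHerm (R := R) σ τ h) (hσ : ∀ x, σ (σ x) = x) : IsHerm (R := F) σ σ h where
  add_left := hh.add_left
  smul_left := hh.smul_left
  symm := hh.symm
  adj a u v := by rw [hh.smul_left, hh.smul_right, hσ]
  nondeg := hh.nondeg

/-- A Hermitian form invariant under a group is Hermitian over the group algebra. -/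
theorem IsHerm.repModule (hh : IsHerm (R := F) σ σ h) {X : A →* (V ≃ₗ[F] V)}
    (hX : ∀ a u v, h (X a u) (X a v) = h u v) :
    IsHerm (R := MonoidAlgebra F A) σ (algInv A σ)
      (fun u v : RepModule X => h (repEquiv X u) (repEquiv X v)) where
  add_left u v w := by rw [map_add, hh.add_left]
  smul_left a u v := by rw [map_smul, hh.smul_left]
  symm u v := hh.symm _ _
  adj r u v := by
    induction r using MonoidAlgebra.induction_linear with
    | zero => rw [map_zero, zero_smul, zero_smul, map_zero, hh.zero_left, hh.zero_right]
    | add x y hx hy =>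
      rw [add_smul, map_add, hh.add_left, hx, hy, map_add (algInv A σ), add_smul, map_add,
        hh.add_right]
    | single a x =>
      have h1 : ∀ (a : A) (x : F) (w : RepModule X),
          repEquiv X (MonoidAlgebra.single a x • w) = x • X a (repEquiv X w) := by
        intro a x w
        have h2 : MonoidAlgebra.single a x = x • MonoidAlgebra.of F A a := by
          rw [MonoidAlgebra.of_apply, MonoidAlgebra.smul_single, smul_eq_mul, mul_one]
        rw [h2, smul_assoc, map_smul, repEquiv_smul]
      rw [algInv_single, h1, h1, hh.adj, ← hX a⁻¹]
      congr 1
      · change (X a⁻¹ * X a) _ = _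
        rw [← map_mul, inv_mul_cancel, map_one]
        rfl
      · rw [map_smul]
  nondeg u hu := by
    rw [← (repEquiv X).map_eq_zero_iff]
    refine hh.nondeg _ fun v => ?_
    have := hu ((repEquiv X).symm v)
    rwa [LinearEquiv.apply_symm_apply] at this

end Involution

section ChainIsometry

variable {F R : Type*} [Field F] [CommRing R] [Algebra F R] {σ : F →+* F} {τ : R →+* R}

open scoped Classical in
/-- Chains of isotropic submodules with the same multiplicities are related by an isometry. -/
theorem IsHerm.exists_isometry_map_chain (hS : IsSesqPair (F := F) σ τ) {V V' : Type u}
    [AddCommGroup V] [Module F V] [Module R V] [IsScalarTower F R V] [Finite F] [Finite V]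
    [IsSemisimpleModule R V] [AddCommGroup V'] [Module F V'] [Module R V'] [IsScalarTower F R V']
    [Finite V'] [IsSemisimpleModule R V'] {h : V → V → F} (hH : IsHerm (R := R) σ τ h)
    {h' : V' → V' → F} (hH' : IsHerm (R := R) σ τ h') (hmult : mult R V = mult R V')
    (c : Finset (Submodule R V)) (c' : Finset (Submodule R V'))
    (hc : IsChain (· ≤ ·) (c : Set (Submodule R V)))
    (hc' : IsChain (· ≤ ·) (c' : Set (Submodule R V')))
    (hi : ∀ U ∈ c, ∀ x ∈ U, ∀ y ∈ U, h x y = 0) (hi' : ∀ U ∈ c', ∀ x ∈ U, ∀ y ∈ U, h' x y = 0)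
    (him : c.image (fun U : Submodule R V => mult R U) =
      c'.image (fun U : Submodule R V' => mult R U)) :
    ∃ f : V ≃ₗ[R] V', (∀ x y, h' (f x) (f y) = h x y) ∧
      ∀ U ∈ c, ∀ U' ∈ c', mult R U = mult R U' → U.map (f : V →ₗ[R] V') = U' := by
  -- Reduction to Witt's theorem for a single isotropic submodule: `U` and `U'` are the greatest
  -- members of the chains, or zero for empty chains. An isomorphism between them that matches the
  -- smaller members is extended to an isometry.
  obtain ⟨U, U', hU, hU', hUi, hUi', hUU'⟩ : ∃ (U : Submodule R V) (U' : Submodule R V'),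
      (∀ x ∈ c, x ≤ U) ∧ (∀ x ∈ c', x ≤ U') ∧ (∀ x ∈ U, ∀ y ∈ U, h x y = 0) ∧
      (∀ x ∈ U', ∀ y ∈ U', h' x y = 0) ∧ mult R U = mult R U' := by
    have hmem : ∀ U ∈ c, ∃ U' ∈ c', mult R U' = mult R U := fun U hU =>
      Finset.mem_image.1 (him.subset (Finset.mem_image.2 ⟨U, hU, rfl⟩))
    have hmem' : ∀ U ∈ c', ∃ U' ∈ c, mult R U' = mult R U := fun U hU =>
      Finset.mem_image.1 (him.superset (Finset.mem_image.2 ⟨U, hU, rfl⟩))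
    rcases c.eq_empty_or_nonempty with rfl | hne
    · have hc'0 : c' = ∅ := by
        rw [Finset.eq_empty_iff_forall_notMem]
        intro U hU
        obtain ⟨y, hy, -⟩ := hmem' U hU
        exact absurd hy (Finset.notMem_empty y)
      subst hc'0
      refine ⟨⊥, ⊥, by simp, by simp, fun x hx y _ => ?_, fun x hx y _ => ?_, ?_⟩
      · rw [(mem_bot R).1 hx, hH.zero_left]
      · rw [(mem_bot R).1 hx, hH'.zero_left]
      · rw [mult_bot, mult_bot]
    · obtain ⟨U₁, hU₁⟩ := hne
      obtain ⟨U₁', hU₁', -⟩ := hmem U₁ hU₁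
      obtain ⟨U, hU, hUmax⟩ := exists_greatest_of_isChain hc ⟨U₁, hU₁⟩
      obtain ⟨U', hU', hUmax'⟩ := exists_greatest_of_isChain hc' ⟨U₁', hU₁'⟩
      refine ⟨U, U', hUmax, hUmax', hi U hU, hi' U' hU', le_antisymm ?_ ?_⟩
      · obtain ⟨y, hy, hyU⟩ := hmem U hU
        rw [← hyU]
        exact mult_mono (hUmax' y hy)
      · obtain ⟨y, hy, hyU⟩ := hmem' U' hU'
        rw [← hyU]
        exact mult_mono (hUmax y hy)
  have hcomap : ∀ {V : Type u} [AddCommGroup V] [Module R V] [Finite V] (U : Submodule R V)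
      (c : Finset (Submodule R V)), (∀ x ∈ c, x ≤ U) →
      (c.image (fun x => x.comap U.subtype)).image (fun W : Submodule R U => mult R W) =
        c.image (fun x : Submodule R V => mult R x) := by
    intro V _ _ _ U c hU
    rw [Finset.image_image]
    exact Finset.image_congr fun x hx => mult_comap_subtype (hU x hx)
  have hmono : ∀ {V : Type u} [AddCommGroup V] [Module R V] (U : Submodule R V),
      Monotone fun x : Submodule R V => x.comap U.subtype := fun U x y h => comap_mono h
  obtain ⟨θ, hθ⟩ := exists_linearEquiv_map_chain hUU' (c.image fun x => x.comap U.subtype)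
    (c'.image fun x => x.comap U'.subtype) (isChain_finset_image hc (hmono U))
    (isChain_finset_image hc' (hmono U')) (by rw [hcomap U c hU, hcomap U' c' hU', him])
  obtain ⟨f, hf, hfθ⟩ := hH.exists_isometry_comp_eq hS hH' (φ := U.subtype) U.injective_subtype
    (fun x y => hUi _ x.2 _ y.2) (φ' := U'.subtype ∘ₗ (θ : U →ₗ[R] U'))
    (U'.injective_subtype.comp θ.injective) (fun x y => hUi' _ (θ x).2 _ (θ y).2) hmult
  refine ⟨f, hf, fun x hx y hy hxy => ?_⟩
  have h1 := hθ (x.comap U.subtype) (Finset.mem_image.2 ⟨x, hx, rfl⟩) (y.comap U'.subtype)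
    (Finset.mem_image.2 ⟨y, hy, rfl⟩)
    (by rw [mult_comap_subtype (hU x hx), mult_comap_subtype (hU' y hy), hxy])
  have h2 : x = (x.comap U.subtype).map U.subtype := by
    rw [map_comap_subtype, inf_eq_right.2 (hU x hx)]
  have h3 : (y.comap U'.subtype).map U'.subtype = y := by
    rw [map_comap_subtype, inf_eq_right.2 (hU' y hy)]
  rw [h2, ← h3, ← h1, ← Submodule.map_comp, ← Submodule.map_comp]
  congr 1
  exact LinearMap.ext hfθ

end ChainIsometry

section Form

variable {F : Type*} [Field F] {q n : ℕ} {c : F}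

/-- The condition on `c` says that `σ c = (-1)^(n+1) c`. This sign compensates the one that appears
when the coordinates are reversed, so the form is Hermitian for every `n`. -/
theorem isHerm_hermForm (hq : 1 < q) {σ : F →+* F} (hσ : ∀ x, σ x = x ^ q)
    (hσσ : ∀ x, σ (σ x) = x) (hc : c ^ (q - 1) = (-1) ^ (n + 1)) :
    IsHerm (R := F) σ σ (hermForm q n c) := by
  have hc0 : c ≠ 0 := by
    rintro rfl
    rw [zero_pow (by omega)] at hc
    exact pow_ne_zero (n + 1) (neg_ne_zero.2 (one_ne_zero (α := F))) hc.symm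
  have hcq : σ c = c * (-1) ^ (n + 1) := by
    rw [hσ, ← hc, ← pow_succ']
    congr 1
    omega
  have hform : ∀ u v, hermForm q n c u v = c * ∑ i : Fin n, (-1) ^ (i : ℕ) * u i * σ (v i.rev) := by
    intro u v
    simp only [hermForm, hσ]
  have hadd : ∀ u v w, hermForm q n c (u + v) w = hermForm q n c u w + hermForm q n c v w := by
    intro u v w
    rw [hform, hform, hform, ← mul_add, ← Finset.sum_add_distrib]
    congr 1
    refine Finset.sum_congr rfl fun i _ => ?_
    rw [Pi.add_apply]
    ring
  have hsmul : ∀ (a : F) u v, hermForm q n c (a • u) v = a * hermForm q n c u v := by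
    intro a u v
    rw [hform, hform, mul_left_comm]
    congr 1
    rw [Finset.mul_sum]
    refine Finset.sum_congr rfl fun i _ => ?_
    rw [Pi.smul_apply, smul_eq_mul]
    ring
  have hsymm : ∀ u v, hermForm q n c v u = σ (hermForm q n c u v) := by
    intro u v
    rw [hform, hform, map_mul, map_sum, hcq, mul_assoc]
    congr 1
    rw [Finset.mul_sum, ← Equiv.sum_comp Fin.revPerm]
    refine Finset.sum_congr rfl fun i _ => ?_
    simp only [Fin.revPerm_apply, Fin.rev_rev, map_mul, map_pow, map_neg, map_one, hσσ]
    have h1 : ((-1 : F)) ^ (n + 1) * (-1) ^ (i : ℕ) = (-1) ^ (i.rev : ℕ) := by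
      have h2 : (i.rev : ℕ) + (i + 1) = n := by
        rw [Fin.val_rev]
        omega
      have h4 : ((-1 : F)) ^ (n + 1) = (-1) ^ ((i.rev : ℕ) + (i + 1) + 1) :=
        congrArg (fun k => (-1 : F) ^ (k + 1)) h2.symm
      have h3 : ((-1 : F)) ^ ((i.rev : ℕ) + (i + 1) + 1) * (-1) ^ (i : ℕ) =
        (-1) ^ (i.rev : ℕ) * ((-1) ^ ((i : ℕ) + 1) * (-1) ^ ((i : ℕ) + 1)) := by ring
      rw [h4, h3, ← mul_pow]
      simp
    rw [← h1]
    ring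
  refine ⟨hadd, hsmul, hsymm, fun a u v => ?_, fun u hu => ?_⟩
  · rw [hsmul, hsymm, hsymm (σ a • v), hsmul, map_mul, hσσ]
  · funext i
    -- Pairing with the basis vector at `i.rev` isolates the coordinate `u i`, up to a unit.
    have h1 := hu (Pi.single i.rev 1)
    rw [hform, mul_eq_zero, or_iff_right hc0, Finset.sum_eq_single i] at h1
    · rw [Pi.single_eq_same, map_one, mul_one, mul_eq_zero] at h1
      exact h1.resolve_left (pow_ne_zero _ (neg_ne_zero.2 one_ne_zero))
    · intro j _ hj
      rw [Pi.single_eq_of_ne, map_zero, mul_zero]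
      exact fun h => hj (Fin.rev_injective h)
    · exact fun h => absurd (Finset.mem_univ i) h

end Form

section Consequences

variable {F R : Type*} [Field F] [CommRing R] [Algebra F R] {σ : F →+* F} {τ : R →+* R}
  {V : Type*} [AddCommGroup V] [Module F V] [Finite F] [Finite V] {h : V → V → F}

theorem IsHerm.mult_add_mapDomain_submodule_le [Module R V] [IsScalarTower F R V]
    [IsSemisimpleModule R V] (hS : IsSesqPair (F := F) σ τ) (hH : IsHerm (R := R) σ τ h)
    (U : Submodule R V) (hU : ∀ x ∈ U, ∀ y ∈ U, h x y = 0) :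
    mult R U + (mult R U).mapDomain hS.tauMax ≤ mult R V :=
  (hH.mult_add_mapDomain_le hS (φ := U.subtype) U.injective_subtype
    fun x y => hU x x.2 y y.2).1

theorem IsHerm.mapDomain_mult [Module R V] [IsScalarTower F R V] [IsSemisimpleModule R V]
    (hS : IsSesqPair (F := F) σ τ) (hH : IsHerm (R := R) σ τ h) :
    (mult R V).mapDomain hS.tauMax = mult R V :=
  (hH.mult_add_mapDomain_le hS (φ := (⊥ : Submodule R V).subtype) (injective_subtype _)
    fun x y => by
      rw [Subsingleton.elim x 0, map_zero]
      exact hH.zero_left _).2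

/-- Hermitian spaces of the same dimension over a finite field are isometric. -/
theorem IsHerm.exists_isometry {V' : Type*} [AddCommGroup V'] [Module F V'] [Finite V']
    {h' : V' → V' → F} (hS : IsSesqPair (F := F) σ σ) (hH : IsHerm (R := F) σ σ h)
    (hH' : IsHerm (R := F) σ σ h') (hdim : finrank F V = finrank F V') :
    ∃ e : V ≃ₗ[F] V', ∀ x y, h' (e x) (e y) = h x y := by
  obtain ⟨e, he, -⟩ := hH.exists_isometry_comp_eq hS hH'
    (φ := (⊥ : Submodule F V).subtype) (injective_subtype _)
    (fun x y => by
      rw [Subsingleton.elim x 0, map_zero]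
      exact hH.zero_left _) (φ' := 0) (fun x y _ => Subsingleton.elim x y)
    (fun x y => hH'.zero_left _) (mult_congr (LinearEquiv.ofFinrankEq V V' hdim))
  exact ⟨e, he⟩

end Consequences

/-! ### The general unitary group. -/

section Unitary

variable {F : Type u} [Field F] {q r n : ℕ} {c : F} {σ : F →+* F}

theorem isHerm_repModule_GU (hH : IsHerm (R := F) σ σ (hermForm q n c))
    (X : Multiplicative (Fin r → ℤ) →* GU q n c) :
    IsHerm (R := GroupAlg F r) σ (algInv _ σ)
      (fun u v : RepModule ((GU q n c).subtype.comp X) =>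
        hermForm q n c (repEquiv _ u) (repEquiv _ v)) :=
  hH.repModule fun a u v => (X a).2 u v

theorem lt_top_of_isotropic (hH : IsHerm (R := F) σ σ (hermForm q n c))
    {U : Submodule F (Fin n → F)} (h0 : ⊥ < U)
    (hi : ∀ u ∈ U, ∀ v ∈ U, hermForm q n c u v = 0) : U < ⊤ := by
  rw [lt_top_iff_ne_top]
  rintro rfl
  obtain ⟨v, -, hv⟩ := (Submodule.ne_bot_iff _).1 h0.ne'
  exact hv (hH.nondeg v fun w => hi v mem_top w mem_top)

/-- The subspace of vectors orthogonal to a given subspace. -/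
def orthSubspace (hH : IsHerm (R := F) σ σ (hermForm q n c)) (U : Submodule F (Fin n → F)) :
    Submodule F (Fin n → F) where
  carrier := {v | ∀ x ∈ U, hermForm q n c x v = 0}
  add_mem' {v w} hv hw x hx := by rw [hH.add_right, hv x hx, hw x hx, add_zero]
  zero_mem' x _ := hH.zero_right x
  smul_mem' a v hv x hx := by rw [hH.smul_right, hv x hx, mul_zero]

theorem map_orthSubspace (hH : IsHerm (R := F) σ σ (hermForm q n c)) (g : GU q n c)
    {U : Submodule F (Fin n → F)} (hU : U.map (g.1 : (Fin n → F) →ₗ[F] (Fin n → F)) = U) :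
    (orthSubspace hH U).map (g.1 : (Fin n → F) →ₗ[F] (Fin n → F)) = orthSubspace hH U := by
  ext v
  constructor
  · rintro ⟨w, hw, rfl⟩ x hx
    rw [← hU] at hx
    obtain ⟨y, hy, rfl⟩ := hx
    exact (g.2 y w).trans (hw y hy)
  · intro hv
    refine ⟨g.1.symm v, fun x hx => ?_, g.1.apply_symm_apply v⟩
    have h1 : g.1 x ∈ U := hU ▸ mem_map_of_mem hx
    rw [← g.2 x, g.1.apply_symm_apply]
    exact hv _ h1

theorem map_subspace_of_commute (g : GU q n c) (X : Multiplicative (Fin r → ℤ) →* GU q n c)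
    (hg : ∀ z, Commute (X z) g) (z) : g.1 * (GU q n c).subtype.comp X z =
      (GU q n c).subtype.comp X z * g.1 := congrArg Subtype.val (hg z).symm

variable [Finite F]

/-- Let `N` be the radical of the form on the socle `S₀`. If it were zero, `S₀` would have an
orthogonal complement containing no simple submodule, so the module would be semisimple.
Intersecting with `N^⊥` keeps members nonzero, since they meet `S₀`, which lies in `N^⊥`. After this
retraction adding `N` preserves isotropy, and the second retraction leaves a poset with least
element `N`. -/
theorem reducedEulerChar_fixed_eq_zero_unitary (hσσ : ∀ x, σ (σ x) = x) (hne : ∃ x, σ x ≠ x)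
    (hH : IsHerm (R := F) σ σ (hermForm q n c)) {X : Multiplicative (Fin r → ℤ) →* GU q n c}
    (hX : ¬ IsSemisimpleHom (GU q n c).subtype X) {g : GU q n c} (hg : ∀ z, Commute (X z) g) :
    reducedEulerChar {x : IsotropicPoset q n c // (∀ z, X z • x = x) ∧ g • x = x} = 0 := by
  let Q := {x : IsotropicPoset q n c // (∀ z, X z • x = x) ∧ g • x = x}
  let Y := (GU q n c).subtype.comp X
  let S₀ := subspace Y (socle (GroupAlg F r) (RepModule Y))
  let N := S₀ ⊓ orthSubspace hH S₀
  have hS := isSesqPair_algInv (A := Multiplicative (Fin r → ℤ)) hσσ hne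
  have hHY := isHerm_repModule_GU hH X
  have hSX : ∀ z, S₀.map ((X z).1 : (Fin n → F) →ₗ[F] (Fin n → F)) = S₀ := map_subspace Y _
  have hSg : S₀.map (g.1 : (Fin n → F) →ₗ[F] (Fin n → F)) = S₀ :=
    map_subspace_socle Y g.1 (map_subspace_of_commute g X hg)
  have hmapinf : ∀ (g : GU q n c) (U U' : Submodule F (Fin n → F)),
      U.map (g.1 : (Fin n → F) →ₗ[F] (Fin n → F)) = U →
      U'.map (g.1 : (Fin n → F) →ₗ[F] (Fin n → F)) = U' →
      (U ⊓ U').map (g.1 : (Fin n → F) →ₗ[F] (Fin n → F)) = U ⊓ U' := by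
    intro g U U' h h'
    rw [Submodule.map_inf _ g.1.injective, h, h']
  have hNX : ∀ z, N.map ((X z).1 : (Fin n → F) →ₗ[F] (Fin n → F)) = N :=
    fun z => hmapinf _ _ _ (hSX z) (map_orthSubspace hH _ (hSX z))
  have hNg : N.map (g.1 : (Fin n → F) →ₗ[F] (Fin n → F)) = N :=
    hmapinf _ _ _ hSg (map_orthSubspace hH _ hSg)
  have hNi : ∀ u ∈ N, ∀ v ∈ N, hermForm q n c u v = 0 := fun u hu v hv => hv.2 u hu.1
  have hN0 : ⊥ < N := by
    rw [bot_lt_iff_ne_bot]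
    intro hN
    apply hX
    apply isSemisimpleModule_of_socle_eq_top
    have h1 : Disjoint (socle (GroupAlg F r) (RepModule Y)) (hHY.perp hS (socle _ _)) := by
      rw [disjoint_iff, eq_bot_iff]
      rintro v ⟨hv, hv'⟩
      have h2 : repEquiv Y v ∈ N := by
        refine ⟨mem_subspace.2 hv, ?_⟩
        rintro _ ⟨w, hw, rfl⟩
        exact hv' w hw
      rw [hN, mem_bot, LinearEquiv.map_eq_zero_iff] at h2
      exact h2
    have h2 := hHY.isCompl_perp hS h1
    by_contra h3
    have h4 : hHY.perp hS (socle _ _) ≠ ⊥ := by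
      intro h5
      rw [h5] at h2
      exact h3 (by simpa using h2.sup_eq_top)
    apply inf_socle_ne_bot h4
    rw [inf_comm, h1.eq_bot]
  have hxX : ∀ x : Q, ∀ z, x.1.1.map ((X z).1 : (Fin n → F) →ₗ[F] (Fin n → F)) = x.1.1 :=
    fun x z => congrArg Subtype.val (x.2.1 z)
  have hxg : ∀ x : Q, x.1.1.map (g.1 : (Fin n → F) →ₗ[F] (Fin n → F)) = x.1.1 :=
    fun x => congrArg Subtype.val x.2.2
  let mk : ∀ U : Submodule F (Fin n → F), ⊥ < U → (∀ u ∈ U, ∀ v ∈ U, hermForm q n c u v = 0) →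
      (∀ z, U.map ((X z).1 : (Fin n → F) →ₗ[F] (Fin n → F)) = U) →
      U.map (g.1 : (Fin n → F) →ₗ[F] (Fin n → F)) = U → Q := fun U h0 hi hX hg =>
    ⟨⟨U, h0, lt_top_of_isotropic hH h0 hi, hi⟩, fun z => Subtype.ext (hX z), Subtype.ext hg⟩
  have hf0 : ∀ x : Q, ⊥ < x.1.1 ⊓ orthSubspace hH N := by
    intro x
    have h1 : x.1.1 ⊓ S₀ ≤ x.1.1 ⊓ orthSubspace hH N := by
      refine inf_le_inf_left _ fun v hv w hw => ?_
      exact hH.eq_zero_comm (hw.2 v hv)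
    refine lt_of_lt_of_le ?_ h1
    have h2 := bot_lt_subspace (inf_socle_ne_bot (bot_lt_genSub Y x.1.2.1).ne')
    rwa [subspace_inf, subspace_genSub (hxX x)] at h2
  let f : Q → Q := fun x => mk (x.1.1 ⊓ orthSubspace hH N) (hf0 x)
    (fun u hu v hv => x.1.2.2.2 u hu.1 v hv.1)
    (fun z => hmapinf _ _ _ (hxX x z) (map_orthSubspace hH _ (hNX z)))
    (hmapinf _ _ _ (hxg x) (map_orthSubspace hH _ hNg))
  have hf : ∀ x, (f x).1.1 = x.1.1 ⊓ orthSubspace hH N := fun _ => rfl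
  have hidem : ∀ x, f (f x) = f x := fun x => by
    refine Subtype.ext (Subtype.ext ?_)
    rw [hf, hf, inf_assoc, inf_idem]
  change reducedEulerChar Q = 0
  rw [reducedEulerChar_retract_of_le f (fun x y h => ?_) (fun x => ?_) hidem]
  rotate_left
  · change (f x).1.1 ≤ (f y).1.1
    rw [hf, hf]
    exact inf_le_inf_right _ h
  · change (f x).1.1 ≤ x.1.1
    rw [hf]
    exact inf_le_left
  have hNorth : N ≤ orthSubspace hH N := fun v hv x hx => hNi x hx v hv
  have hQ' : ∀ x : {x // f x = x}, x.1.1.1 ≤ orthSubspace hH N := fun x => by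
    have h1 := hf x.1
    rw [x.2] at h1
    exact h1.le.trans inf_le_right
  have hsupi : ∀ x : {x // f x = x}, ∀ u ∈ x.1.1.1 ⊔ N, ∀ v ∈ x.1.1.1 ⊔ N,
      hermForm q n c u v = 0 := by
    intro x u hu v hv
    obtain ⟨u₁, hu₁, u₂, hu₂, rfl⟩ := mem_sup.1 hu
    obtain ⟨v₁, hv₁, v₂, hv₂, rfl⟩ := mem_sup.1 hv
    rw [hH.add_left, hH.add_right, hH.add_right, x.1.1.2.2.2 u₁ hu₁ v₁ hv₁, hNi u₂ hu₂ v₂ hv₂,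
      hQ' x hv₁ u₂ hu₂, hH.eq_zero_comm (hQ' x hu₁ v₂ hv₂), add_zero, add_zero]
  let k : {x // f x = x} → {x // f x = x} := fun x =>
    ⟨mk (x.1.1.1 ⊔ N) (lt_of_lt_of_le hN0 le_sup_right) (hsupi x)
      (fun z => by rw [Submodule.map_sup, hxX, hNX]) (by rw [Submodule.map_sup, hxg, hNg]),
      Subtype.ext (Subtype.ext (inf_eq_left.2 (sup_le (hQ' x) hNorth)))⟩
  have hk : ∀ x, (k x).1.1.1 = x.1.1.1 ⊔ N := fun _ => rfl
  rw [reducedEulerChar_retract_of_ge k (fun x y h => ?_) (fun x => ?_) (fun x => ?_)]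
  rotate_left
  · change (k x).1.1.1 ≤ (k y).1.1.1
    rw [hk, hk]
    exact sup_le_sup_right h _
  · change x.1.1.1 ≤ (k x).1.1.1
    rw [hk]
    exact le_sup_left
  · refine Subtype.ext (Subtype.ext (Subtype.ext ?_))
    rw [hk, hk, sup_assoc, sup_idem]
  refine reducedEulerChar_eq_zero_of_isLeast
    ⟨⟨mk N hN0 hNi hNX hNg, Subtype.ext (Subtype.ext (inf_eq_left.2 hNorth))⟩,
      Subtype.ext (Subtype.ext (Subtype.ext (sup_idem N)))⟩ fun x => ?_
  change N ≤ x.1.1.1.1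
  have h1 := hk x.1
  rw [x.2] at h1
  rw [h1]
  exact le_sup_right

instance finite_isotropic {I : Type*} (t : I → I) (M : I →₀ ℕ) :
    Finite {N : I →₀ ℕ // N ≠ 0 ∧ N + N.mapDomain t ≤ M} := by
  classical
  exact ((Set.finite_Iic M).subset fun N hN => le_self_add.trans hN.2).to_subtype

open scoped Classical in
/-- The equivariant Euler characteristic of the general unitary group as a sum over multiplicities
of maximal ideals. -/
theorem chiGU_succ_eq_sum (hS : IsSesqPair (F := F) σ (algInv (Multiplicative (Fin r → ℤ)) σ))
    (hH : IsHerm (R := F) σ σ (hermForm q n c)) (Ms : Finset (MaximalSpectrum (GroupAlg F r) →₀ ℕ))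
    (hMs : ∀ M, M ∈ Ms ↔ M.mapDomain hS.tauMax = M ∧ weight (degree F) M = n) :
    chiGU (r + 1) q n c = ((∑ M ∈ Ms, reducedEulerChar
      {N : MaximalSpectrum (GroupAlg F r) →₀ ℕ // N ≠ 0 ∧ N + N.mapDomain hS.tauMax ≤ M} : ℤ) :
      ℚ) := by
  obtain ⟨Z, hZ, hsum⟩ := exists_finset_chains Ms
    (fun M N : MaximalSpectrum (GroupAlg F r) →₀ ℕ => N ≠ 0 ∧ N + N.mapDomain hS.tauMax ≤ M)
  rw [chiGU, ← hsum]
  have hfix : ∀ (X : Multiplicative (Fin r → ℤ) →* GU q n c)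
      (x : IsotropicPoset q n c), (∀ z, X z • x = x) → ∀ z,
        x.1.map ((GU q n c).subtype.comp X z : (Fin n → F) →ₗ[F] (Fin n → F)) = x.1 :=
    fun X x hx z => congrArg Subtype.val (hx z)
  have hgen : ∀ (X : Multiplicative (Fin r → ℤ) →* GU q n c)
      (x : IsotropicPoset q n c), (∀ z, X z • x = x) →
      ∀ u ∈ genSub ((GU q n c).subtype.comp X) x.1, ∀ v ∈ genSub ((GU q n c).subtype.comp X) x.1,
        hermForm q n c (repEquiv _ u) (repEquiv _ v) = 0 := by
    intro X x hx u hu v hv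
    rw [mem_genSub (hfix X x hx)] at hu hv
    exact x.2.2.2 _ hu _ hv
  refine equivariantEulerChar_eq_sum_mult (P := IsotropicPoset q n c) (GU q n c).subtype
    Subtype.val_injective (fun x => x.1) (fun _ _ => Iff.rfl) (fun _ _ => rfl)
    (fun X hX g hg => reducedEulerChar_fixed_eq_zero_unitary hS.sigma_sigma hS.sigma_ne hH hX hg)
    Z (fun X c' hc' => ?_) (fun z hz => ?_) (fun X c₁ X' c₂ hc₁ hc₂ he => ?_)
  · have : IsSemisimpleModule (GroupAlg F r) (RepModule ((GU q n c).subtype.comp X)) := hc'.1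
    have hHY := isHerm_repModule_GU hH X
    refine (hZ _).2 ⟨(hMs _).2 ⟨?_, ?_⟩, ?_, fun N hN => ?_⟩
    · exact hHY.mapDomain_mult hS
    · change weight _ (mult _ _) = n
      rw [← finrank_eq_weight_mult, (repEquiv _).finrank_eq, finrank_fin_fun]
    · exact isChain_finset_image hc'.2.1 fun x y h => mult_mono (genSub_le_genSub h)
    · obtain ⟨x, hx, rfl⟩ := Finset.mem_image.1 hN
      refine ⟨fun h => (bot_lt_genSub _ x.2.1).ne' (mult_eq_zero_iff.1 h), ?_⟩
      exact hHY.mult_add_mapDomain_submodule_le hS _ (hgen X x (hc'.2.2 x hx))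
  · obtain ⟨M, C⟩ := z
    obtain ⟨hM, hC, hQ⟩ := (hZ _).1 hz
    obtain ⟨hMτ, hMw⟩ := (hMs M).1 hM
    obtain ⟨N₀, hN₀, hN₀max⟩ : ∃ N₀ : MaximalSpectrum (GroupAlg F r) →₀ ℕ,
        N₀ + N₀.mapDomain hS.tauMax ≤ M ∧ ∀ N ∈ C, N ≤ N₀ := by
      rcases C.eq_empty_or_nonempty with rfl | hne
      · exact ⟨0, by simp, by simp⟩
      · obtain ⟨N₀, hN₀, hmax⟩ := exists_greatest_of_isChain hC hne
        exact ⟨N₀, (hQ N₀ hN₀).2, hmax⟩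
    -- Take a model whose isotropic submodule accommodates the top of the chain. Hermitian spaces of
    -- equal dimension are isometric, so the model can be carried to the given form. There the group
    -- acts by isometries because the involution inverts group elements.
    obtain ⟨W, hWM, hWN⟩ := hS.exists_hermModel finite_quotient_groupAlg hMτ hN₀
    have hdim : finrank F W.V = finrank F (Fin n → F) := by
      rw [finrank_eq_weight_mult (R := GroupAlg F r), hWM, hMw, finrank_fin_fun]
    obtain ⟨e, he⟩ := (W.herm.restrictScalars hS.sigma_sigma).exists_isometry
      (isSesqPair_self hS.sigma_sigma hS.sigma_ne) hH hdim
    obtain ⟨X₀, f, hf⟩ := exists_hom_of_module (A := Multiplicative (Fin r → ℤ)) e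
    have hX₀ : ∀ z, X₀ z ∈ GU q n c := by
      intro z u v
      obtain ⟨u, rfl⟩ := e.surjective u
      obtain ⟨v, rfl⟩ := e.surjective v
      rw [← hf, ← hf, ← repEquiv_smul, ← repEquiv_smul, ← map_smul, ← map_smul, hf, hf, hf, hf,
        he, he, W.herm.adj, smul_smul, MonoidAlgebra.of_apply, algInv_single, map_one,
        MonoidAlgebra.single_mul_single, inv_mul_cancel, mul_one, ← MonoidAlgebra.one_def,
        one_smul]
    let X : Multiplicative (Fin r → ℤ) →* GU q n c := X₀.codRestrict _ hX₀
    have hX : IsSemisimpleModule (GroupAlg F r) (RepModule X₀) := IsSemisimpleModule.congr f.symm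
    have hXM : mult (GroupAlg F r) (RepModule X₀) = M := (mult_congr f).symm.trans hWM
    obtain ⟨s, hs, hs'⟩ := exists_chain_mult_eq (V := W.U) C hC
      fun N hN => hWN ▸ hN₀max N hN
    let s' : (MaximalSpectrum (GroupAlg F r) →₀ ℕ) → Submodule (GroupAlg F r) (RepModule X₀) :=
      fun N => ((s N).map W.U.subtype).map (f : W.V →ₗ[GroupAlg F r] RepModule X₀)
    have hs1 : ∀ N ∈ C, mult (GroupAlg F r) (s' N) = N := by
      intro N hN
      rw [← mult_congr (f.submoduleMap ((s N).map W.U.subtype)), mult_map_subtype, hs N hN]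
    have hP : ∀ N ∈ C, ∃ x : IsotropicPoset q n c, x.1 = subspace X₀ (s' N) := by
      intro N hN
      have h0 : ⊥ < subspace X₀ (s' N) := bot_lt_subspace fun h =>
        (hQ N hN).1 ((hs1 N hN).symm.trans ((mult_eq_of_eq h).trans mult_bot))
      have hi : ∀ u ∈ subspace X₀ (s' N), ∀ v ∈ subspace X₀ (s' N), hermForm q n c u v = 0 := by
        rintro _ ⟨_, ⟨_, ⟨u, -, rfl⟩, rfl⟩, rfl⟩ _ ⟨_, ⟨_, ⟨v, -, rfl⟩, rfl⟩, rfl⟩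
        change hermForm q n c (repEquiv X₀ (f u)) (repEquiv X₀ (f v)) = 0
        rw [hf, hf, he]
        exact W.isotropic _ u.2 _ v.2
      exact ⟨⟨_, h0, lt_top_of_isotropic hH h0 hi, hi⟩, rfl⟩
    obtain ⟨c', hc', hcC⟩ := exists_fixedChain (P := IsotropicPoset q n c) (GU q n c).subtype
      (fun x => x.1) (fun _ _ => Iff.rfl) (fun _ _ => rfl) X hX C hC s' hs1
      (fun N hN N' hN' h => map_mono (map_mono (hs' N hN N' hN' h))) hP
    exact ⟨X, c', hc', Prod.ext hXM hcC⟩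
  · have : IsSemisimpleModule (GroupAlg F r) (RepModule ((GU q n c).subtype.comp X)) := hc₁.1
    have : IsSemisimpleModule (GroupAlg F r) (RepModule ((GU q n c).subtype.comp X')) := hc₂.1
    have him := congrArg Prod.snd he
    -- Injectivity of the invariant: Witt's theorem for chains yields an isometry, which is the
    -- required element of the unitary group.
    obtain ⟨f, hiso, hf⟩ := (isHerm_repModule_GU hH X).exists_isometry_map_chain hS
      (isHerm_repModule_GU hH X') (congrArg Prod.fst he) _ _
      (isChain_image_genSub ((GU q n c).subtype.comp X) (val := fun x : IsotropicPoset q n c => x.1)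
        (fun _ _ => Iff.rfl) hc₁.2.1)
      (isChain_image_genSub ((GU q n c).subtype.comp X')
        (val := fun x : IsotropicPoset q n c => x.1) (fun _ _ => Iff.rfl) hc₂.2.1)
      (fun U hU => by
        obtain ⟨x, hx, rfl⟩ := Finset.mem_image.1 hU
        exact hgen X x (hc₁.2.2 x hx))
      (fun U hU => by
        obtain ⟨x, hx, rfl⟩ := Finset.mem_image.1 hU
        exact hgen X' x (hc₂.2.2 x hx)) (by
        rw [Finset.image_image, Finset.image_image]
        exact him)
    refine ⟨⟨(repEquiv _).symm.trans ((f.restrictScalars F).trans (repEquiv _)), fun u v => ?_⟩, f,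
      fun v => ?_, fun x hx x' hx' h => hf (genSub ((GU q n c).subtype.comp X) x.1)
        (Finset.mem_image.2 ⟨x, hx, rfl⟩) (genSub ((GU q n c).subtype.comp X') x'.1)
        (Finset.mem_image.2 ⟨x', hx', rfl⟩) h⟩
    · refine (hiso _ _).trans ?_
      exact congrArg₂ (hermForm q n c) (LinearEquiv.apply_symm_apply _ u)
        (LinearEquiv.apply_symm_apply _ v)
    · change _ = repEquiv _ (f ((repEquiv _).symm (repEquiv _ v)))
      rw [LinearEquiv.symm_apply_apply]

end Unitary

/-! ### Counting multiplicity functions by weight. -/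

section Counting

variable {I : Type*} {w : I → ℕ} {t : I → I}

theorem weight_mono {N M : I →₀ ℕ} (h : N ≤ M) : weight w N ≤ weight w M := by
  obtain ⟨L, rfl⟩ := le_iff_exists_add.1 h
  rw [weight_add]
  exact Nat.le_add_right _ _

theorem weight_nsmul (j : ℕ) (N : I →₀ ℕ) : weight w (j • N) = j * weight w N := by
  induction j with
  | zero => rw [zero_smul, weight_zero, zero_mul]
  | succ j ih => rw [succ_nsmul, weight_add, ih, add_mul, one_mul]

theorem weight_mapDomain (hwt : ∀ i, w (t i) = w i) (N : I →₀ ℕ) :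
    weight w (N.mapDomain t) = weight w N := by
  induction N using Finsupp.induction_linear with
  | zero => rw [Finsupp.mapDomain_zero]
  | add N N' h h' => rw [Finsupp.mapDomain_add, weight_add, weight_add, h, h']
  | single i k => rw [Finsupp.mapDomain_single, weight_single, weight_single, hwt]

theorem weight_eq_sum_of_subset {J : Finset I} {M : I →₀ ℕ} (h : M.support ⊆ J) :
    weight w M = ∑ i ∈ J, M i * w i :=
  Finsupp.sum_of_support_subset M h _ fun _ _ => zero_mul _

theorem eq_zero_of_weight_eq_zero (hw : ∀ i, 0 < w i) {N : I →₀ ℕ} (h : weight w N = 0) :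
    N = 0 := by
  ext i
  have h1 : Finsupp.single i (N i) ≤ N := by
    rw [Finsupp.single_le_iff]
  have h2 := weight_mono (w := w) h1
  rw [weight_single, h, Nat.le_zero, mul_eq_zero] at h2
  exact h2.resolve_right (hw i).ne'

variable (w t) in
/-- The multiplicity functions of a given weight invariant under an involution. -/
def symSet (n : ℕ) : Set (I →₀ ℕ) := {M | M.mapDomain t = M ∧ weight w M = n}

theorem finite_symSet (hw : ∀ i, 0 < w i) (hfin : ∀ n, {i | w i ≤ n}.Finite) (n : ℕ) :
    (symSet w t n).Finite := by
  classical
  refine (Set.finite_Iic (Finsupp.indicator (hfin n).toFinset fun _ _ => n)).subset ?_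
  rintro M ⟨-, hM⟩ i
  have h1 : Finsupp.single i (M i) ≤ M := by
    rw [Finsupp.single_le_iff]
  have h2 := weight_mono (w := w) h1
  rw [weight_single, hM] at h2
  by_cases h3 : M i = 0
  · rw [h3]
    exact Nat.zero_le _
  · have h4 : w i ≤ n := (Nat.le_mul_of_pos_left _ (Nat.pos_of_ne_zero h3)).trans h2
    rw [Finsupp.indicator_of_mem ((hfin n).mem_toFinset.2 h4)]
    exact (Nat.le_mul_of_pos_right _ (hw i)).trans h2

open scoped Classical in
variable (w t) in
/-- The finite set of invariant multiplicity functions of a given weight. -/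
noncomputable def symFinset (n : ℕ) : Finset (I →₀ ℕ) :=
  if h : (symSet w t n).Finite then h.toFinset else ∅

theorem mem_symFinset (hw : ∀ i, 0 < w i) (hfin : ∀ n, {i | w i ≤ n}.Finite) {n : ℕ}
    {M : I →₀ ℕ} : M ∈ symFinset w t n ↔ M.mapDomain t = M ∧ weight w M = n := by
  rw [symFinset, dif_pos (finite_symSet hw hfin n), Set.Finite.mem_toFinset]
  rfl

theorem mem_symFinset_id (hw : ∀ i, 0 < w i) (hfin : ∀ n, {i | w i ≤ n}.Finite) {n : ℕ}
    {M : I →₀ ℕ} : M ∈ symFinset w id n ↔ weight w M = n := by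
  rw [mem_symFinset hw hfin, Finsupp.mapDomain_id]
  simp

theorem symFinset_zero (hw : ∀ i, 0 < w i) (hfin : ∀ n, {i | w i ≤ n}.Finite) :
    symFinset w t 0 = {0} := by
  ext M
  rw [mem_symFinset hw hfin, Finset.mem_singleton]
  constructor
  · exact fun h => eq_zero_of_weight_eq_zero hw h.2
  · rintro rfl
    exact ⟨Finsupp.mapDomain_zero, weight_zero w⟩

open scoped Classical in
variable (w t) in
/-- The weight of an orbit of the involution. -/
noncomputable def orbitWeight (i : I) : ℕ := if t i = i then w i else 2 * w i

open scoped Classical in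
variable (t) in
/-- The indicator function of an orbit of the involution. -/
noncomputable def orbitFun (i : I) : I →₀ ℕ :=
  if t i = i then Finsupp.single i 1 else Finsupp.single i 1 + Finsupp.single (t i) 1

theorem weight_orbitFun (hwt : ∀ i, w (t i) = w i) (i : I) :
    weight w (orbitFun t i) = orbitWeight w t i := by
  rw [orbitFun, orbitWeight]
  split_ifs
  · rw [weight_single, one_mul]
  · rw [weight_add, weight_single, weight_single, hwt, one_mul, two_mul]

theorem mapDomain_orbitFun (ht : Function.Involutive t) (i : I) :
    (orbitFun t i).mapDomain t = orbitFun t i := by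
  rw [orbitFun]
  split_ifs with h
  · rw [Finsupp.mapDomain_single, h]
  · rw [Finsupp.mapDomain_add, Finsupp.mapDomain_single, Finsupp.mapDomain_single, ht, add_comm]

theorem nsmul_orbitFun_le_iff (ht : Function.Involutive t) {M : I →₀ ℕ} (hM : M.mapDomain t = M)
    (i : I) (j : ℕ) : j • orbitFun t i ≤ M ↔ j ≤ M i := by
  classical
  have h1 : M (t i) = M i := by
    conv_lhs => rw [← hM, Finsupp.mapDomain_apply ht.injective]
  constructor
  · intro h
    refine le_trans ?_ (h i)
    rw [orbitFun]
    split_ifs with h2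
    · simp
    · simp [h2]
  · intro h l
    rw [orbitFun]
    split_ifs with h2
    · rw [Finsupp.smul_apply, Finsupp.single_apply]
      split_ifs with h3
      · rw [← h3]
        simpa using h
      · simp
    · rw [Finsupp.smul_apply, Finsupp.add_apply, Finsupp.single_apply, Finsupp.single_apply]
      split_ifs with h3 h4 h4
      · exact absurd (h4.trans h3.symm) h2
      · rw [← h3]
        simpa using h
      · rw [← h4, h1]
        simpa using h
      · simp

theorem mapDomain_of_add (N L : I →₀ ℕ) (hN : N.mapDomain t = N)
    (h : (N + L).mapDomain t = N + L) : L.mapDomain t = L := by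
  rw [Finsupp.mapDomain_add, hN] at h
  exact add_left_cancel h

/-- Subtracting `j` copies of the orbit of `i` is a bijection which lowers the weight by `j` times
the orbit weight. -/
theorem card_filter_le_apply (hw : ∀ i, 0 < w i) (hfin : ∀ n, {i | w i ≤ n}.Finite)
    (ht : Function.Involutive t) (hwt : ∀ i, w (t i) = w i) {n j : ℕ} {i : I}
    (hj : orbitWeight w t i * j ≤ n) :
    ((symFinset w t n).filter fun M => j ≤ M i).card =
      (symFinset w t (n - orbitWeight w t i * j)).card := by
  refine (Finset.card_bij (fun M _ => j • orbitFun t i + M) ?_ ?_ ?_).symm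
  · intro M hM
    rw [mem_symFinset hw hfin] at hM
    have hsym : (j • orbitFun t i + M).mapDomain t = j • orbitFun t i + M := by
      rw [Finsupp.mapDomain_add, Finsupp.mapDomain_smul, mapDomain_orbitFun ht, hM.1]
    refine Finset.mem_filter.2 ⟨(mem_symFinset hw hfin).2 ⟨hsym, ?_⟩, ?_⟩
    · rw [weight_add, weight_nsmul, weight_orbitFun hwt, hM.2, mul_comm]
      omega
    · rw [← nsmul_orbitFun_le_iff ht hsym]
      exact le_self_add
  · intro M _ M' _ h
    exact add_left_cancel h
  · intro M hM
    obtain ⟨hM, hMj⟩ := Finset.mem_filter.1 hM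
    rw [mem_symFinset hw hfin] at hM
    obtain ⟨L, rfl⟩ := le_iff_exists_add.1 ((nsmul_orbitFun_le_iff ht hM.1 i j).2 hMj)
    refine ⟨L, (mem_symFinset hw hfin).2 ⟨mapDomain_of_add _ _ ?_ hM.1, ?_⟩, rfl⟩
    · rw [Finsupp.mapDomain_smul, mapDomain_orbitFun ht]
    · have := hM.2
      rw [weight_add, weight_nsmul, weight_orbitFun hwt, mul_comm] at this
      omega

theorem orbitWeight_pos (hw : ∀ i, 0 < w i) (i : I) : 0 < orbitWeight w t i := by
  have := hw i
  rw [orbitWeight]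
  split_ifs <;> omega

theorem le_orbitWeight (i : I) : w i ≤ orbitWeight w t i := by
  rw [orbitWeight]
  split_ifs <;> omega

/-- Double counting of the total weight of all invariant multiplicity functions. -/
theorem mul_card_symFinset (hw : ∀ i, 0 < w i) (hfin : ∀ n, {i | w i ≤ n}.Finite)
    (ht : Function.Involutive t) (hwt : ∀ i, w (t i) = w i) {c : ℕ → ℕ} (hc0 : c 0 = 0)
    (hc : ∀ k, 0 < k → c k = ∑ᶠ i ∈ {i | orbitWeight w t i ∣ k}, w i) (n : ℕ) :
    n * (symFinset w t n).card =
      ∑ p ∈ Finset.HasAntidiagonal.antidiagonal n, (symFinset w t p.1).card * c p.2 := by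
  classical
  let J := (hfin n).toFinset
  have hcJ : ∀ k ∈ Finset.Ioc 0 n, c k = ∑ i ∈ J with orbitWeight w t i ∣ k, w i := by
    intro k hk
    rw [Finset.mem_Ioc] at hk
    rw [hc k hk.1, ← finsum_mem_coe_finset]
    refine finsum_mem_congr (Set.ext fun i => ?_) fun _ _ => rfl
    simp only [Finset.coe_filter, J, Set.Finite.mem_toFinset]
    refine ⟨fun h => ⟨?_, h⟩, fun h => h.2⟩
    exact (le_orbitWeight i).trans ((Nat.le_of_dvd hk.1 h).trans hk.2)
  have h1 : n * (symFinset w t n).card = ∑ M ∈ symFinset w t n, ∑ i ∈ J, M i * w i := by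
    rw [mul_comm, ← smul_eq_mul, ← Finset.sum_const]
    refine Finset.sum_congr rfl fun M hM => ?_
    rw [mem_symFinset hw hfin] at hM
    rw [← weight_eq_sum_of_subset, hM.2]
    intro i hi
    rw [Finsupp.mem_support_iff] at hi
    have h2 : weight w (Finsupp.single i (M i)) ≤ n := by
      rw [← hM.2]
      refine weight_mono ?_
      rw [Finsupp.single_le_iff]
    rw [weight_single] at h2
    exact (hfin n).mem_toFinset.2 ((Nat.le_mul_of_pos_left _ (Nat.pos_of_ne_zero hi)).trans h2)
  -- `M i` counts the multiples `k` of the orbit weight whose quotient lies between 1 and `M i`.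
  -- With `k` as outer variable, the functions that contribute to a given `i` correspond to those of
  -- weight `n - k`.
  have h2 : ∀ M ∈ symFinset w t n, ∀ i ∈ J, M i * w i =
      ∑ k ∈ Finset.Ioc 0 n, if orbitWeight w t i ∣ k ∧ k / orbitWeight w t i ≤ M i then w i
        else 0 := by
    intro M hM i _
    rw [mem_symFinset hw hfin] at hM
    have hpos := orbitWeight_pos (t := t) hw i
    have h3 : M i * orbitWeight w t i ≤ n := by
      rw [← weight_orbitFun hwt, ← weight_nsmul, ← hM.2]
      exact weight_mono ((nsmul_orbitFun_le_iff ht hM.1 i _).2 le_rfl)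
    rw [← Finset.sum_filter, Finset.sum_const, smul_eq_mul]
    congr 1
    have h4 : (Finset.Ioc 0 n).filter (fun k => orbitWeight w t i ∣ k ∧
        k / orbitWeight w t i ≤ M i) =
        (Finset.Ioc 0 (M i * orbitWeight w t i)).filter (fun k => orbitWeight w t i ∣ k) := by
      ext k
      simp only [Finset.mem_filter, Finset.mem_Ioc]
      constructor
      · rintro ⟨⟨h5, h6⟩, h7, h8⟩
        refine ⟨⟨h5, ?_⟩, h7⟩
        rw [← Nat.div_mul_cancel h7]
        exact Nat.mul_le_mul_right _ h8
      · rintro ⟨⟨h5, h6⟩, h7⟩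
        exact ⟨⟨h5, h6.trans h3⟩, h7, Nat.div_le_of_le_mul (by rwa [mul_comm])⟩
    rw [h4, Nat.Ioc_filter_dvd_card_eq_div, Nat.mul_div_cancel _ hpos]
  rw [h1, Finset.sum_congr rfl fun M hM => Finset.sum_congr rfl (h2 M hM)]
  have h3 : ∑ M ∈ symFinset w t n, ∑ i ∈ J, ∑ k ∈ Finset.Ioc 0 n,
      (if orbitWeight w t i ∣ k ∧ k / orbitWeight w t i ≤ M i then w i else 0) =
      ∑ k ∈ Finset.Ioc 0 n, ∑ i ∈ J with orbitWeight w t i ∣ k,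
        w i * (symFinset w t (n - k)).card := by
    rw [Finset.sum_comm' (t' := J) (s' := fun _ => symFinset w t n) (by simp)]
    have h5 : ∀ i ∈ J, ∑ M ∈ symFinset w t n, ∑ k ∈ Finset.Ioc 0 n,
        (if orbitWeight w t i ∣ k ∧ k / orbitWeight w t i ≤ M i then w i else 0) =
        ∑ k ∈ Finset.Ioc 0 n, if orbitWeight w t i ∣ k then
          w i * (symFinset w t (n - k)).card else 0 := by
      intro i _
      rw [Finset.sum_comm]
      refine Finset.sum_congr rfl fun k hk => ?_
      rw [Finset.mem_Ioc] at hk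
      split_ifs with h6
      · have h7 := card_filter_le_apply hw hfin ht hwt (n := n) (i := i)
          (j := k / orbitWeight w t i) (by rw [Nat.mul_div_cancel' h6]; exact hk.2)
        rw [Nat.mul_div_cancel' h6] at h7
        rw [← h7, mul_comm, ← smul_eq_mul, ← Finset.sum_const, Finset.sum_filter]
        simp only [h6, true_and]
      · simp [h6]
    rw [Finset.sum_congr rfl h5, Finset.sum_comm]
    exact Finset.sum_congr rfl fun k _ => (Finset.sum_filter _ _).symm
  rw [h3, ← Finset.Nat.sum_antidiagonal_swap, Finset.Nat.sum_antidiagonal_eq_sum_range_succ_mk,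
    Finset.sum_range_succ']
  simp only [Prod.fst_swap, Prod.snd_swap, hc0, mul_zero, add_zero]
  have h6 : Finset.Ioc 0 n = (Finset.range n).map ⟨(· + 1), add_left_injective 1⟩ := by
    ext k
    simp only [Finset.mem_Ioc, Finset.mem_map, Finset.mem_range, Function.Embedding.coeFn_mk]
    constructor
    · rintro ⟨h, h'⟩
      exact ⟨k - 1, by omega, by omega⟩
    · rintro ⟨a, ha, rfl⟩
      omega
  rw [h6, Finset.sum_map]
  refine Finset.sum_congr rfl fun k hk => ?_
  rw [Finset.mem_range] at hk
  simp only [Function.Embedding.coeFn_mk]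
  rw [← Finset.sum_mul, ← hcJ (k + 1) (Finset.mem_Ioc.2 ⟨by omega, by omega⟩), mul_comm]

end Counting

/-! ### Recursions for the Euler characteristics. -/

section Recursion

variable {I : Type*} {w : I → ℕ} {t : I → I}

/-- Summing over all ways of subtracting from an invariant multiplicity function. -/
theorem sum_symFinset_shift {w' : I → ℕ} (hw : ∀ i, 0 < w i) (hfin : ∀ n, {i | w i ≤ n}.Finite)
    (hw' : ∀ i, 0 < w' i) (hfin' : ∀ n, {i | w' i ≤ n}.Finite) (u : (I →₀ ℕ) → (I →₀ ℕ))
    (hu : ∀ N, (u N).mapDomain t = u N) (huw : ∀ N, weight w (u N) = weight w' N)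
    (D : (I →₀ ℕ) → Finset (I →₀ ℕ)) (hD : ∀ M N, N ∈ D M ↔ u N ≤ M) (f : (I →₀ ℕ) → ℤ) (n : ℕ) :
    ∑ M ∈ symFinset w t n, ∑ N ∈ D M, f (M - u N) =
      ∑ p ∈ Finset.HasAntidiagonal.antidiagonal n,
        ((symFinset w' id p.1).card : ℤ) * ∑ M ∈ symFinset w t p.2, f M := by
  have h1 : ∀ p ∈ Finset.HasAntidiagonal.antidiagonal n,
      ((symFinset w' id p.1).card : ℤ) * ∑ M ∈ symFinset w t p.2, f M =
        ∑ y ∈ symFinset w' id p.1 ×ˢ symFinset w t p.2, f y.2 := by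
    intro p _
    rw [Finset.sum_product]
    simp only [Finset.sum_const, nsmul_eq_mul]
  rw [Finset.sum_congr rfl h1, Finset.sum_sigma', Finset.sum_sigma']
  refine Finset.sum_bij' (fun x _ => ⟨(weight w' x.2, weight w (x.1 - u x.2)), (x.2, x.1 - u x.2)⟩)
    (fun y _ => ⟨u y.2.1 + y.2.2, y.2.1⟩) ?_ ?_ ?_ ?_ ?_
  · rintro ⟨M, N⟩ h
    obtain ⟨hM, hN⟩ := Finset.mem_sigma.1 h
    rw [mem_symFinset hw hfin] at hM
    obtain ⟨L, rfl⟩ := le_iff_exists_add.1 ((hD M N).1 hN)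
    rw [weight_add, huw] at hM
    simp only [add_tsub_cancel_left, Finset.mem_sigma, Finset.HasAntidiagonal.mem_antidiagonal,
      Finset.mem_product]
    exact ⟨hM.2, (mem_symFinset_id hw' hfin').2 rfl,
      (mem_symFinset hw hfin).2 ⟨mapDomain_of_add _ _ (hu N) hM.1, rfl⟩⟩
  · rintro ⟨⟨a, b⟩, ⟨N, L⟩⟩ h
    simp only [Finset.mem_sigma, Finset.HasAntidiagonal.mem_antidiagonal, Finset.mem_product] at h
    obtain ⟨hab, hN, hL⟩ := h
    rw [mem_symFinset_id hw' hfin'] at hN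
    rw [mem_symFinset hw hfin] at hL
    refine Finset.mem_sigma.2 ⟨(mem_symFinset hw hfin).2 ⟨?_, ?_⟩, (hD _ _).2 le_self_add⟩
    · rw [Finsupp.mapDomain_add, hu, hL.1]
    · rw [weight_add, huw, hN, hL.2, hab]
  · rintro ⟨M, N⟩ h
    obtain ⟨hM, hN⟩ := Finset.mem_sigma.1 h
    simp only [add_tsub_cancel_of_le ((hD M N).1 hN)]
  · rintro ⟨⟨a, b⟩, ⟨N, L⟩⟩ h
    simp only [Finset.mem_sigma, Finset.HasAntidiagonal.mem_antidiagonal, Finset.mem_product] at h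
    obtain ⟨hab, hN, hL⟩ := h
    rw [mem_symFinset_id hw' hfin'] at hN
    rw [mem_symFinset hw hfin] at hL
    simp only [add_tsub_cancel_left, hN, hL.2]
  · rintro ⟨M, N⟩ _
    rfl

open scoped Classical in
/-- The finite set of functions `N` with `u N` below a given function. -/
noncomputable def belowFinset (u : (I →₀ ℕ) → (I →₀ ℕ)) (M : I →₀ ℕ) : Finset (I →₀ ℕ) :=
  (Set.finite_Iic M).toFinset.filter fun N => u N ≤ M

theorem mem_belowFinset {u : (I →₀ ℕ) → (I →₀ ℕ)} (hu : ∀ N, N ≤ u N) {M N : I →₀ ℕ} :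
    N ∈ belowFinset u M ↔ u N ≤ M := by
  simp only [belowFinset, Finset.mem_filter, Set.Finite.mem_toFinset, Set.mem_Iic,
    and_iff_right_iff_imp]
  exact (hu N).trans

/-- Isotropic multiplicities above a given one. -/
noncomputable def aboveIsoIsotropic {M x : I →₀ ℕ} (hx : x ≠ 0 ∧ x + x.mapDomain t ≤ M) :
    {z : I →₀ ℕ // z ≠ 0 ∧ z + z.mapDomain t ≤ M - (x + x.mapDomain t)} ≃o
      {y : {y : I →₀ ℕ // y ≠ 0 ∧ y + y.mapDomain t ≤ M} // ⟨x, hx⟩ < y} where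
  toFun z := ⟨⟨x + z.1, fun h => hx.1 (add_eq_zero.1 h).1, by
      have := (le_tsub_iff_left hx.2).1 z.2.2
      rwa [Finsupp.mapDomain_add, add_add_add_comm]⟩,
    show x < x + z.1 from lt_add_of_pos_right x (pos_iff_ne_zero.2 z.2.1)⟩
  invFun y := ⟨y.1.1 - x, fun h => (show x < y.1.1 from y.2).not_ge (tsub_eq_zero_iff_le.1 h), by
    obtain ⟨⟨y, hy⟩, hxy⟩ := y
    obtain ⟨z, rfl⟩ := le_iff_exists_add.1 (show x ≤ y from hxy.le)
    have h := hy.2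
    rw [Finsupp.mapDomain_add, add_add_add_comm] at h
    simp only [add_tsub_cancel_left]
    exact (le_tsub_iff_left hx.2).2 h⟩
  left_inv z := Subtype.ext (add_tsub_cancel_left _ _)
  right_inv y := Subtype.ext (Subtype.ext (add_tsub_cancel_of_le (show x ≤ y.1.1 from y.2.le)))
  map_rel_iff' := add_le_add_iff_left x

theorem add_lt_iff_lt_tsub {x z M : I →₀ ℕ} (h : x ≤ M) : x + z < M ↔ z < M - x := by
  obtain ⟨L, rfl⟩ := le_iff_exists_add.1 h
  rw [add_tsub_cancel_left, add_lt_add_iff_left]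

/-- Intermediate multiplicities above a given one. -/
noncomputable def aboveIsoBetween {M x : I →₀ ℕ} (hx : x ≠ 0 ∧ x < M) :
    {z : I →₀ ℕ // z ≠ 0 ∧ z < M - x} ≃o
      {y : {y : I →₀ ℕ // y ≠ 0 ∧ y < M} // ⟨x, hx⟩ < y} where
  toFun z := ⟨⟨x + z.1, fun h => hx.1 (add_eq_zero.1 h).1, (add_lt_iff_lt_tsub hx.2.le).2 z.2.2⟩,
    show x < x + z.1 from lt_add_of_pos_right x (pos_iff_ne_zero.2 z.2.1)⟩
  invFun y := ⟨y.1.1 - x, fun h => (show x < y.1.1 from y.2).not_ge (tsub_eq_zero_iff_le.1 h), by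
    rw [← add_lt_iff_lt_tsub hx.2.le, add_tsub_cancel_of_le (show x ≤ y.1.1 from y.2.le)]
    exact y.1.2.2⟩
  left_inv z := Subtype.ext (add_tsub_cancel_left _ _)
  right_inv y := Subtype.ext (Subtype.ext (add_tsub_cancel_of_le (show x ≤ y.1.1 from y.2.le)))
  map_rel_iff' := add_le_add_iff_left x

variable (t) in
/-- The negated Euler characteristic of the poset of isotropic multiplicities. -/
noncomputable def isotropicEuler (M : I →₀ ℕ) : ℤ :=
  -reducedEulerChar {z : I →₀ ℕ // z ≠ 0 ∧ z + z.mapDomain t ≤ M}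

/-- This is the recursion `reducedEulerChar_eq_sum_gt`: subtracting `x` identifies the elements
above `x` with the poset of `M - (x + x.mapDomain t)`, and the term `N = 0` is the whole poset. -/
theorem sum_isotropicEuler (M : I →₀ ℕ) :
    ∑ N ∈ belowFinset (fun N => N + N.mapDomain t) M,
      isotropicEuler t (M - (N + N.mapDomain t)) = 1 := by
  classical
  have := Fintype.ofFinite {z : I →₀ ℕ // z ≠ 0 ∧ z + z.mapDomain t ≤ M}
  have h0 : (0 : I →₀ ℕ) ∈ belowFinset (fun N => N + N.mapDomain t) M :=
    (mem_belowFinset fun _ => le_self_add).2 (by simp)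
  rw [← Finset.add_sum_erase _ _ h0, Finsupp.mapDomain_zero, add_zero, tsub_zero]
  have h1 : ∑ N ∈ (belowFinset (fun N => N + N.mapDomain t) M).erase 0,
      isotropicEuler t (M - (N + N.mapDomain t)) =
      ∑ x : {z : I →₀ ℕ // z ≠ 0 ∧ z + z.mapDomain t ≤ M}, -reducedEulerChar {y // x < y} := by
    rw [Finset.sum_subtype (p := fun z : I →₀ ℕ => z ≠ 0 ∧ z + z.mapDomain t ≤ M) _ (fun N => by
      rw [Finset.mem_erase, mem_belowFinset fun _ => le_self_add])]
    refine Finset.sum_congr rfl fun x _ => ?_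
    rw [isotropicEuler, reducedEulerChar_congr (aboveIsoIsotropic x.2)]
  rw [h1, isotropicEuler, reducedEulerChar_eq_sum_gt, Finset.sum_neg_distrib]
  ring

open scoped Classical in
/-- The Möbius function of the poset of multiplicities. -/
noncomputable def multMoebius (M : I →₀ ℕ) : ℤ :=
  if M = 0 then 1 else reducedEulerChar {z : I →₀ ℕ // z ≠ 0 ∧ z < M}

/-- The same recursion for an open interval: `N = 0` contributes the interval itself, and `N = M`
the value 1 assigned to the zero function. -/
theorem sum_multMoebius {M : I →₀ ℕ} (hM : M ≠ 0) :
    ∑ N ∈ belowFinset id M, multMoebius (M - id N) = 0 := by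
  classical
  have := Fintype.ofFinite {z : I →₀ ℕ // z ≠ 0 ∧ z < M}
  have h0 : (0 : I →₀ ℕ) ∈ belowFinset id M :=
    (mem_belowFinset (u := id) fun _ => le_rfl).2 zero_le
  have hMM : M ∈ (belowFinset id M).erase 0 :=
    Finset.mem_erase.2 ⟨hM, (mem_belowFinset (u := id) fun _ => le_rfl).2 le_rfl⟩
  rw [← Finset.add_sum_erase _ _ h0, ← Finset.add_sum_erase _ _ hMM]
  have h1 : ∑ N ∈ ((belowFinset id M).erase 0).erase M, multMoebius (M - id N) =
      ∑ x : {z : I →₀ ℕ // z ≠ 0 ∧ z < M}, reducedEulerChar {y // x < y} := by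
    rw [Finset.sum_subtype (p := fun z : I →₀ ℕ => z ≠ 0 ∧ z < M) _ (fun N => by
      rw [Finset.mem_erase, Finset.mem_erase, mem_belowFinset (u := id) fun _ => le_rfl, lt_iff_le_and_ne,
        id]
      tauto)]
    refine Finset.sum_congr rfl fun x _ => ?_
    rw [multMoebius, if_neg, id]
    · exact reducedEulerChar_congr (aboveIsoBetween x.2)
    · rw [id, tsub_eq_zero_iff_le]
      exact x.2.2.not_ge
  rw [h1, id, id, tsub_zero, tsub_self, multMoebius, multMoebius, if_neg hM, if_pos rfl,
    reducedEulerChar_eq_sum_gt]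
  ring

/-- The generating function of the Möbius numbers inverts that of the multiplicities. -/
theorem sum_card_mul_sum_multMoebius (hw : ∀ i, 0 < w i) (hfin : ∀ n, {i | w i ≤ n}.Finite)
    (n : ℕ) : ∑ p ∈ Finset.HasAntidiagonal.antidiagonal n, ((symFinset w id p.1).card : ℤ) *
      ∑ M ∈ symFinset w id p.2, multMoebius M = if n = 0 then 1 else 0 := by
  rw [← sum_symFinset_shift hw hfin hw hfin id (fun N => Finsupp.mapDomain_id) (fun _ => rfl)
    (belowFinset id) (fun M N => mem_belowFinset (u := id) fun _ => le_rfl)]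
  split_ifs with hn
  · subst hn
    rw [symFinset_zero hw hfin, Finset.sum_singleton]
    have h1 : belowFinset id (0 : I →₀ ℕ) = {0} := by
      ext N
      rw [mem_belowFinset (u := id) fun _ => le_rfl, Finset.mem_singleton, id, nonpos_iff_eq_zero]
    rw [h1, Finset.sum_singleton, id, tsub_zero, multMoebius, if_pos rfl]
  · refine Finset.sum_eq_zero fun M hM => sum_multMoebius ?_
    rintro rfl
    rw [mem_symFinset_id hw hfin, weight_zero] at hM
    exact hn hM.symm

/-- The generating function of the isotropic Euler characteristics divides that of the invariant
multiplicities. -/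
theorem sum_card_mul_sum_isotropic (hw : ∀ i, 0 < w i) (hfin : ∀ n, {i | w i ≤ n}.Finite)
    (ht : Function.Involutive t) (hwt : ∀ i, w (t i) = w i) (n : ℕ) :
    ∑ p ∈ Finset.HasAntidiagonal.antidiagonal n,
      ((symFinset (fun i => 2 * w i) id p.1).card : ℤ) * ∑ M ∈ symFinset w t p.2, isotropicEuler t M =
      (symFinset w t n).card := by
  rw [← sum_symFinset_shift hw hfin (w' := fun i => 2 * w i) (fun i => by simp [hw i])
    (fun n => (hfin n).subset fun i hi => ?_) (fun N => N + N.mapDomain t) (fun N => ?_)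
    (fun N => ?_) (belowFinset _) (fun M N => mem_belowFinset fun _ => le_self_add)]
  · rw [Finset.sum_congr rfl fun M _ => sum_isotropicEuler M, Finset.sum_const,
      nsmul_eq_mul, mul_one]
  · simp only [Set.mem_ofPred_eq] at hi ⊢
    omega
  · rw [Finsupp.mapDomain_add, ← Finsupp.mapDomain_comp, ht.comp_self, Finsupp.mapDomain_id,
      add_comm]
  · rw [weight_add, weight_mapDomain hwt]
    induction N using Finsupp.induction_linear with
    | zero => rw [weight_zero, weight_zero]
    | add N N' h h' => rw [weight_add, weight_add, ← h, ← h']; ring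
    | single i k => rw [weight_single, weight_single]; ring

end Recursion

/-- Frobenius iterated `l * k` times, where `q = p ^ l`; the field `F` fixes the characteristic to
be `p`. -/
theorem exists_pow_ringHom (F : Type*) [Field F] [Finite F] {E : Type*} [CommRing E] [Nontrivial E]
    [Algebra F E] {q s : ℕ} (hq : IsPrimePow q) (hs : s ≠ 0) (hF : Nat.card F = q ^ s) (k : ℕ) :
    ∃ φ : E →+* E, ∀ x, φ x = x ^ q ^ k := by
  obtain ⟨p, l, hp, hl, rfl⟩ := hq
  rw [← Nat.prime_iff] at hp
  have : CharP F p := by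
    have := Fintype.ofFinite F
    obtain ⟨p', hp'⟩ := CharP.exists F
    obtain ⟨n, hp'', hn⟩ := FiniteField.card F p'
    rw [← Nat.card_eq_fintype_card, hF, ← pow_mul] at hn
    have h1 : p = p' := (Nat.prime_dvd_prime_iff_eq hp hp'').1
      (hp.dvd_of_dvd_pow (hn ▸ dvd_pow_self p (by positivity)))
    exact h1 ▸ hp'
  have : CharP E p := charP_of_injective_algebraMap' F p
  have : ExpChar E p := ExpChar.prime hp
  exact ⟨iterateFrobenius E p (l * k), fun x => by rw [iterateFrobenius_def, pow_mul]⟩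

/-! ### Involutions of finite residue fields. -/

section ResidueFields

variable {F E : Type*} [Field F] [Finite F] [CommRing E] [Algebra F E] [Finite E]

theorem natCard_algHom_of_isField (hE : IsField E) (L : Type*) [Field L] [Algebra F L]
    [IsAlgClosed L] : Nat.card (E →ₐ[F] L) = finrank F E := by
  let _ := hE.toField
  rw [← AlgHom.card F E L, Nat.card_eq_fintype_card]

/-- The Frobenius automorphism over `F` has order equal to the degree. -/
theorem forall_pow_eq_self_iff (hE : IsField E) (k : ℕ) :
    (∀ y : E, y ^ (Nat.card F ^ k) = y) ↔ finrank F E ∣ k := by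
  let _ := hE.toField
  have := Fintype.ofFinite F
  rw [← FiniteField.orderOf_frobeniusAlgHom F E, orderOf_dvd_iff_pow_eq_one, DFunLike.ext_iff,
    Nat.card_eq_fintype_card]
  refine forall_congr' fun y => ?_
  have h : (FiniteField.frobeniusAlgHom F E ^ k) y = y ^ (Fintype.card F ^ k) := by
    rw [AlgHom.coe_pow, FiniteField.coe_frobeniusAlgHom, pow_iterate]
  rw [h]
  rfl

variable {q : ℕ} {α : E →+* E}

/-- On `F` the composite is the power map with exponent `q ^ (k + 1)`. As `k` is odd, this is a
power of the order of `F`, so scalars are fixed. -/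
theorem exists_algHom_pow [Nontrivial E] (hq : IsPrimePow q) (hF : Nat.card F = q ^ 2)
    (hαF : ∀ a : F, α (algebraMap F E a) = algebraMap F E (a ^ q)) {k : ℕ} (hk : Odd k) :
    ∃ β : E →ₐ[F] E, ∀ y, β y = α (y ^ q ^ k) := by
  obtain ⟨φ, hφ⟩ := exists_pow_ringHom F (E := E) hq two_ne_zero hF k
  refine ⟨{ α.comp φ with commutes' := fun a => ?_ }, fun y => congrArg α (hφ y)⟩
  change α (φ (algebraMap F E a)) = _
  rw [hφ, ← map_pow, hαF]
  congr 1
  obtain ⟨j, rfl⟩ := hk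
  rw [← pow_mul, ← pow_succ, show 2 * j + 1 + 1 = 2 * (j + 1) by ring, pow_mul, ← hF]
  have := Fintype.ofFinite F
  rw [Nat.card_eq_fintype_card, FiniteField.pow_card_pow]

theorem exists_eq_frobenius_pow (hE : IsField E) (β : E →ₐ[F] E) :
    ∃ j : ℕ, ∀ y, β y = y ^ (Nat.card F ^ j) := by
  let _ := hE.toField
  have := Fintype.ofFinite F
  obtain ⟨j, hj⟩ := (FiniteField.bijective_frobeniusAlgHom_pow F E).2 β
  refine ⟨j, fun y => ?_⟩
  rw [← hj, Nat.card_eq_fintype_card]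
  simp only [AlgHom.coe_pow, FiniteField.coe_frobeniusAlgHom, pow_iterate]

theorem pow_card_injective (hE : IsField E) (j : ℕ) :
    Function.Injective fun y : E => y ^ (Nat.card F ^ j) := by
  let _ := hE.toField
  have := Fintype.ofFinite F
  have h := (FiniteField.frobeniusAlgHom F E ^ j).toRingHom.injective
  intro x y hxy
  apply h
  change (FiniteField.frobeniusAlgHom F E ^ j) x = (FiniteField.frobeniusAlgHom F E ^ j) y
  rw [AlgHom.coe_pow, FiniteField.coe_frobeniusAlgHom, pow_iterate, ← Nat.card_eq_fintype_card]
  exact hxy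

/-- A self-dual residue field has odd degree. -/
theorem odd_finrank_of_involution (hE : IsField E) (hq : IsPrimePow q) (hF : Nat.card F = q ^ 2)
    (hα : ∀ x, α (α x) = x) (hαF : ∀ a : F, α (algebraMap F E a) = algebraMap F E (a ^ q)) :
    Odd (finrank F E) := by
  have : Nontrivial E := hE.nontrivial
  obtain ⟨β, hβ⟩ := exists_algHom_pow hq hF hαF odd_one
  obtain ⟨j, hj⟩ := exists_eq_frobenius_pow hE β
  -- `β` combines `α` with the `q`-power map. Its square no longer involves `α` and is Frobenius
  -- itself, so the degree divides `2 * j - 1`. The case `j = 0` is separate because subtraction is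
  -- truncated.
  have h1 : ∀ y : E, y ^ (Nat.card F ^ (2 * j)) = y ^ Nat.card F := by
    intro y
    rw [two_mul, pow_add, pow_mul, ← hj, ← hj, hβ, hβ, ← map_pow, hα, pow_one, ← pow_mul, hF, sq]
  rcases Nat.eq_zero_or_pos j with rfl | hj0
  · have h2 : finrank F E ∣ 1 := (forall_pow_eq_self_iff hE 1).1 fun y => by
      rw [pow_one, ← h1, mul_zero, pow_zero, pow_one]
    rw [Nat.dvd_one.1 h2]
    exact odd_one
  · have h2 : finrank F E ∣ 2 * j - 1 := (forall_pow_eq_self_iff hE (2 * j - 1)).1 fun y => by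
      apply pow_card_injective (F := F) hE 1
      change (y ^ Nat.card F ^ (2 * j - 1)) ^ Nat.card F ^ 1 = y ^ Nat.card F ^ 1
      rw [← pow_mul, ← pow_add, Nat.sub_add_cancel (by omega), h1, pow_one]
    exact Odd.of_dvd_nat (by rw [Nat.odd_iff]; omega) h2

/-- The involution of a self-dual residue field is a power of Frobenius. -/
theorem involution_eq_pow (hE : IsField E) (hq : IsPrimePow q) (hF : Nat.card F = q ^ 2)
    (hα : ∀ x, α (α x) = x) (hαF : ∀ a : F, α (algebraMap F E a) = algebraMap F E (a ^ q)) {k : ℕ}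
    (hk : Odd k) (hdk : finrank F E ∣ k) (y : E) : α y = y ^ q ^ k := by
  have : Nontrivial E := hE.nontrivial
  obtain ⟨β, hβ⟩ := exists_algHom_pow hq hF hαF hk
  obtain ⟨j, hj⟩ := exists_eq_frobenius_pow hE β
  have hk' := (forall_pow_eq_self_iff hE k).2 hdk
  -- The square of `β` is the `k`-th power of Frobenius, which is trivial since the degree divides
  -- `k`. The degree is odd, so `β` itself is trivial; evaluating it at `α y` gives the claim.
  have h1 : finrank F E ∣ 2 * j := (forall_pow_eq_self_iff hE (2 * j)).1 fun y => by
    rw [two_mul, pow_add, pow_mul, ← hj, ← hj, hβ, hβ, ← map_pow, hα, ← pow_mul, ← pow_add,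
      ← two_mul, pow_mul, ← hF, hk']
  have h2 : finrank F E ∣ j :=
    (Nat.Coprime.dvd_mul_left (Nat.coprime_two_right.2 (Odd.of_dvd_nat hk hdk))).1 h1
  have h3 := (forall_pow_eq_self_iff hE j).2 h2 (α y)
  rw [← hj, hβ, map_pow, hα] at h3
  exact h3.symm

end ResidueFields

/-! ### Geometric points and maximal ideals. -/

section Points

variable {F R : Type*} [Field F] [Finite F] [CommRing R] [Algebra F R] (L : Type*) [Field L]
  [Algebra F L] [IsAlgClosed L] [Algebra.IsAlgebraic F L]

variable {L} in
theorem isMaximal_ker_algHom (χ : R →ₐ[F] L) : (RingHom.ker χ).IsMaximal := by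
  have h1 : IsField χ.range := Subalgebra.isField_of_algebraic _
  have h2 : IsField (R ⧸ RingHom.ker χ) :=
    MulEquiv.isField h1 (Ideal.quotientKerEquivRange χ).toMulEquiv
  exact Ideal.Quotient.maximal_of_isField _ h2

variable {L} in
/-- The maximal ideal of a geometric point. -/
def pointIdeal (χ : R →ₐ[F] L) : MaximalSpectrum R := ⟨RingHom.ker χ, isMaximal_ker_algHom χ⟩

theorem isField_quotient (m : MaximalSpectrum R) : IsField (R ⧸ m.asIdeal) :=
  (Ideal.Quotient.maximal_ideal_iff_isField_quotient m.asIdeal).1 m.isMaximal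

/-- Points with kernel `m` are embeddings of the residue field into `L`; by separability there are
as many of them as its degree. -/
theorem natCard_pointIdeal_eq (m : MaximalSpectrum R) [Finite (R ⧸ m.asIdeal)] :
    Nat.card {χ : R →ₐ[F] L // pointIdeal χ = m} = degree F m := by
  rw [degree, ← natCard_algHom_of_isField (isField_quotient m) L]
  refine Nat.card_congr ⟨fun χ => Ideal.Quotient.liftₐ m.asIdeal χ.1 fun a ha => ?_,
    fun ψ => ⟨ψ.comp (Ideal.Quotient.mkₐ F m.asIdeal), ?_⟩, fun χ => ?_, fun ψ => ?_⟩
  · have := χ.2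
    rw [← this] at ha
    exact ha
  · have hinj : Function.Injective ψ := by
      let _ := (isField_quotient m).toField
      exact ψ.toRingHom.injective
    ext x
    change ψ (Ideal.Quotient.mk m.asIdeal x) = 0 ↔ _
    rw [map_eq_zero_iff ψ hinj, Ideal.Quotient.eq_zero_iff_mem]
  · apply Subtype.ext
    ext x
    rfl
  · ext x
    obtain ⟨x, rfl⟩ := Ideal.Quotient.mk_surjective x
    rfl

/-- Counting geometric points by their maximal ideals. -/
theorem finite_and_natCard_points (hfin : ∀ m : MaximalSpectrum R, Finite (R ⧸ m.asIdeal))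
    {C : (R →ₐ[F] L) → Prop} {T : MaximalSpectrum R → Prop} (hCT : ∀ χ, C χ ↔ T (pointIdeal χ))
    [Finite {χ // C χ}] :
    {m | T m}.Finite ∧ Nat.card {χ // C χ} = ∑ᶠ m ∈ {m | T m}, degree F m := by
  have hpos : ∀ m : MaximalSpectrum R, 0 < degree F m := by
    intro m
    have := (isField_quotient m).nontrivial
    have := hfin m
    exact Module.finrank_pos
  have hsurj : ∀ m, T m → ∃ χ : {χ : R →ₐ[F] L // C χ}, pointIdeal χ.1 = m := by
    intro m hm
    have := hfin m
    have h1 := hpos m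
    rw [← natCard_pointIdeal_eq L m] at h1
    obtain ⟨⟨χ, hχ⟩⟩ := (Nat.card_pos_iff.1 h1).1
    exact ⟨⟨χ, (hCT χ).2 (hχ ▸ hm)⟩, hχ⟩
  have hT : {m | T m}.Finite := by
    refine (Set.finite_range fun χ : {χ : R →ₐ[F] L // C χ} => pointIdeal χ.1).subset ?_
    intro m hm
    exact hsurj m hm
  refine ⟨hT, ?_⟩
  have := hT.fintype
  have e : {χ : R →ₐ[F] L // C χ} ≃ Σ m : {m | T m}, {χ : R →ₐ[F] L // pointIdeal χ = m} :=
    { toFun := fun χ => ⟨⟨pointIdeal χ.1, (hCT _).1 χ.2⟩, ⟨χ.1, rfl⟩⟩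
      invFun := fun y => ⟨y.2.1, (hCT _).2 (by rw [y.2.2]; exact y.1.2)⟩
      left_inv := fun χ => rfl
      right_inv := by
        rintro ⟨⟨m, hm⟩, ⟨χ, hχ⟩⟩
        dsimp at hχ
        subst hχ
        rfl }
  have hfin' : ∀ m : {m | T m}, Finite {χ : R →ₐ[F] L // pointIdeal χ = m} := fun m =>
    Nat.finite_of_card_ne_zero (by
      have := hfin m
      rw [natCard_pointIdeal_eq]
      exact (hpos _).ne')
  rw [Nat.card_congr e, Nat.card_sigma, ← finsum_set_coe_eq_finsum_mem, finsum_eq_sum_of_fintype]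
  refine Finset.sum_congr rfl fun m _ => ?_
  have := hfin m
  exact natCard_pointIdeal_eq L _

end Points

/-! ### Torsion points of the split torus. -/

section HomCount

theorem hom_ext_of_single {r : ℕ} {G : Type*} [Group G] {X Y : Multiplicative (Fin r → ℤ) →* G}
    (h : ∀ i, X (Multiplicative.ofAdd (Pi.single i 1)) = Y (Multiplicative.ofAdd (Pi.single i 1))) :
    X = Y := by
  let S : AddSubgroup (Fin r → ℤ) := Subgroup.toAddSubgroup' (X.eqLocus Y)
  have hS : ∀ z : Fin r → ℤ, z ∈ S := by
    intro z
    rw [← Finset.univ_sum_single z]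
    refine sum_mem fun i _ => ?_
    have hi : Pi.single i (z i) = z i • (Pi.single i 1 : Fin r → ℤ) := by
      rw [← Pi.single_smul, smul_eq_mul, mul_one]
    rw [hi]
    exact S.zsmul_mem (h i) _
  exact MonoidHom.ext fun z => hS z.toAdd

/-- The homomorphism from `ℤ^r` to a commutative group with given values on the basis. -/
def homOfBasis {r : ℕ} {G : Type*} [CommGroup G] (y : Fin r → G) :
    Multiplicative (Fin r → ℤ) →* G where
  toFun a := ∏ i, y i ^ a.toAdd i
  map_one' := by simp
  map_mul' a b := by simp [zpow_add, Finset.prod_mul_distrib]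

theorem homOfBasis_single {r : ℕ} {G : Type*} [CommGroup G] (y : Fin r → G) (i : Fin r) :
    homOfBasis y (Multiplicative.ofAdd (Pi.single i 1)) = y i := by
  change ∏ j, y j ^ (Pi.single i 1 : Fin r → ℤ) j = y i
  rw [Finset.prod_eq_single i]
  · simp
  · intro j _ hj
    rw [Pi.single_eq_of_ne hj, zpow_zero]
  · simp

variable {F L : Type*} [Field F] [Field L] [Algebra F L] {r : ℕ}

/-- A point is given by its values on a basis of ℤ^r, here arbitrary `N`-th roots of unity, and
there are exactly `N` of these since `N` is nonzero in `L`. -/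
theorem natCard_algHom_pow_eq_one [IsAlgClosed L] {N : ℕ} (hN : (N : L) ≠ 0) :
    Nat.card {χ : GroupAlg F r →ₐ[F] L // ∀ a, χ (MonoidAlgebra.of F _ a) ^ N = 1} = N ^ r := by
  have : NeZero (N : L) := ⟨hN⟩
  have : NeZero N := ⟨by rintro rfl; simp at hN⟩
  have hroots : Nat.card (rootsOfUnity N L) = N := HasEnoughRootsOfUnity.natCard_rootsOfUnity L N
  let e : {χ : GroupAlg F r →ₐ[F] L // ∀ a, χ (MonoidAlgebra.of F _ a) ^ N = 1} →
      (Fin r → rootsOfUnity N L) := fun χ i =>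
    rootsOfUnity.mkOfPowEq (χ.1 (MonoidAlgebra.of F _ (Multiplicative.ofAdd (Pi.single i 1))))
      (χ.2 _)
  have he : Function.Bijective e := by
    constructor
    · intro χ ψ h
      apply Subtype.ext
      refine MonoidAlgebra.algHom_ext (fun a => ?_) (by ext)
      have h1 : ((χ.1 : GroupAlg F r →* L).comp (MonoidAlgebra.of F _)).toHomUnits =
          ((ψ.1 : GroupAlg F r →* L).comp (MonoidAlgebra.of F _)).toHomUnits := by
        refine hom_ext_of_single fun i => Units.ext ?_
        have h2 := congrArg (fun x : rootsOfUnity N L => ((x : Lˣ) : L)) (congrFun h i)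
        exact h2
      exact congrArg Units.val (DFunLike.congr_fun h1 a)
    · intro y
      let X : Multiplicative (Fin r → ℤ) →* L :=
        (Units.coeHom L).comp ((rootsOfUnity N L).subtype.comp (homOfBasis y))
      have hX : ∀ a, MonoidAlgebra.lift F L _ X (MonoidAlgebra.of F _ a) = X a := fun a =>
        MonoidAlgebra.lift_of X a
      refine ⟨⟨MonoidAlgebra.lift F L _ X, fun a => ?_⟩, ?_⟩
      · rw [hX]
        exact rootsOfUnity.coe_pow (homOfBasis y a) N ▸ by
          have := (homOfBasis y a).2
          rw [mem_rootsOfUnity] at this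
          exact congrArg Units.val this
      · funext i
        apply Subtype.ext
        apply Units.ext
        refine (hX _).trans ?_
        change (((homOfBasis y (Multiplicative.ofAdd (Pi.single i 1)) : rootsOfUnity N L) : Lˣ) : L)
          = _
        rw [homOfBasis_single]
  rw [Nat.card_congr (Equiv.ofBijective e he), Nat.card_fun, hroots, Nat.card_eq_fintype_card,
    Fintype.card_fin]

/-- Both sides of the first equation are ring homomorphisms in `x` that agree on scalars, so it
suffices to compare them on group elements. -/
theorem pow_card_iff_of [Finite F] {q s : ℕ} (hq : IsPrimePow q) (hs : s ≠ 0)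
    (hF : Nat.card F = q ^ s) (k : ℕ) (χ : GroupAlg F r →ₐ[F] L) :
    (∀ x, χ x ^ (Nat.card F ^ k) = χ x) ↔
      ∀ a, χ (MonoidAlgebra.of F _ a) ^ (Nat.card F ^ k - 1) = 1 := by
  have hunit : ∀ a, χ (MonoidAlgebra.of F _ a) ≠ 0 := fun a =>
    (((Group.isUnit a).map (MonoidAlgebra.of F _)).map χ).ne_zero
  have hpos : Nat.card F ^ k ≠ 0 := pow_ne_zero _ Nat.card_pos.ne'
  constructor
  · intro h a
    apply mul_left_cancel₀ (hunit a)
    rw [mul_one, ← pow_succ', Nat.sub_add_cancel (Nat.pos_of_ne_zero hpos), h]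
  · intro h x
    obtain ⟨φ, hφ⟩ := exists_pow_ringHom F (E := L) hq hs hF (s * k)
    rw [pow_mul, ← hF] at hφ
    rw [← hφ]
    induction x using MonoidAlgebra.induction_on with
    | of a =>
      rw [hφ, ← Nat.sub_add_cancel (Nat.pos_of_ne_zero hpos), pow_succ, h, one_mul]
    | add x y hx hy => rw [map_add, map_add, hx, hy]
    | smul c x hx =>
      have := Fintype.ofFinite F
      rw [map_smul, Algebra.smul_def, map_mul, hx, hφ, ← map_pow, Nat.card_eq_fintype_card,
        FiniteField.pow_card_pow]

/-- On group elements, which `algInv` inverts, the relation reads `y⁻¹ = y ^ q ^ k`. On scalars it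
holds automatically because `k` is odd, so that the `q ^ k`-power map acts on `F` as `σ`. -/
theorem tau_pow_iff_of [Finite F] {q : ℕ} (hq : IsPrimePow q) (hF : Nat.card F = q ^ 2)
    {σ : F →+* F} (hσ : ∀ x, σ x = x ^ q) {k : ℕ} (hk : Odd k) (χ : GroupAlg F r →ₐ[F] L) :
    (∀ x, χ (algInv _ σ x) = χ x ^ q ^ k) ↔
      ∀ a, χ (MonoidAlgebra.of F _ a) ^ (q ^ k + 1) = 1 := by
  have hmul : ∀ a, χ (MonoidAlgebra.of F _ a) * χ (MonoidAlgebra.of F _ a⁻¹) = 1 := fun a => by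
    rw [← map_mul, ← map_mul, mul_inv_cancel, map_one, map_one]
  have hunit : ∀ a, χ (MonoidAlgebra.of F _ a) ≠ 0 := fun a => left_ne_zero_of_mul_eq_one (hmul a)
  have hinv : ∀ a, algInv _ σ (MonoidAlgebra.of F (Multiplicative (Fin r → ℤ)) a) =
      MonoidAlgebra.of F _ a⁻¹ := fun a => by
    rw [MonoidAlgebra.of_apply, algInv_single, map_one, MonoidAlgebra.of_apply]
  constructor
  · intro h a
    rw [pow_succ', ← h, hinv, hmul]
  · intro h x
    obtain ⟨φ, hφ⟩ := exists_pow_ringHom F (E := L) hq two_ne_zero hF k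
    rw [← hφ]
    induction x using MonoidAlgebra.induction_on with
    | of a =>
      apply mul_left_cancel₀ (hunit a)
      rw [hφ, ← pow_succ', h, hinv, hmul]
    | add x y hx hy => rw [map_add, map_add, map_add, map_add, hx, hy]
    | smul c x hx =>
      have h1 : algInv (Multiplicative (Fin r → ℤ)) σ (algebraMap F _ c) =
          algebraMap F _ (σ c) := by
        rw [MonoidAlgebra.coe_algebraMap]
        simp [algInv_single]
      rw [Algebra.smul_def, map_mul, map_mul, map_mul, map_mul, hx, h1, AlgHom.commutes,
        AlgHom.commutes, hσ]
      congr 1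
      obtain ⟨j, rfl⟩ := hk
      have := Fintype.ofFinite F
      rw [hφ, ← map_pow]
      congr 1
      rw [pow_succ, pow_mul q, ← hF, pow_mul, Nat.card_eq_fintype_card, FiniteField.pow_card_pow]

end HomCount

/-! ### Sums of residue degrees over maximal ideals. -/

section DegreeSums

variable {F : Type*} [Field F] [Finite F] {r : ℕ}

theorem isPrimePow_natCard (F : Type*) [Field F] [Finite F] : IsPrimePow (Nat.card F) := by
  have := Fintype.ofFinite F
  rw [Nat.card_eq_fintype_card]
  exact FiniteField.isPrimePow_card F

theorem cast_natCard_eq_zero (F L : Type*) [Field F] [Finite F] [Field L] [Algebra F L] :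
    ((Nat.card F : ℕ) : L) = 0 := by
  have := Fintype.ofFinite F
  rw [Nat.card_eq_fintype_card, ← map_natCast (algebraMap F L), FiniteField.cast_card_eq_zero,
    map_zero]

section Points

variable {R L : Type*} [CommRing R] [Algebra F R] [Field L] [Algebra F L] [IsAlgClosed L]
  [Algebra.IsAlgebraic F L]

theorem exists_injective_of_point (χ : R →ₐ[F] L) :
    ∃ ψ : R ⧸ (pointIdeal χ).asIdeal →ₐ[F] L, Function.Injective ψ ∧
      ∀ x, ψ (Ideal.Quotient.mk _ x) = χ x := by
  refine ⟨Ideal.Quotient.liftₐ _ χ fun a ha => ha, ?_, fun x => rfl⟩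
  let _ := (isField_quotient (pointIdeal χ)).toField
  exact (Ideal.Quotient.liftₐ (pointIdeal χ).asIdeal χ fun a ha => ha).toRingHom.injective

theorem forall_pow_card_eq_iff (χ : R →ₐ[F] L) [Finite (R ⧸ (pointIdeal χ).asIdeal)] (k : ℕ) :
    (∀ x, χ x ^ (Nat.card F ^ k) = χ x) ↔ degree F (pointIdeal χ) ∣ k := by
  obtain ⟨ψ, hψ, hχ⟩ := exists_injective_of_point χ
  rw [degree, ← forall_pow_eq_self_iff (isField_quotient _)]
  constructor
  · intro h y
    obtain ⟨x, rfl⟩ := Ideal.Quotient.mk_surjective y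
    apply hψ
    rw [map_pow, hχ, h]
  · intro h x
    rw [← hχ, ← map_pow, h]

variable {q : ℕ} {σ : F →+* F} {τ : R →+* R}

theorem IsSesqPair.exists_involution (hS : IsSesqPair (F := F) σ τ) (hσ : ∀ x, σ x = x ^ q)
    {m : MaximalSpectrum R} (hm : hS.tauMax m = m) :
    ∃ α : R ⧸ m.asIdeal →+* R ⧸ m.asIdeal, (∀ x, α (α x) = x) ∧
      (∀ a : F, α (algebraMap F _ a) = algebraMap F _ (a ^ q)) ∧
      ∀ x, α (Ideal.Quotient.mk _ x) = Ideal.Quotient.mk _ (τ x) := by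
  obtain ⟨α, -, hαF, -, hα⟩ := hS.exists_ringHom_quotient m.asIdeal m.asIdeal
    (congrArg MaximalSpectrum.asIdeal hm).symm
  refine ⟨α, fun x => ?_, fun a => ?_, hα⟩
  · obtain ⟨x, rfl⟩ := Ideal.Quotient.mk_surjective x
    rw [hα, hα, hS.tau_tau]
  · rw [Algebra.algebraMap_eq_smul_one, hαF, map_one, hσ, Algebra.algebraMap_eq_smul_one]

theorem IsSesqPair.odd_degree (hS : IsSesqPair (F := F) σ τ) (hσ : ∀ x, σ x = x ^ q)
    (hq : IsPrimePow q) (hF : Nat.card F = q ^ 2) {m : MaximalSpectrum R}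
    [Finite (R ⧸ m.asIdeal)] (hm : hS.tauMax m = m) : Odd (degree F m) := by
  obtain ⟨α, hα, hαF, -⟩ := hS.exists_involution hσ hm
  exact odd_finrank_of_involution (isField_quotient m) hq hF hα hαF

/-- Applying the relation twice gives invariance under the `k`-th power of Frobenius, hence the
divisibility. Conversely, `involution_eq_pow` identifies the involution of a self-dual residue field
with the `q ^ k`-power map. -/
theorem IsSesqPair.forall_tau_eq_iff (hS : IsSesqPair (F := F) σ τ) (hσ : ∀ x, σ x = x ^ q)
    (hq : IsPrimePow q) (hF : Nat.card F = q ^ 2) {k : ℕ} (hk : Odd k) (χ : R →ₐ[F] L)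
    [Finite (R ⧸ (pointIdeal χ).asIdeal)] :
    (∀ x, χ (τ x) = χ x ^ q ^ k) ↔
      hS.tauMax (pointIdeal χ) = pointIdeal χ ∧ degree F (pointIdeal χ) ∣ k := by
  have hq0 : q ≠ 0 := hq.ne_zero
  constructor
  · intro h
    constructor
    · ext x
      change χ (τ x) = 0 ↔ χ x = 0
      rw [h, pow_eq_zero_iff (pow_ne_zero _ hq0)]
    · rw [← forall_pow_card_eq_iff]
      intro x
      rw [hF, ← pow_mul, two_mul, pow_add, pow_mul, ← h, ← h, hS.tau_tau]
  · rintro ⟨h1, h2⟩ x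
    obtain ⟨ψ, -, hχ⟩ := exists_injective_of_point χ
    obtain ⟨α, hα, hαF, hmk⟩ := hS.exists_involution hσ h1
    have := involution_eq_pow (isField_quotient _) hq hF hα hαF hk h2
      (Ideal.Quotient.mk _ x)
    rw [← hχ, ← hχ, ← hmk, this, map_pow]

end Points

/-- `τ` induces a bijection of residue fields; it is not linear over `F`, so degrees are compared
through cardinalities. -/
theorem IsSesqPair.degree_tauMax {R : Type*} [CommRing R] [Algebra F R] {σ : F →+* F} {τ : R →+* R}
    (hS : IsSesqPair (F := F) σ τ) (hfin : ∀ m : MaximalSpectrum R, Finite (R ⧸ m.asIdeal))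
    (m : MaximalSpectrum R) : degree F (hS.tauMax m) = degree F m := by
  obtain ⟨α, hα, -⟩ := hS.exists_ringHom_quotient m.asIdeal (hS.tauMax m).asIdeal rfl
  have := hfin m
  have := hfin (hS.tauMax m)
  have h := Nat.card_congr (Equiv.ofBijective α hα)
  rw [Module.natCard_eq_pow_finrank (K := F) (V := R ⧸ m.asIdeal),
    Module.natCard_eq_pow_finrank (K := F) (V := R ⧸ (hS.tauMax m).asIdeal)] at h
  exact Nat.pow_right_injective (isPrimePow_natCard F).two_le h

theorem degree_pos (m : MaximalSpectrum (GroupAlg F r)) : 0 < degree F m := by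
  have := (isField_quotient m).nontrivial
  have := finite_quotient_groupAlg m
  exact Module.finrank_pos

/-- The sum counts points invariant under the `k`-th power of Frobenius, each ideal carrying as many
points as its degree. These are the torsion points for `|F| ^ k - 1`, which is prime to the
characteristic. -/
theorem finite_and_sum_degree {k : ℕ} (hk : 0 < k) :
    {m : MaximalSpectrum (GroupAlg F r) | degree F m ∣ k}.Finite ∧
      ∑ᶠ m ∈ {m : MaximalSpectrum (GroupAlg F r) | degree F m ∣ k}, degree F m =
        (Nat.card F ^ k - 1) ^ r := by
  let L := AlgebraicClosure F
  have hQ := isPrimePow_natCard F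
  have h1 : 1 < Nat.card F ^ k := Nat.one_lt_pow hk.ne' hQ.two_le
  have hN : ((Nat.card F ^ k - 1 : ℕ) : L) ≠ 0 := by
    rw [Nat.cast_sub h1.le, Nat.cast_pow, cast_natCard_eq_zero, zero_pow hk.ne']
    simp
  have hcard := natCard_algHom_pow_eq_one (F := F) (r := r) hN
  have : Finite {χ : GroupAlg F r →ₐ[F] L //
      ∀ a, χ (MonoidAlgebra.of F _ a) ^ (Nat.card F ^ k - 1) = 1} :=
    Nat.finite_of_card_ne_zero (by
      rw [hcard]
      exact pow_ne_zero _ (by omega))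
  have h := finite_and_natCard_points (F := F) (R := GroupAlg F r) L finite_quotient_groupAlg
    (C := fun χ => ∀ a, χ (MonoidAlgebra.of F _ a) ^ (Nat.card F ^ k - 1) = 1)
    (T := fun m => degree F m ∣ k) fun χ => by
      have := finite_quotient_groupAlg (pointIdeal χ)
      rw [← pow_card_iff_of hQ one_ne_zero (pow_one _).symm, forall_pow_card_eq_iff]
  rw [hcard] at h
  exact ⟨h.1, h.2.symm⟩

theorem finite_degree_le (n : ℕ) : {m : MaximalSpectrum (GroupAlg F r) | degree F m ≤ n}.Finite := by
  refine (finite_and_sum_degree (F := F) (r := r) n.factorial_pos).1.subset fun m hm => ?_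
  exact Nat.dvd_factorial (degree_pos m) hm

variable {q : ℕ} {σ : F →+* F}

/-- The sum counts points on which the involution acts as the `q ^ k`-power map, that is, points
with coordinates among the `(q ^ k + 1)`-st roots of unity. -/
theorem sum_degree_selfdual (hS : IsSesqPair (F := F) σ (algInv (Multiplicative (Fin r → ℤ)) σ))
    (hσ : ∀ x, σ x = x ^ q) (hq : IsPrimePow q) (hF : Nat.card F = q ^ 2) {k : ℕ} (hk : Odd k) :
    ∑ᶠ m ∈ {m | hS.tauMax m = m ∧ degree F m ∣ k}, degree F m = (q ^ k + 1) ^ r := by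
  let L := AlgebraicClosure F
  have hN : ((q ^ k + 1 : ℕ) : L) ≠ 0 := by
    have h := cast_natCard_eq_zero F L
    rw [hF, Nat.cast_pow, pow_eq_zero_iff two_ne_zero] at h
    rw [Nat.cast_add, Nat.cast_pow, h, zero_pow hk.pos.ne']
    simp
  have hcard := natCard_algHom_pow_eq_one (F := F) (r := r) hN
  have : Finite {χ : GroupAlg F r →ₐ[F] L //
      ∀ a, χ (MonoidAlgebra.of F _ a) ^ (q ^ k + 1) = 1} :=
    Nat.finite_of_card_ne_zero (by
      rw [hcard]
      exact pow_ne_zero _ (by omega))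
  have h := finite_and_natCard_points (F := F) (R := GroupAlg F r) L finite_quotient_groupAlg
    (C := fun χ => ∀ a, χ (MonoidAlgebra.of F _ a) ^ (q ^ k + 1) = 1)
    (T := fun m => hS.tauMax m = m ∧ degree F m ∣ k) fun χ => by
      have := finite_quotient_groupAlg (pointIdeal χ)
      rw [← tau_pow_iff_of hq hF hσ hk, hS.forall_tau_eq_iff hσ hq hF hk]
  rw [hcard] at h
  exact h.2.symm

/-- The power sums of the degrees of the self-dual multiplicity functions. -/
theorem sum_degree_orbitWeight
    (hS : IsSesqPair (F := F) σ (algInv (Multiplicative (Fin r → ℤ)) σ))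
    (hσ : ∀ x, σ x = x ^ q) (hq : IsPrimePow q) (hF : Nat.card F = q ^ 2) {k : ℕ} (hk : 0 < k) :
    ∑ᶠ m ∈ {m | orbitWeight (degree F) hS.tauMax m ∣ k}, degree F m =
      if Even k then (q ^ k - 1) ^ r else (q ^ k + 1) ^ r := by
  split_ifs with hek
  -- For `k = 2 * j` an ideal counts exactly when its degree divides `j`: a dual pair has weight
  -- twice the degree, and a self-dual ideal has odd degree, which divides `2 * j` only if it
  -- divides `j`.
  · obtain ⟨j, rfl⟩ := even_iff_two_dvd.1 hek
    rw [pow_mul, ← hF, ← (finite_and_sum_degree (F := F) (r := r) (by omega : 0 < j)).2]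
    refine finsum_mem_congr (Set.ext fun m => iff_of_eq ?_) fun _ _ => rfl
    change (orbitWeight (degree F) hS.tauMax m ∣ 2 * j) = (degree F m ∣ j)
    rw [orbitWeight]
    split_ifs with hm
    · have := finite_quotient_groupAlg m
      exact propext (Nat.Coprime.dvd_mul_left
        (Nat.coprime_two_right.2 (hS.odd_degree hσ hq hF hm)))
    · exact propext (Nat.mul_dvd_mul_iff_left two_pos)
  -- For odd `k` dual pairs drop out, their weight being even.
  · rw [Nat.not_even_iff_odd] at hek
    rw [← sum_degree_selfdual hS hσ hq hF hek]
    refine finsum_mem_congr (Set.ext fun m => iff_of_eq ?_) fun _ _ => rfl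
    change (orbitWeight (degree F) hS.tauMax m ∣ k) = (hS.tauMax m = m ∧ degree F m ∣ k)
    rw [orbitWeight]
    split_ifs with hm
    · simp [hm]
    · refine propext ⟨fun h => absurd (dvd_of_mul_right_dvd h) ?_, fun h => absurd h.1 hm⟩
      rw [← even_iff_two_dvd, Nat.not_even_iff_odd]
      exact hek

theorem sum_degree_double {k : ℕ} (hk : 0 < k) :
    ∑ᶠ m ∈ {m : MaximalSpectrum (GroupAlg F r) |
        orbitWeight (fun i => 2 * degree F i) id m ∣ k}, 2 * degree F m =
      if Even k then 2 * (Nat.card F ^ (k / 2) - 1) ^ r else 0 := by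
  have h0 : ∀ m : MaximalSpectrum (GroupAlg F r),
      orbitWeight (fun i => 2 * degree F i) id m = 2 * degree F m := fun m => if_pos rfl
  simp only [h0]
  split_ifs with hek
  · obtain ⟨j, rfl⟩ := even_iff_two_dvd.1 hek
    have h := finite_and_sum_degree (F := F) (r := r) (by omega : 0 < j)
    simp only [Nat.mul_dvd_mul_iff_left two_pos]
    rw [Nat.mul_div_cancel_left _ two_pos, ← h.2, ← smul_eq_mul, smul_finsum_mem h.1]
    rfl
  · refine finsum_mem_eq_zero_of_forall_eq_zero fun m hm => ?_
    exact absurd (even_iff_two_dvd.2 (dvd_of_mul_right_dvd hm)) hek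

end DegreeSums

open PowerSeries

/-! ### Logarithmic derivatives of power series. -/

section LogDerivative

/-- `f` has constant coefficient one and logarithmic derivative `g`, with respect to `x d/dx`. -/
structure HasLogDeriv (f g : ℚ⟦X⟧) : Prop where
  constantCoeff_eq : constantCoeff f = 1
  deriv_eq : X * derivative ℚ f = f * g

variable {f f' g g' : ℚ⟦X⟧}

theorem coeff_X_mul_derivative (f : ℚ⟦X⟧) (n : ℕ) :
    coeff n (X * derivative ℚ f) = n * coeff n f := by
  cases n with
  | zero => simp
  | succ n =>
    rw [coeff_succ_X_mul, coeff_derivative]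
    push_cast
    ring

theorem hasLogDeriv_mk {a c : ℕ → ℚ} (h0 : a 0 = 1)
    (h : ∀ n : ℕ, n * a n = ∑ p ∈ Finset.HasAntidiagonal.antidiagonal n, a p.1 * c p.2) :
    HasLogDeriv (mk a) (mk c) where
  constantCoeff_eq := by rw [← coeff_zero_eq_constantCoeff_apply, coeff_mk, h0]
  deriv_eq := by
    ext n
    rw [coeff_X_mul_derivative, coeff_mk, h, coeff_mul]
    simp only [coeff_mk]

theorem HasLogDeriv.mul (h : HasLogDeriv f g) (h' : HasLogDeriv f' g') :
    HasLogDeriv (f * f') (g + g') where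
  constantCoeff_eq := by rw [map_mul, h.constantCoeff_eq, h'.constantCoeff_eq, mul_one]
  deriv_eq := by
    rw [Derivation.leibniz, smul_eq_mul, smul_eq_mul]
    linear_combination f * h'.deriv_eq + f' * h.deriv_eq

theorem hasLogDeriv_one : HasLogDeriv 1 0 where
  constantCoeff_eq := map_one _
  deriv_eq := by simp

theorem HasLogDeriv.mul_inv_cancel (h : HasLogDeriv f g) : f * f⁻¹ = 1 :=
  PowerSeries.mul_inv_cancel f (by rw [h.constantCoeff_eq]; exact one_ne_zero)

theorem HasLogDeriv.inv (h : HasLogDeriv f g) : HasLogDeriv f⁻¹ (-g) where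
  constantCoeff_eq := by rw [constantCoeff_inv, h.constantCoeff_eq, inv_one]
  deriv_eq := by
    rw [derivative_inv']
    linear_combination (-f⁻¹ ^ 2) * h.deriv_eq - g * f⁻¹ * h.mul_inv_cancel

theorem HasLogDeriv.pow (h : HasLogDeriv f g) (k : ℕ) : HasLogDeriv (f ^ k) (k • g) := by
  induction k with
  | zero =>
    rw [pow_zero, zero_smul]
    exact hasLogDeriv_one
  | succ k ih =>
    rw [pow_succ, succ_nsmul]
    exact ih.mul h

theorem hasLogDeriv_prod {ι : Type*} (s : Finset ι) {f g : ι → ℚ⟦X⟧}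
    (h : ∀ i, HasLogDeriv (f i) (g i)) : HasLogDeriv (∏ i ∈ s, f i) (∑ i ∈ s, g i) := by
  classical
  induction s using Finset.induction_on with
  | empty =>
    rw [Finset.prod_empty, Finset.sum_empty]
    exact hasLogDeriv_one
  | insert i s hi ih =>
    rw [Finset.prod_insert hi, Finset.sum_insert hi]
    exact (h i).mul ih

theorem HasLogDeriv.rescale (h : HasLogDeriv f g) (s : ℚ) :
    HasLogDeriv (PowerSeries.rescale s f) (PowerSeries.rescale s g) where
  constantCoeff_eq := by
    rw [← coeff_zero_eq_constantCoeff_apply, coeff_rescale, coeff_zero_eq_constantCoeff_apply,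
      h.constantCoeff_eq, pow_zero, one_mul]
  deriv_eq := by
    rw [← map_mul, ← h.deriv_eq]
    ext n
    rw [coeff_X_mul_derivative, coeff_rescale, coeff_rescale, coeff_X_mul_derivative]
    ring

/-- A power series is determined by its constant coefficient and logarithmic derivative. -/
theorem HasLogDeriv.eq (h : HasLogDeriv f g) (h' : HasLogDeriv f' g) : f = f' := by
  have h1 := h.mul h'.inv
  have h2 := h1.deriv_eq
  rw [add_neg_cancel, mul_zero] at h2
  have h3 : f * f'⁻¹ = 1 := by
    apply derivative.ext
    · rw [(mul_eq_zero.1 h2).resolve_left X_ne_zero]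
      simp
    · rw [h1.constantCoeff_eq, map_one]
  linear_combination f' * h3 - f * h'.mul_inv_cancel

theorem hasLogDeriv_one_add (α : ℚ) :
    HasLogDeriv (1 + C α * X) (mk fun k => if k = 0 then 0 else -(-α) ^ k) where
  constantCoeff_eq := by simp
  deriv_eq := by
    ext n
    rw [coeff_X_mul_derivative, add_mul, one_mul, mul_assoc, map_add, map_add, coeff_C_mul,
      coeff_C_mul, coeff_mk]
    rcases n with _ | _ | n
    · simp
    · rw [coeff_succ_X_mul, coeff_mk, coeff_one, coeff_X]
      simp
    · rw [coeff_succ_X_mul, coeff_mk, coeff_one, coeff_X]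
      simp
      ring

end LogDerivative

/-! ### Alternating products of linear factors. -/

section AlternatingProducts

variable {r : ℕ}

/-- The product of the `(1 + α_j x)^{±\binom{r}{j}}` with alternating signs. -/
noncomputable def altProd (r : ℕ) (α : ℕ → ℚ) : ℚ⟦X⟧ :=
  ∏ j ∈ Finset.range (r + 1), if Even j then (1 + C (α j) * X) ^ r.choose j
    else (1 + C (α j) * X)⁻¹ ^ r.choose j

theorem hasLogDeriv_altProd (α : ℕ → ℚ) :
    HasLogDeriv (altProd r α) (mk fun k => if k = 0 then 0 else
      -∑ j ∈ Finset.range (r + 1), (-1) ^ j * r.choose j * (-α j) ^ k) := by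
  have h := hasLogDeriv_prod (Finset.range (r + 1))
    (f := fun j => if Even j then (1 + C (α j) * X) ^ r.choose j
      else (1 + C (α j) * X)⁻¹ ^ r.choose j)
    (g := fun j => mk fun k => if k = 0 then 0 else (-1) ^ j * r.choose j * (-(-α j) ^ k))
    fun j => by
      split_ifs with hj
      · convert (hasLogDeriv_one_add (α j)).pow (r.choose j) using 1
        ext k
        rw [map_nsmul, coeff_mk, coeff_mk, hj.neg_one_pow]
        split_ifs <;> simp
      · convert (hasLogDeriv_one_add (α j)).inv.pow (r.choose j) using 1
        ext k
        rw [map_nsmul, map_neg, coeff_mk, coeff_mk, (Nat.not_even_iff_odd.1 hj).neg_one_pow]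
        split_ifs <;> simp
  rw [altProd]
  convert h using 1
  ext k
  rw [map_sum, coeff_mk]
  simp only [coeff_mk]
  split_ifs
  · simp
  · rw [← Finset.sum_neg_distrib]
    exact Finset.sum_congr rfl fun j _ => by ring

theorem coe_altProd (α : ℕ → ℚ) : ((altProd r α : ℚ⟦X⟧) : LaurentSeries ℚ) =
    ∏ j ∈ Finset.range (r + 1), ((1 + C (α j) * X : ℚ⟦X⟧) : LaurentSeries ℚ) ^
      ((-1) ^ j * (r.choose j : ℤ)) := by
  have hcoe : ∀ f : ℚ⟦X⟧, (f : LaurentSeries ℚ) = HahnSeries.ofPowerSeries ℤ ℚ f := fun f => rfl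
  rw [altProd, hcoe, map_prod]
  refine Finset.prod_congr rfl fun j _ => ?_
  split_ifs with hj
  · rw [hj.neg_one_pow, one_mul, zpow_natCast, map_pow]
  · rw [(Nat.not_even_iff_odd.1 hj).neg_one_pow, neg_one_mul, zpow_neg, zpow_natCast, map_pow,
      ← inv_pow]
    congr 1
    apply eq_inv_of_mul_eq_one_right
    rw [hcoe, ← map_mul, (hasLogDeriv_one_add (α j)).mul_inv_cancel, map_one]

theorem sum_alternating_pow (a : ℚ) (k : ℕ) :
    ∑ j ∈ Finset.range (r + 1), (-1) ^ j * (r.choose j : ℚ) * (a ^ (r - j)) ^ k =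
      (a ^ k - 1) ^ r := by
  rw [sub_eq_neg_add, add_pow]
  refine Finset.sum_congr rfl fun j _ => ?_
  rw [← pow_mul, ← pow_mul, mul_comm k]
  ring

/-- The coefficients of the alternating product are polynomials in the parameter. -/
theorem exists_polynomial_coeff_altProd (r n : ℕ) : ∃ P : Polynomial ℤ, ∀ a : ℤ,
    coeff n (altProd r fun j => -(a : ℚ) ^ (r - j)) = ((P.eval a : ℤ) : ℚ) := by
  -- The product is formed over the ring of integer polynomials, where the factors are invertible
  -- because their constant term is 1, and is then specialized at `a`.
  let g : ℕ → (Polynomial ℤ)⟦X⟧ := fun j => 1 + C (-Polynomial.X ^ (r - j)) * X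
  let G : (Polynomial ℤ)⟦X⟧ := ∏ j ∈ Finset.range (r + 1),
    if Even j then g j ^ r.choose j else invOfUnit (g j) 1 ^ r.choose j
  refine ⟨coeff n G, fun a => ?_⟩
  let φ : Polynomial ℤ →+* ℚ := (Int.castRingHom ℚ).comp (Polynomial.evalRingHom a)
  have hg : ∀ j, map φ (g j) = 1 + C (-(a : ℚ) ^ (r - j)) * X := fun j => by
    simp [g, φ]
  have hG : map φ G = altProd r fun j => -(a : ℚ) ^ (r - j) := by
    rw [altProd, map_prod]
    refine Finset.prod_congr rfl fun j _ => ?_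
    split_ifs
    · rw [map_pow, hg]
    · rw [map_pow]
      congr 1
      rw [eq_inv_iff_mul_eq_one (by simp), ← hg, ← map_mul, mul_comm, mul_invOfUnit _ _ (by simp [g]),
        map_one]
  rw [← hG, coeff_map]
  rfl

end AlternatingProducts

/-! ### The generating functions of both families. -/

section GeneratingFunctions

variable {r : ℕ}

theorem hasLogDeriv_card {I : Type*} {w : I → ℕ} {t : I → I} (hw : ∀ i, 0 < w i)
    (hfin : ∀ n, {i | w i ≤ n}.Finite) (ht : Function.Involutive t) (hwt : ∀ i, w (t i) = w i)
    {c : ℕ → ℕ} (hc0 : c 0 = 0)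
    (hc : ∀ k, 0 < k → ∑ᶠ i ∈ {i | orbitWeight w t i ∣ k}, w i = c k) :
    HasLogDeriv (mk fun n => ((symFinset w t n).card : ℚ)) (mk fun k => (c k : ℚ)) := by
  refine hasLogDeriv_mk ?_ fun n => ?_
  · rw [symFinset_zero hw hfin, Finset.card_singleton, Nat.cast_one]
  · exact_mod_cast mul_card_symFinset hw hfin ht hwt hc0 (fun k hk => (hc k hk).symm) n

/-- The series is the inverse of the one counting all multiplicity functions, whose logarithmic
derivative has coefficients `(|K| ^ k - 1) ^ r`. Expanding by the binomial theorem identifies the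
product. -/
theorem mk_chiGL_eq (K : Type*) [Field K] [Finite K] (r : ℕ) :
    (mk fun n => if n = 0 then 1 else chiGL K (r + 1) n) =
      altProd r fun j => -(Nat.card K : ℚ) ^ (r - j) := by
  let w : MaximalSpectrum (GroupAlg K r) → ℕ := degree K
  have hw : ∀ m, 0 < w m := degree_pos
  have hfin : ∀ n, {m | w m ≤ n}.Finite := finite_degree_le
  have hA := hasLogDeriv_card (t := id) hw hfin (fun _ => rfl) (fun _ => rfl)
    (c := fun k => if k = 0 then 0 else (Nat.card K ^ k - 1) ^ r) rfl fun k hk => by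
      rw [if_neg hk.ne', ← (finite_and_sum_degree (F := K) (r := r) hk).2]
      refine finsum_mem_congr (Set.ext fun m => ?_) fun _ _ => rfl
      exact iff_of_eq (congrArg (· ∣ k) (if_pos rfl))
  have hAF : (mk fun n => ((symFinset w id n).card : ℚ)) *
      (mk fun n => if n = 0 then 1 else chiGL K (r + 1) n) = 1 := by
    ext n
    rw [coeff_mul, coeff_one]
    have h := sum_card_mul_sum_multMoebius hw hfin n
    have h' := congrArg (Int.cast : ℤ → ℚ) h
    push_cast at h'
    rw [← h']
    refine Finset.sum_congr rfl fun p _ => ?_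
    rw [coeff_mk, coeff_mk]
    congr 1
    split_ifs with hp
    · rw [hp, symFinset_zero hw hfin, Finset.sum_singleton, multMoebius, if_pos rfl, Int.cast_one]
    · rw [chiGL_succ_eq_sum (symFinset w id p.2) fun M => mem_symFinset_id hw hfin, Int.cast_sum]
      refine Finset.sum_congr rfl fun M hM => ?_
      rw [multMoebius, if_neg]
      rintro rfl
      rw [mem_symFinset_id hw hfin, weight_zero] at hM
      exact hp hM.symm
  have h1 : (mk fun n => if n = 0 then 1 else chiGL K (r + 1) n) =
      (mk fun n => ((symFinset w id n).card : ℚ))⁻¹ := by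
    rw [eq_inv_iff_mul_eq_one (by rw [hA.constantCoeff_eq]; exact one_ne_zero), mul_comm, hAF]
  rw [h1]
  refine hA.inv.eq ?_
  convert hasLogDeriv_altProd (r := r) fun j => -(Nat.card K : ℚ) ^ (r - j) using 1
  ext k
  rw [map_neg, coeff_mk, coeff_mk]
  simp only [neg_neg]
  rw [sum_alternating_pow]
  split_ifs
  · simp
  · rw [Nat.cast_pow, Nat.cast_sub (Nat.one_le_pow _ _ Nat.card_pos)]
    push_cast
    rfl

variable {F : Type*} [Field F] [Finite F] {q : ℕ} {σ : F →+* F}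

/-- The logarithmic derivative of the generating function of the unitary groups. -/
theorem hasLogDeriv_isotropic (hq : IsPrimePow q) (hF : Nat.card F = q ^ 2)
    (hσ : ∀ x, σ x = x ^ q)
    (hS : IsSesqPair (F := F) σ (algInv (Multiplicative (Fin r → ℤ)) σ)) :
    HasLogDeriv (mk fun n =>
        ((∑ M ∈ symFinset (degree F) hS.tauMax n, isotropicEuler hS.tauMax M : ℤ) : ℚ))
      (mk fun k => if k = 0 then 0 else if Even k then -((q : ℚ) ^ k - 1) ^ r
        else ((q : ℚ) ^ k + 1) ^ r) := by
  let w : MaximalSpectrum (GroupAlg F r) → ℕ := degree F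
  have hw : ∀ m, 0 < w m := degree_pos
  have hfin : ∀ n, {m | w m ≤ n}.Finite := finite_degree_le
  have hw2 : ∀ m, 0 < 2 * w m := fun m => Nat.mul_pos two_pos (hw m)
  have hfin2 : ∀ n, {m | 2 * w m ≤ n}.Finite := fun n =>
    (hfin n).subset fun m (hm : 2 * w m ≤ n) => by
      change w m ≤ n
      omega
  have ht : Function.Involutive hS.tauMax := hS.tauMax_tauMax
  have hwt : ∀ m, w (hS.tauMax m) = w m := hS.degree_tauMax finite_quotient_groupAlg
  have hB := hasLogDeriv_card hw hfin ht hwt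
    (c := fun k => if k = 0 then 0 else if Even k then (q ^ k - 1) ^ r else (q ^ k + 1) ^ r) rfl
    fun k hk => by rw [if_neg hk.ne', sum_degree_orbitWeight hS hσ hq hF hk]
  have hA := hasLogDeriv_card (t := id) hw2 hfin2 (fun _ => rfl) (fun _ => rfl)
    (c := fun k => if k = 0 then 0 else if Even k then 2 * (q ^ k - 1) ^ r else 0) rfl
    fun k hk => by
      rw [if_neg hk.ne', sum_degree_double hk, hF]
      split_ifs with hek
      · rw [← pow_mul, Nat.mul_div_cancel' (even_iff_two_dvd.1 hek)]
      · rfl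
  have hAE : (mk fun n => ((symFinset (fun m => 2 * w m) id n).card : ℚ)) *
      (mk fun n => ((∑ M ∈ symFinset w hS.tauMax n, isotropicEuler hS.tauMax M : ℤ) : ℚ)) =
      mk fun n => ((symFinset w hS.tauMax n).card : ℚ) := by
    ext n
    rw [coeff_mul, coeff_mk]
    simp only [coeff_mk]
    exact_mod_cast sum_card_mul_sum_isotropic hw hfin ht hwt n
  -- The series is the quotient of the one counting self-dual functions by the one counting all
  -- functions with doubled weight. Even coefficients of the logarithmic derivative become `(q ^ k -
  -- 1) ^ r - 2 * (q ^ k - 1) ^ r`; the denominator does not affect odd ones.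
  have hE : (mk fun n => ((∑ M ∈ symFinset w hS.tauMax n, isotropicEuler hS.tauMax M : ℤ) : ℚ)) =
      (mk fun n => ((symFinset w hS.tauMax n).card : ℚ)) *
        (mk fun n => ((symFinset (fun m => 2 * w m) id n).card : ℚ))⁻¹ := by
    rw [← hAE]
    linear_combination (-(mk fun n =>
      ((∑ M ∈ symFinset w hS.tauMax n, isotropicEuler hS.tauMax M : ℤ) : ℚ))) * hA.mul_inv_cancel
  convert hB.mul hA.inv using 1
  ext k
  rw [map_add, map_neg, coeff_mk, coeff_mk, coeff_mk]
  have hqk : 1 ≤ q ^ k := Nat.one_le_pow _ _ hq.pos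
  split_ifs
  · simp
  · push_cast [Nat.cast_sub hqk]
    ring
  · push_cast
    ring

theorem neg_chiGU_eq_sum (hq : IsPrimePow q) (hσ : ∀ x, σ x = x ^ q)
    (hS : IsSesqPair (F := F) σ (algInv (Multiplicative (Fin r → ℤ)) σ)) {n : ℕ} {c : F}
    (hc : c ^ (q - 1) = (-1) ^ (n + 1)) : -chiGU (r + 1) q n c =
      ((∑ M ∈ symFinset (degree F) hS.tauMax n, isotropicEuler hS.tauMax M : ℤ) : ℚ) := by
  rw [chiGU_succ_eq_sum hS (isHerm_hermForm hq.one_lt hσ hS.sigma_sigma hc)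
    (symFinset (degree F) hS.tauMax n) fun M => mem_symFinset degree_pos finite_degree_le,
    ← Int.cast_neg, ← Finset.sum_neg_distrib]
  rfl

theorem exists_isSesqPair (hq : IsPrimePow q) (hF : Nat.card F = q ^ 2) (r : ℕ) :
    ∃ σ : F →+* F, (∀ x, σ x = x ^ q) ∧
      IsSesqPair (F := F) σ (algInv (Multiplicative (Fin r → ℤ)) σ) := by
  obtain ⟨σ, hσ⟩ := exists_pow_ringHom F (E := F) hq two_ne_zero hF 1
  rw [pow_one] at hσ
  refine ⟨σ, hσ, isSesqPair_algInv (fun x => ?_) ?_⟩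
  · rw [hσ, hσ, pow_pow_eq_self hF]
  · simpa only [hσ] using exists_pow_ne_self hq.one_lt hF

/-- The generating function of the unitary groups, up to its constant term, as an alternating
product. -/
theorem neg_chiGU_eq_coeff (hq : IsPrimePow q) (hF : Nat.card F = q ^ 2) {n : ℕ} {c : F}
    (hc : c ^ (q - 1) = (-1) ^ (n + 1)) : -chiGU (r + 1) q n c =
      coeff n (altProd r fun j => (-1) ^ j * (q : ℚ) ^ (r - j)) := by
  obtain ⟨σ, hσ, hS⟩ := exists_isSesqPair hq hF r
  rw [neg_chiGU_eq_sum hq hσ hS hc, ← coeff_mk n fun n =>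
    ((∑ M ∈ symFinset (degree F) hS.tauMax n, isotropicEuler hS.tauMax M : ℤ) : ℚ)]
  congr 1
  refine (hasLogDeriv_isotropic hq hF hσ hS).eq ?_
  convert hasLogDeriv_altProd (r := r) fun j => (-1) ^ j * (q : ℚ) ^ (r - j) using 1
  ext k
  rw [coeff_mk, coeff_mk]
  split_ifs with hk hek
  · rfl
  · simp only [hek.neg_pow, mul_pow, ← pow_mul, (hek.mul_left _).neg_one_pow, one_mul]
    simp only [pow_mul]
    rw [sum_alternating_pow]
  -- For odd `k` the signs `(-1) ^ j` survive the `k`-th power and cancel those of the alternating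
  -- sum, leaving the expansion of `(q ^ k + 1) ^ r`.
  · rw [Nat.not_even_iff_odd] at hek
    rw [add_comm, add_pow, ← Finset.sum_neg_distrib]
    refine Finset.sum_congr rfl fun j _ => ?_
    have h : ((-1 : ℚ) ^ j) * (-1) ^ j = 1 := by rw [← mul_pow]; norm_num
    have h' : (((-1 : ℚ) ^ j) ^ k) = (-1) ^ j := by rw [pow_right_comm, hek.neg_one_pow]
    rw [hek.neg_pow, mul_pow, h', one_pow, ← pow_mul, ← pow_mul, mul_comm k]
    linear_combination (-(r.choose j : ℚ) * (q : ℚ) ^ ((r - j) * k)) * h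

/-- Changing the sign of the parameter rescales the alternating product. -/
theorem altProd_neg (r : ℕ) (a : ℚ) : (altProd r fun j => (-1) ^ j * a ^ (r - j)) =
    rescale ((-1) ^ (r + 1)) (altProd r fun j => -(-a) ^ (r - j)) := by
  refine (hasLogDeriv_altProd _).eq ?_
  convert (hasLogDeriv_altProd (r := r) fun j => -(-a) ^ (r - j)).rescale ((-1) ^ (r + 1)) using 1
  ext k
  rw [coeff_mk, coeff_rescale, coeff_mk]
  split_ifs
  · simp
  · rw [mul_neg, Finset.mul_sum]
    congr 1
    refine Finset.sum_congr rfl fun j hj => ?_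
    have hj' : r = r - j + j := (Nat.sub_add_cancel (Finset.mem_range_succ_iff.1 hj)).symm
    -- The parameters of the two products differ by the factor `(-1) ^ (r + 1)`, independent of `j`,
    -- because `(-1) ^ r * (-1) ^ (r - j) = (-1) ^ j`.
    have h : -((-1) ^ j * a ^ (r - j)) = (-1) ^ (r + 1) * (- -(-a) ^ (r - j)) := by
      have h1 : ((-1 : ℚ) ^ (r - j)) * (-1) ^ (r - j) = 1 := by rw [← mul_pow]; norm_num
      rw [neg_neg, neg_pow a, pow_succ]
      nth_rewrite 2 [hj']
      rw [pow_add]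
      linear_combination ((-1) ^ j * a ^ (r - j)) * h1
    rw [h, mul_pow]
    ring

end GeneratingFunctions

end UnitaryBuilding

theorem theorem1p1 (r : ℕ) :
    (∀ (q : ℕ) (F : Type*) [Field F] [Finite F] (c : ℕ → F), IsPrimePow q → Nat.card F = q ^ 2 →
      (∀ n, 1 ≤ n → c n ^ (q - 1) = (-1) ^ (n + 1)) →
      ((UnitaryBuilding.FGLminus (r + 1) q c : PowerSeries ℚ) : LaurentSeries ℚ) =
        ∏ j ∈ Finset.range (r + 1),
          ((1 + PowerSeries.C ((-1) ^ j * (q : ℚ) ^ (r - j)) * PowerSeries.X : PowerSeries ℚ) :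
            LaurentSeries ℚ) ^ ((-1) ^ j * (r.choose j : ℤ))) ∧
    (∀ n : ℕ, 1 ≤ n → ∃ P : Polynomial ℤ,
      (∀ (q : ℕ) (K : Type*) [Field K] [Finite K], IsPrimePow q → Nat.card K = q →
        UnitaryBuilding.chiGL K (r + 1) n = ((P.eval (q : ℤ) : ℤ) : ℚ)) ∧
      (∀ (q : ℕ) (F : Type*) [Field F] [Finite F] (c : F), IsPrimePow q → Nat.card F = q ^ 2 →
        c ^ (q - 1) = (-1) ^ (n + 1) →
        UnitaryBuilding.chiGU (r + 1) q n c =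
          -(-1) ^ (n * (r + 1)) * ((P.eval (-(q : ℤ)) : ℤ) : ℚ))) := by
  constructor
  · intro q F _ _ c hq hF hc
    rw [← UnitaryBuilding.coe_altProd]
    congr 1
    ext n
    rw [UnitaryBuilding.FGLminus, map_sub, PowerSeries.coeff_mk, PowerSeries.coeff_one]
    split_ifs with hn
    · rw [hn, PowerSeries.coeff_zero_eq_constantCoeff_apply,
        (UnitaryBuilding.hasLogDeriv_altProd _).constantCoeff_eq, sub_zero]
    · rw [zero_sub, UnitaryBuilding.neg_chiGU_eq_coeff hq hF (hc n (Nat.one_le_iff_ne_zero.2 hn))]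
  · intro n hn
    obtain ⟨P, hP⟩ := UnitaryBuilding.exists_polynomial_coeff_altProd r n
    refine ⟨P, fun q K _ _ _ hK => ?_, fun q F _ _ c hq hF hc => ?_⟩
    · have h := congrArg (PowerSeries.coeff n) (UnitaryBuilding.mk_chiGL_eq K r)
      rw [PowerSeries.coeff_mk, if_neg (Nat.one_le_iff_ne_zero.1 hn), hK] at h
      rw [h, ← hP]
      rfl
    -- The unitary product is the linear one with parameter `-q`, rescaled by `(-1) ^ (r + 1)`. The
    -- `n`-th power of this scale is the sign in the claim.
    · rw [← hP, ← neg_neg (UnitaryBuilding.chiGU _ _ _ _),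
        UnitaryBuilding.neg_chiGU_eq_coeff hq hF hc, UnitaryBuilding.altProd_neg,
        PowerSeries.coeff_rescale, ← pow_mul, mul_comm (r + 1), neg_mul]
      push_cast
      rfl
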